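/- **Setting.** Consider general relativity with a minimally coupled scalar field $\varphi$ (smooth potential $V$, coupling $\lambda_\varphi\neq0$, $\kappa=16\pi G>0$; $V$ is twice the usual potential) on the extended ADM phase space with variables $(q_{ab},P^{ab})$, $(\varphi,\pi_\varphi)$, $(N,\Pi)$, $(N^a,\Pi_a)$ over $\mathbb R^3$, with brackets $\{q_{ab}(x),P^{cd}(y)\}=\kappa\,\delta^c_{(a}\delta^d_{b)}\delta(x,y)$, $\{\varphi(x),\pi_\varphi(y)\}=\delta(x,y)$, constraints $\Pi$, $\Pi_a$, $$C=\tfrac{1}{\sqrt q}\big(P_{ab}P^{ab}-\tfrac12P^2\big)-\sqrt q\,R+\kappa\Big(\tfrac{\lambda_\varphi\pi_\varphi^2}{2\sqrt q}+\tfrac{\sqrt q}{2\lambda_\varphi}\big(q^{ab}\partial_a\varphi\,\partial_b\varphi+V(\varphi)\big)\Big),\qquad C_a=-2q_{ac}D_bP^{bc}+\kappa\pi_\varphi\partial_a\varphi ,$$ and dynamics generated by $\int(NC+N^aC_a+\lambda\Pi+\lambda^a\Pi_a)$, normalized so that $q_{ab},P^{ab},\varphi,\pi_\varphi$ obey the ADM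 evolution equations with lapse $N$ and shift $N^a$, and $\dot N=\lambda$, $\dot N^a=\lambda^a$, $\dot\Pi=-C$, $\dot\Pi_a=-C_a$. On an open set $I$ of times let $q_{ab}=A\delta_{ab}$, $P^{ab}=\tilde P\delta^{ab}$, $N=\bar N$, $N^a=0$, $\varphi=\bar\varphi$, $\pi_\varphi=\bar\pi_\varphi$, $\Pi=\Pi_a=0$ (functions of $t$ only) be a smooth solution of these equations and constraints with $A>0$, $\bar N>0$, $\dot A\ne0$. Put $\tilde{\mathcal H}=\dot A/(2A)$ and $p=\frac12\big(\lambda_\varphi\bar\pi_\varphi^2/A^3-V(\bar\varphi)/\lambda_\varphi\big)$. Write perturbations as $$\delta q_{ab}=2A\big(\psi\delta_{ab}+E_{,<ab>}+F_{(a,b)}+\tfrac12h^{TT}_{ab}\big),\quad \delta P^{ab}=2\tilde P\big(p_\psi\delta^{ab}+p_E^{,<ab>}+p_F^{(a,b)}+\tfrac12p_{h}^{ab}\big),$$ $$\delta N=\bar N\phi,\quad \delta N^a=B^{,a}+S^a,\quad\delta\Pi=\bar Np_\phi,\quad \delta\Pi_a=p_{B,a}+p_{S\,a},$$ together with $\delta\varphi,\delta\pi_\varphi$,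 where $E_{,<ab>}=E_{,ab}-\frac13\delta_{ab}\Delta E$, $\Delta$ is the Laplacian of $\delta_{ab}$, $F,p_F,S,p_S$ are divergence-free, $h^{TT},p_h$ are symmetric, trace-free and divergence-free, and all components are smooth in $(t,x)$ and decay at spatial infinity together with their first time derivatives (in each case with all spatial derivatives). Let $G^\mu=-T^\mu$ with the linearized geometrical clocks of the longitudinal gauge $$\delta T^0=2\tilde P\sqrt A\,(E+p_E),\qquad \delta T^a=\delta^{ab}(E_{,b}+F_b),$$ let $\mathcal B$ be the inverse of $\mathcal A^\mu_\nu=\{T^\mu,C_\nu\}$ at the background, and let the linearized Dirac observable of a phase space function $f$ be $$\mathcal O_f=\delta f+\overline{\{f,C_\nu\}}\,(\mathcal B\,\delta G)^\nu+\overline{\{f,\Pi_\nu\}}\,\Big(\mathcal B\big(\delta\dot G-\overline{\{\dot T,C_\rho\}}\,(\mathcal B\,\delta G)^\rho\big)\Big)^\nu ,$$ where $C_\nu=(C,C_a)$, $\Pi_\nu=(\Pi,\Pi_a)$, sums and spatial integrals are understood, the brackets with $C_\nu$ and $\Pi_\nu$ are normalized so that smearing them with $(n,v^a)$ gives, respectively,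 the ADM evolution with lapse $n$ and shift $v^a$, and the displacement $(\delta N,\delta N^a)=(n,v^a)$. Let $\approx$ mean equality along every solution of the linearized canonical equations (with arbitrary multipliers $\delta\lambda,\delta\lambda^a$) that satisfies all linearized constraints. Set $$\Psi=\psi+\tfrac{4\tilde{\mathcal H}^2A}{\bar N^2}(E+p_E)-\tfrac13\Delta E,\qquad \Upsilon=p_\psi+\tfrac12\Delta E+\tfrac23\Delta p_E-\Big(\tfrac{\tilde{\mathcal H}^2A}{\bar N^2}+\tfrac{\kappa A}{2}p\Big)(E+p_E),$$ $$\nu^a=p_F^a+\delta^{ab}F_b,\qquad \digamma=\frac{10\tilde{\mathcal H}^2+\kappa\bar N^2p}{4\tilde{\mathcal H}},\qquad \delta\varphi^{(gi)}=\mathcal O_{\delta\varphi},\quad\delta\pi_\varphi^{(gi)}=\mathcal O_{\delta\pi_\varphi},$$ $$\delta\tilde T^{(gi)}=-3\lambda_\varphi\tfrac{\bar\pi_\varphi^2}{A^3}\Psi+\lambda_\varphi\tfrac{\bar\pi_\varphi}{A^3}\delta\pi_\varphi^{(gi)}-\tfrac1{2\lambda_\varphi}V'(\bar\varphi)\,\delta\varphi^{(gi)}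 .$$ **Claim.** For all $t\in I$: (i) $\mathcal O_\psi\approx\Psi$, $\mathcal O_\phi\approx-\Psi$, $\mathcal O_{p_\psi}\approx\Upsilon$, $\mathcal O_{p_F^a}\approx\nu^a$, $\mathcal O_{S^a}\approx4\tilde{\mathcal H}\nu^a$, $\mathcal O_E,\mathcal O_{p_E},\mathcal O_{F_a},\mathcal O_B\approx0$, and $\mathcal O_{p_\phi}\approx p_\phi$, $\mathcal O_{p_B}\approx p_B$, $\mathcal O_{p_S^a}\approx p_S^a$. (ii) The observables obey the gauge-invariant Hamilton equations $$\dot{\mathcal O}_\psi\approx2\tilde{\mathcal H}(\Upsilon-\Psi),\qquad \dot{\mathcal O}_{\phi}\approx2\tilde{\mathcal H}(\Psi-\Upsilon),$$ $$\dot{\mathcal O}_{p_\psi}\approx\Big(-\tfrac{\tilde{\mathcal H}}2+\tfrac\kappa4\tfrac{\bar N^2p}{\tilde{\mathcal H}}\Big)\Upsilon+\tfrac{\tilde{\mathcal H}}2\Psi-\tfrac\kappa8\tfrac{\bar N^2}{\tilde{\mathcal H}}\delta\tilde T^{(gi)},$$ $$\dot{\mathcal O}_{p_F^a}\approx(\digamma-4\tilde{\mathcal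 H})\nu^a,\qquad \dot{\mathcal O}_{S^a}\approx(4\dot{\tilde{\mathcal H}}-16\tilde{\mathcal H}^2+4\digamma\tilde{\mathcal H})\nu^a,$$ $$\dot{\mathcal O}_{\delta\varphi}\approx\bar N\tfrac{\lambda_\varphi}{A^{3/2}}\big(-4\bar\pi_\varphi\Psi+\delta\pi_\varphi^{(gi)}\big),$$ $$\dot{\mathcal O}_{\delta\pi_\varphi}\approx-\bar N\tfrac{A^{3/2}}{\lambda_\varphi}\Big(V'(\bar\varphi)\Psi-\tfrac1A\Delta\delta\varphi^{(gi)}+\tfrac12V''(\bar\varphi)\,\delta\varphi^{(gi)}\Big),$$ and the time derivatives of $\mathcal O_E,\mathcal O_{p_E},\mathcal O_{F_a},\mathcal O_B,\mathcal O_{p_\phi},\mathcal O_{p_B},\mathcal O_{p_S^a}$ vanish weakly. (iii) Wherever $\dot{\bar\varphi}\neq0$, the Bardeen potential obeys the closed equation $$\ddot\Psi\approx\frac{\bar N^2}{A}\Delta\Psi+\Big(\frac\kappa2\bar N^2p-\frac{\bar N^2\tilde{\mathcal H}}{\dot{\bar\varphi}}V'(\bar\varphi)-3\tilde{\mathcal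 H}^2\Big)\Psi+\Big(\frac{\dot{\bar N}}{\bar N}-7\tilde{\mathcal H}-\frac{\bar N^2}{\dot{\bar\varphi}}V'(\bar\varphi)\Big)\dot\Psi .$$ (iv) If $\bar N=\sqrt A$ on $I$ (conformal time), then wherever $\dot{\bar\varphi}\neq0$ this is the Lagrangian equation $$\ddot\Psi+2\Big(\tilde{\mathcal H}-\frac{\ddot{\bar\varphi}}{\dot{\bar\varphi}}\Big)\dot\Psi-\Delta\Psi+2\Big(\dot{\tilde{\mathcal H}}-\tilde{\mathcal H}\frac{\ddot{\bar\varphi}}{\dot{\bar\varphi}}\Big)\Psi\approx0 .$$ -/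

import Mathlib

open Filter Topology
open scoped ContDiff

noncomputable section

namespace Cosmo

/-- Coordinate space `ℝ³`. -/
abbrev E3 := EuclideanSpace ℝ (Fin 3)

abbrev Mat3 := Matrix (Fin 3) (Fin 3) ℝ

/-- Partial derivative `∂_i f`. -/
def pd (i : Fin 3) (f : E3 → ℝ) : E3 → ℝ :=
  fun x => fderiv ℝ f x (EuclideanSpace.single i 1)

/-- Laplacian with respect to the flat metric `δ_ab`. -/
def lap (f : E3 → ℝ) : E3 → ℝ := fun x => ∑ i, pd i (pd i f) x

/-- Flat divergence of a vector field. -/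
def divergence (v : E3 → Fin 3 → ℝ) : E3 → ℝ := fun x => ∑ i, pd i (fun y => v y i) x

/-- Smooth functions that tend to zero at infinity together with all their partial derivatives. -/
def Decays (f : E3 → ℝ) : Prop :=
  ContDiff ℝ ∞ f ∧
    ∀ l : List (Fin 3), Tendsto (l.foldr pd f) (cocompact E3) (𝓝 0)

/-- Kronecker delta. -/
def kron (a b : Fin 3) : ℝ := if a = b then 1 else 0

/-! ### The extended ADM phase space of gravity with a minimally coupled scalar field -/

/-- The coupling constants `κ`, `λ_φ` and the potential `V`. -/
structure Model where
  kappa : ℝ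
  lam : ℝ
  V : ℝ → ℝ

/-- A point of the extended ADM phase space (or a tangent vector to it, i.e. a perturbation):
spatial metric `q_ab` and its momentum `P^{ab}`, scalar field and its momentum, lapse, shift and
their momenta `Π`, `Π_a`.  The momenta are densities, written in Cartesian coordinates. -/
structure ADM where
  q : E3 → Mat3
  P : E3 → Mat3
  field : E3 → ℝ
  mom : E3 → ℝ
  N : E3 → ℝ
  Nv : E3 → Fin 3 → ℝ
  Pi : E3 → ℝ
  Piv : E3 → Fin 3 → ℝ

instance : Add ADM where
  add X Y :=
    { q := X.q + Y.q, P := X.P + Y.P, field := X.field + Y.field, mom := X.mom + Y.mom,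
      N := X.N + Y.N, Nv := X.Nv + Y.Nv, Pi := X.Pi + Y.Pi, Piv := X.Piv + Y.Piv }

instance : SMul ℝ ADM where
  smul c X :=
    { q := c • X.q, P := c • X.P, field := c • X.field, mom := c • X.mom,
      N := c • X.N, Nv := c • X.Nv, Pi := c • X.Pi, Piv := c • X.Piv }

/-- A lapse-type function and a shift-type vector field: smearing functions of the constraints
(descriptors), values of the four clocks, or Lagrange multipliers. -/
structure Descriptor where
  n : E3 → ℝ
  v : E3 → Fin 3 → ℝ

instance : Add Descriptor where
  add c d := { n := c.n + d.n, v := c.v + d.v }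

instance : SMul ℝ Descriptor where
  smul r d := { n := r • d.n, v := r • d.v }

instance : Inhabited Descriptor where
  default := { n := 0, v := 0 }

/-- Square root of the determinant of the metric. -/
def sqrtDet (q : E3 → Mat3) (x : E3) : ℝ := Real.sqrt (q x).det

/-- Christoffel symbols `Γ^c_{ab}`. -/
def christoffel (q : E3 → Mat3) (c a b : Fin 3) (x : E3) : ℝ :=
  (1 / 2) * ∑ d, (q x)⁻¹ c d *
    (pd a (fun y => q y b d) x + pd b (fun y => q y a d) x - pd d (fun y => q y a b) x)

/-- Ricci tensor `R_{ab}`. -/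
def ricci (q : E3 → Mat3) (x : E3) : Mat3 :=
  Matrix.of fun a b =>
    (∑ c, pd c (christoffel q c a b) x) - (∑ c, pd b (christoffel q c a c) x)
      + ∑ c, ∑ d, (christoffel q c c d x * christoffel q d a b x
          - christoffel q c b d x * christoffel q d a c x)

/-- Scalar curvature. -/
def scalarCurv (q : E3 → Mat3) (x : E3) : ℝ := ((q x)⁻¹ * ricci q x).trace

/-- Covariant Hessian `D_a D_b n`. -/
def covHess (q : E3 → Mat3) (n : E3 → ℝ) (x : E3) : Mat3 :=
  Matrix.of fun a b => pd a (pd b n) x - ∑ c, christoffel q c a b x * pd c n x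

/-- `q^{ab} ∂_b f`. -/
def gradUp (q : E3 → Mat3) (f : E3 → ℝ) (x : E3) (a : Fin 3) : ℝ :=
  ∑ b, (q x)⁻¹ a b * pd b f x

/-- `q^{ab} ∂_a f ∂_b f`. -/
def gradSq (q : E3 → Mat3) (f : E3 → ℝ) (x : E3) : ℝ := ∑ a, pd a f x * gradUp q f x a

/-- The trace `P = q_ab P^{ab}`. -/
def trP (X : ADM) (x : E3) : ℝ := (X.q x * X.P x).trace

/-- `P_{ab} P^{ab} - P²/2`. -/
def kinP (X : ADM) (x : E3) : ℝ :=
  (X.q x * X.P x * X.q x * X.P x).trace - (1 / 2) * trP X x ^ 2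

/-- The total Hamiltonian constraint
`(P_{ab}P^{ab} - P²/2)/√q - √q R + κ (λ_φ π²/(2√q) + √q (q^{ab}∂_aφ∂_bφ + V(φ))/(2λ_φ))`. -/
def hamC (M : Model) (X : ADM) (x : E3) : ℝ :=
  kinP X x / sqrtDet X.q x - sqrtDet X.q x * scalarCurv X.q x
    + M.kappa * (M.lam * X.mom x ^ 2 / (2 * sqrtDet X.q x)
        + sqrtDet X.q x * (gradSq X.q X.field x + M.V (X.field x)) / (2 * M.lam))

/-- The total spatial diffeomorphism constraint `-2 q_{ac} D_b P^{bc} + κ π ∂_a φ`, written out as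
`-2 ∂_b (q_{ac} P^{bc}) + P^{bc} ∂_a q_{bc} + κ π ∂_a φ`. -/
def diffC (M : Model) (X : ADM) (x : E3) (a : Fin 3) : ℝ :=
  -2 * (∑ b, pd b (fun y => ∑ c, X.q y a c * X.P y b c) x)
    + (∑ b, ∑ c, X.P x b c * pd a (fun y => X.q y b c) x)
    + M.kappa * X.mom x * pd a X.field x

/-- The Hamiltonian vector field of the smeared secondary constraints
`C[d] = κ⁻¹ ∫ (n C + v^a C_a)`, i.e. the Poisson brackets `{· , C[d]}` of the phase space
coordinates, where `{q_ab(x), P^{cd}(y)} = κ δ^c_(a δ^d_b) δ(x,y)` and `{φ(x), π(y)} = δ(x,y)`.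
These are the ADM evolution equations with lapse `n` and shift `v`:
* `{q_ab, C[d]} = (2n/√q)(P_ab - q_ab P/2) + (L_v q)_ab`,
* `{P^ab, C[d]} = (n/(2√q)) q^{ab} (P_cd P^cd - P²/2) - (2n/√q)(P^{ac}P_c^b - P P^{ab}/2)
    - n√q (R^{ab} - q^{ab}R/2) + √q (D^aD^b n - q^{ab} D²n)
    + κ n (q^{ab} λ_φ π²/(4√q) - √q q^{ab} ((∂φ)² + V)/(4λ_φ) + √q ∂^aφ ∂^bφ/(2λ_φ))
    + (L_v P)^{ab}`,
* `{φ, C[d]} = n λ_φ π/√q + v^a ∂_a φ`,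
* `{π, C[d]} = ∂_a (n √q q^{ab} ∂_b φ/λ_φ) - n √q V'(φ)/(2λ_φ) + ∂_a (v^a π)`. -/
def secVF (M : Model) (d : Descriptor) (X : ADM) : ADM where
  q x := Matrix.of fun a b =>
    2 * d.n x / sqrtDet X.q x * ((X.q x * X.P x * X.q x) a b - (1 / 2) * trP X x * X.q x a b)
      + ∑ c, (d.v x c * pd c (fun y => X.q y a b) x
          + X.q x c b * pd a (fun y => d.v y c) x + X.q x a c * pd b (fun y => d.v y c) x)
  P x := Matrix.of fun a b =>
    d.n x / (2 * sqrtDet X.q x) * kinP X x * (X.q x)⁻¹ a b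
      - 2 * d.n x / sqrtDet X.q x
          * ((X.P x * X.q x * X.P x) a b - (1 / 2) * trP X x * X.P x a b)
      - d.n x * sqrtDet X.q x
          * (((X.q x)⁻¹ * ricci X.q x * (X.q x)⁻¹) a b
              - (1 / 2) * scalarCurv X.q x * (X.q x)⁻¹ a b)
      + sqrtDet X.q x
          * (((X.q x)⁻¹ * covHess X.q d.n x * (X.q x)⁻¹) a b
              - ((X.q x)⁻¹ * covHess X.q d.n x).trace * (X.q x)⁻¹ a b)
      + M.kappa * d.n x
          * (M.lam * X.mom x ^ 2 / (4 * sqrtDet X.q x) * (X.q x)⁻¹ a b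
              - sqrtDet X.q x * (gradSq X.q X.field x + M.V (X.field x)) / (4 * M.lam)
                  * (X.q x)⁻¹ a b
              + sqrtDet X.q x / (2 * M.lam) * gradUp X.q X.field x a * gradUp X.q X.field x b)
      + ∑ c, (pd c (fun y => d.v y c * X.P y a b) x
          - X.P x c b * pd c (fun y => d.v y a) x - X.P x a c * pd c (fun y => d.v y b) x)
  field x := d.n x * M.lam * X.mom x / sqrtDet X.q x + ∑ a, d.v x a * pd a X.field x
  mom x :=
    (∑ a, pd a (fun y => d.n y * sqrtDet X.q y * gradUp X.q X.field y a / M.lam) x)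
      - d.n x * sqrtDet X.q x * deriv M.V (X.field x) / (2 * M.lam)
      + ∑ a, pd a (fun y => d.v y a * X.mom y) x
  N := 0
  Nv := 0
  Pi := 0
  Piv := 0

/-- The Hamiltonian vector field of the smeared primary constraints: it shifts lapse and shift. -/
def primVF (m : Descriptor) : ADM where
  q := 0
  P := 0
  field := 0
  mom := 0
  N := m.n
  Nv := m.v
  Pi := 0
  Piv := 0

/-- The Hamiltonian vector field of the canonical Hamiltonian
`∫ (N C + N^a C_a + λ Π + λ^a Π_a)`, with Lagrange multipliers `m = (λ, λ^a)`: lapse and shift are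
phase space variables with `Ṅ = λ`, `Ṅ^a = λ^a`, `Π̇ = -C`, `Π̇_a = -C_a`. -/
def canVF (M : Model) (m : Descriptor) (X : ADM) : ADM :=
  { secVF M ⟨X.N, X.Nv⟩ X with
    N := m.n
    Nv := m.v
    Pi := fun x => - hamC M X x
    Piv := fun x a => - diffC M X x a }

/-- `Y` has, at every point of space and in every component, time derivative `Y'` at `t`. -/
def HasTimeDeriv (Y : ℝ → ADM) (Y' : ADM) (t : ℝ) : Prop :=
  ∀ x : E3,
    (∀ a b, HasDerivAt (fun s => (Y s).q x a b) (Y'.q x a b) t) ∧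
    (∀ a b, HasDerivAt (fun s => (Y s).P x a b) (Y'.P x a b) t) ∧
    HasDerivAt (fun s => (Y s).field x) (Y'.field x) t ∧
    HasDerivAt (fun s => (Y s).mom x) (Y'.mom x) t ∧
    HasDerivAt (fun s => (Y s).N x) (Y'.N x) t ∧
    (∀ a, HasDerivAt (fun s => (Y s).Nv x a) (Y'.Nv x a) t) ∧
    HasDerivAt (fun s => (Y s).Pi x) (Y'.Pi x) t ∧
    (∀ a, HasDerivAt (fun s => (Y s).Piv x a) (Y'.Piv x a) t)

/-- Componentwise derivative at `0` of a one-parameter family. -/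
def derivZero (Y : ℝ → ADM) : ADM where
  q x := Matrix.of fun a b => deriv (fun r => (Y r).q x a b) 0
  P x := Matrix.of fun a b => deriv (fun r => (Y r).P x a b) 0
  field x := deriv (fun r => (Y r).field x) 0
  mom x := deriv (fun r => (Y r).mom x) 0
  N x := deriv (fun r => (Y r).N x) 0
  Nv x a := deriv (fun r => (Y r).Nv x a) 0
  Pi x := deriv (fun r => (Y r).Pi x) 0
  Piv x a := deriv (fun r => (Y r).Piv x a) 0

/-! ### The spatially flat FLRW background -/

/-- The background functions of time: `A = a²`, `P̃`, the lapse `N̄`, the scalar field and its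
momentum. -/
structure Background where
  A : ℝ → ℝ
  P : ℝ → ℝ
  N : ℝ → ℝ
  field : ℝ → ℝ
  mom : ℝ → ℝ

/-- The homogeneous, isotropic, spatially flat point of the extended phase space:
`q_ab = A δ_ab`, `P^{ab} = P̃ δ^{ab}`, lapse `N̄`, and vanishing shift, `Π`, `Π_a`. -/
def Background.adm (b : Background) (t : ℝ) : ADM where
  q _ := b.A t • (1 : Mat3)
  P _ := b.P t • (1 : Mat3)
  field _ := b.field t
  mom _ := b.mom t
  N _ := b.N t
  Nv := 0
  Pi := 0
  Piv := 0

/-- The background multiplier `λ̄ = dN̄/dt`, with vanishing spatial part. -/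
def Background.mult (b : Background) (t : ℝ) : Descriptor where
  n _ := deriv b.N t
  v := 0

/-- The background is a smooth exact solution, on the time domain `I`, of the canonical equations
and of all constraints, with nondegenerate metric, positive lapse and `dA/dt ≠ 0`. -/
structure Background.IsSolution (M : Model) (I : Set ℝ) (b : Background) : Prop where
  smooth_A : ContDiffOn ℝ ∞ b.A I
  smooth_P : ContDiffOn ℝ ∞ b.P I
  smooth_N : ContDiffOn ℝ ∞ b.N I
  smooth_field : ContDiffOn ℝ ∞ b.field I
  smooth_mom : ContDiffOn ℝ ∞ b.mom I
  A_pos : ∀ t ∈ I, 0 < b.A t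
  N_pos : ∀ t ∈ I, 0 < b.N t
  A_deriv_ne : ∀ t ∈ I, deriv b.A t ≠ 0
  evolution : ∀ t ∈ I, HasTimeDeriv b.adm (canVF M (b.mult t) (b.adm t)) t
  ham : ∀ t ∈ I, ∀ x, hamC M (b.adm t) x = 0
  diff : ∀ t ∈ I, ∀ x a, diffC M (b.adm t) x a = 0

/-- `H̃ = (1/2) Ȧ / A`. -/
def Background.hubble (b : Background) (t : ℝ) : ℝ := (1 / 2) * (deriv b.A t / b.A t)

/-- Pressure of the background scalar field. -/
def Background.pressure (M : Model) (b : Background) (t : ℝ) : ℝ :=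
  (1 / 2) * (M.lam / b.A t ^ 3 * b.mom t ^ 2 - 1 / M.lam * M.V (b.field t))

/-! ### Linearized theory -/

/-- The linearization of the canonical vector field at the background, applied to the perturbation
`Z` of the phase space point and the perturbation `m` of the multipliers. -/
def linVF (M : Model) (b : Background) (t : ℝ) (m : Descriptor) (Z : ADM) : ADM :=
  derivZero fun r => canVF M (b.mult t + r • m) (b.adm t + r • Z)

/-- The linearized Hamiltonian constraint `δC`. -/
def linHamC (M : Model) (b : Background) (t : ℝ) (Z : ADM) (x : E3) : ℝ :=
  deriv (fun r : ℝ => hamC M (b.adm t + r • Z) x) 0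

/-- The linearized diffeomorphism constraint `δC_a`. -/
def linDiffC (M : Model) (b : Background) (t : ℝ) (Z : ADM) (x : E3) (a : Fin 3) : ℝ :=
  deriv (fun r : ℝ => diffC M (b.adm t + r • Z) x a) 0

/-- A curve `Z` of perturbations solves, on `I`, the linearized canonical equations with
multipliers `m` and lies on the linearized constraint surface. -/
structure IsLinearSolution (M : Model) (b : Background) (I : Set ℝ) (m : ℝ → Descriptor)
    (Z : ℝ → ADM) : Prop where
  evolution : ∀ t ∈ I, HasTimeDeriv Z (linVF M b t (m t) (Z t)) t
  ham : ∀ t ∈ I, ∀ x, linHamC M b t (Z t) x = 0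
  diff : ∀ t ∈ I, ∀ x a, linDiffC M b t (Z t) x a = 0
  prim : ∀ t ∈ I, ∀ x, (Z t).Pi x = 0
  primv : ∀ t ∈ I, ∀ x a, (Z t).Piv x a = 0

/-! ### Scalar-vector-tensor decomposition -/

/-- The scalar, vector and tensor components of a perturbation at an instant of time;
`dfield`, `dmom` are the perturbations of the scalar field and of its momentum. -/
@[ext]
structure SVT where
  psi : E3 → ℝ
  E : E3 → ℝ
  F : E3 → Fin 3 → ℝ
  h : E3 → Mat3
  p_psi : E3 → ℝ
  p_E : E3 → ℝ
  p_F : E3 → Fin 3 → ℝ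
  p_h : E3 → Mat3
  phi : E3 → ℝ
  B : E3 → ℝ
  S : E3 → Fin 3 → ℝ
  p_phi : E3 → ℝ
  p_B : E3 → ℝ
  p_S : E3 → Fin 3 → ℝ
  dfield : E3 → ℝ
  dmom : E3 → ℝ

instance : Inhabited SVT where
  default := ⟨0, 0, 0, 0, 0, 0, 0, 0, 0, 0, 0, 0, 0, 0, 0, 0⟩

/-- A property holds for all real component functions. -/
def SVT.ForallComponents (R : (SVT → E3 → ℝ) → Prop) : Prop :=
  (R SVT.psi ∧ R SVT.E ∧ (∀ a, R fun X x => X.F x a) ∧ (∀ a b, R fun X x => X.h x a b)) ∧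
  (R SVT.p_psi ∧ R SVT.p_E ∧ (∀ a, R fun X x => X.p_F x a) ∧
    (∀ a b, R fun X x => X.p_h x a b)) ∧
  (R SVT.phi ∧ R SVT.B ∧ (∀ a, R fun X x => X.S x a)) ∧
  (R SVT.p_phi ∧ R SVT.p_B ∧ (∀ a, R fun X x => X.p_S x a)) ∧
  (R SVT.dfield ∧ R SVT.dmom)

/-- Symmetric, trace-free, divergence-free tensor fields. -/
def IsTT (h : E3 → Mat3) : Prop :=
  (∀ x, (h x).IsSymm) ∧ (∀ x, (h x).trace = 0) ∧ (∀ x a, ∑ c, pd c (fun y => h y c a) x = 0)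

/-- The vector components are divergence-free and the tensor components are TT. -/
def SVT.IsTransverse (X : SVT) : Prop :=
  (∀ x, divergence X.F x = 0) ∧ (∀ x, divergence X.p_F x = 0) ∧
  (∀ x, divergence X.S x = 0) ∧ (∀ x, divergence X.p_S x = 0) ∧ IsTT X.h ∧ IsTT X.p_h

/-- Transverse components, all of them smooth and decaying at infinity. -/
def SVT.IsAdmissible (X : SVT) : Prop :=
  X.IsTransverse ∧ SVT.ForallComponents fun c => Decays (c X)

/-- A curve of components that is transverse, smooth in time and space, and decays at spatial
infinity together with its time derivative. -/
def SVT.IsRegularCurve (I : Set ℝ) (X : ℝ → SVT) : Prop :=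
  (∀ t ∈ I, (X t).IsTransverse) ∧
  SVT.ForallComponents fun c =>
    ContDiffOn ℝ ∞ (fun p : ℝ × E3 => c (X p.1) p.2) (I ×ˢ Set.univ) ∧
    ∀ t ∈ I, Decays (c (X t)) ∧ Decays (fun x => deriv (fun s => c (X s) x) t)

/-- `ψ δ_ab + (∂_a∂_b - δ_ab Δ/3) E + ∂_(a F_b) + h_ab / 2`. -/
def svtTensor (psi E : E3 → ℝ) (F : E3 → Fin 3 → ℝ) (h : E3 → Mat3) (x : E3) : Mat3 :=
  Matrix.of fun a b =>
    psi x * kron a b + (pd a (pd b E) x - (1 / 3) * kron a b * lap E x)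
      + (1 / 2) * (pd b (fun y => F y a) x + pd a (fun y => F y b) x) + (1 / 2) * h x a b

/-- The perturbation with the given components:
`δq_ab = 2A(ψ δ_ab + E_{,<ab>} + F_{(a,b)} + h_ab/2)`,
`δP^{ab} = 2P̃(p_ψ δ^{ab} + p_E^{,<ab>} + p_F^{(a,b)} + p_h^{ab}/2)`,
`δN = N̄ φ`, `δN^a = B^{,a} + S^a`, `δΠ = N̄ p_φ`, `δΠ_a = p_{B,a} + p_{S a}`. -/
def assemble (b : Background) (t : ℝ) (X : SVT) : ADM where
  q x := (2 * b.A t) • svtTensor X.psi X.E X.F X.h x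
  P x := (2 * b.P t) • svtTensor X.p_psi X.p_E X.p_F X.p_h x
  field := X.dfield
  mom := X.dmom
  N x := b.N t * X.phi x
  Nv x a := pd a X.B x + X.S x a
  Pi x := b.N t * X.p_phi x
  Piv x a := pd a X.p_B x + X.p_S x a

/-- The (unique, where it exists) decomposition of a perturbation with decaying components. -/
def svt (b : Background) (t : ℝ) (Z : ADM) : SVT :=
  Classical.epsilon fun X : SVT => X.IsAdmissible ∧ assemble b t X = Z

/-! ### Geometrical clocks of the longitudinal gauge and the observable map -/

/-- The linearized clocks, as explicitly time dependent functions on the linearized phase space: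
`δT⁰ = 2 P̃ √A (E + p_E)`, `δT^a = δ^{ab}(E_{,b} + F_b)`. -/
def clock (b : Background) (t : ℝ) (Z : ADM) : Descriptor where
  n x := 2 * b.P t * Real.sqrt (b.A t) * ((svt b t Z).E x + (svt b t Z).p_E x)
  v x a := pd a (svt b t Z).E x + (svt b t Z).F x a

/-- `δṪ^μ = ∂_t δT^μ + {δT^μ, H_can}` to linear order, as a function on the linearized phase space.
The clocks do not involve lapse and shift, so the multipliers do not contribute. -/
def clockDot (M : Model) (b : Background) (t : ℝ) (Z : ADM) : Descriptor where
  n x := deriv (fun s => (clock b s Z).n x) t + (clock b t (linVF M b t default Z)).n x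
  v x a := deriv (fun s => (clock b s Z).v x a) t + (clock b t (linVF M b t default Z)).v x a

/-- Smooth decaying descriptors whose vector part has a decomposition into a gradient and a
divergence-free field, both decaying. -/
def Descriptor.IsAdmissible (d : Descriptor) : Prop :=
  Decays d.n ∧ ∃ (u : E3 → ℝ) (w : E3 → Fin 3 → ℝ),
    Decays u ∧ (∀ a, Decays fun x => w x a) ∧ (∀ x, divergence w x = 0) ∧
      ∀ x a, d.v x a = pd a u x + w x a

/-- The operator with kernel `A^μ_ν(x,y) = {T^μ(x), C_ν(y)}` at the background:
`β ↦ ∫ A^μ_ν(x,y) β^ν(y) d³y`, the bracket of the clocks with the smeared constraints. -/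
def clockMatrix (M : Model) (b : Background) (t : ℝ) (β : Descriptor) : Descriptor :=
  clock b t (secVF M β (b.adm t))

/-- The inverse `B` of the operator `A`. -/
def clockMatrixInv (M : Model) (b : Background) (t : ℝ) (d : Descriptor) : Descriptor :=
  Classical.epsilon fun β : Descriptor => β.IsAdmissible ∧ clockMatrix M b t β = d

/-- The linearized observable map for the gauge fixing conditions `G^μ = -T^μ`, applied to all
phase space variables at once:
`δO_f = δf + {f, C_ν}(B δG)^ν + {f, Π_ν} (B (δĠ - {Ṫ, C_ρ} (B δG)^ρ))^ν`,
with brackets evaluated at the background (products stand for sums and integrals). -/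
def observable (M : Model) (b : Background) (t : ℝ) (Z : ADM) : ADM :=
  let β := clockMatrixInv M b t ((-1 : ℝ) • clock b t Z)
  let Y := secVF M β (b.adm t)
  let μ := clockMatrixInv M b t
    ((-1 : ℝ) • clockDot M b t Z + (-1 : ℝ) • clockDot M b t Y)
  Z + Y + primVF μ

/-- The observables of all scalar, vector and tensor components along a curve of perturbations. -/
def obs (M : Model) (b : Background) (X : ℝ → SVT) (t : ℝ) : SVT :=
  svt b t (observable M b t (assemble b t (X t)))

/-! ### Gauge invariant variables -/

/-- The Bardeen potential `Ψ = ψ + (4H̃²A/N̄²)(E + p_E) - ΔE/3`. -/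
def bardeen (b : Background) (X : ℝ → SVT) (t : ℝ) (x : E3) : ℝ :=
  (X t).psi x + 4 * b.hubble t ^ 2 * b.A t / b.N t ^ 2 * ((X t).E x + (X t).p_E x)
    - (1 / 3) * lap (X t).E x

/-- `Υ = p_ψ + ΔE/2 + (2/3)Δp_E - (H̃²A/N̄² + κAp/2)(E + p_E)`. -/
def upsilon (M : Model) (b : Background) (X : ℝ → SVT) (t : ℝ) (x : E3) : ℝ :=
  (X t).p_psi x + (1 / 2) * lap (X t).E x + (2 / 3) * lap (X t).p_E x
    - (b.hubble t ^ 2 * b.A t / b.N t ^ 2 + M.kappa * b.A t / 2 * b.pressure M t)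
        * ((X t).E x + (X t).p_E x)

/-- `ν^a = p_F^a + δ^{ab} F_b`. -/
def nu (X : ℝ → SVT) (t : ℝ) (x : E3) (a : Fin 3) : ℝ := (X t).p_F x a + (X t).F x a

/-- `ϝ = (10 H̃² + κ N̄² p) / (4 H̃)`. -/
def digamma (M : Model) (b : Background) (t : ℝ) : ℝ :=
  (10 * b.hubble t ^ 2 + M.kappa * b.N t ^ 2 * b.pressure M t) / (4 * b.hubble t)

/-- The linear function
`δT̃ = -3 λ_φ π̄²/A³ ψ + λ_φ π̄/A³ δπ - V'(φ̄)/(2λ_φ) δφ` of the components. -/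
def deltaT (M : Model) (b : Background) (t : ℝ) (Y : SVT) (x : E3) : ℝ :=
  -3 * M.lam * b.mom t ^ 2 / b.A t ^ 3 * Y.psi x + M.lam * b.mom t / b.A t ^ 3 * Y.dmom x
    - 1 / (2 * M.lam) * deriv M.V (b.field t) * Y.dfield x

/-- The observables of the longitudinal clocks, component by component, at time `t`. -/
structure LongitudinalObservables (M : Model) (b : Background) (X : ℝ → SVT) (t : ℝ) :
    Prop where
  psi : ∀ x, (obs M b X t).psi x = bardeen b X t x
  E : ∀ x, (obs M b X t).E x = 0
  F : ∀ x a, (obs M b X t).F x a = 0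
  p_psi : ∀ x, (obs M b X t).p_psi x = upsilon M b X t x
  p_E : ∀ x, (obs M b X t).p_E x = 0
  p_F : ∀ x a, (obs M b X t).p_F x a = nu X t x a
  phi : ∀ x, (obs M b X t).phi x = - bardeen b X t x
  B : ∀ x, (obs M b X t).B x = 0
  S : ∀ x a, (obs M b X t).S x a = 4 * b.hubble t * nu X t x a
  p_phi : ∀ x, (obs M b X t).p_phi x = (X t).p_phi x
  p_B : ∀ x, (obs M b X t).p_B x = (X t).p_B x
  p_S : ∀ x a, (obs M b X t).p_S x a = (X t).p_S x a

/-- Hamilton's equations for the observables of the longitudinal gauge at time `t`. -/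
structure LongitudinalHamilton (M : Model) (b : Background) (X : ℝ → SVT) (t : ℝ) : Prop where
  psi : ∀ x, HasDerivAt (fun s => (obs M b X s).psi x)
    (2 * b.hubble t * (upsilon M b X t x - bardeen b X t x)) t
  E : ∀ x, HasDerivAt (fun s => (obs M b X s).E x) 0 t
  p_psi : ∀ x, HasDerivAt (fun s => (obs M b X s).p_psi x)
    ((- b.hubble t / 2 + M.kappa / 4 * (b.N t ^ 2 * b.pressure M t / b.hubble t))
        * upsilon M b X t x
      + b.hubble t / 2 * bardeen b X t x
      - M.kappa / 8 * (b.N t ^ 2 / b.hubble t) * deltaT M b t (obs M b X t) x) t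
  p_E : ∀ x, HasDerivAt (fun s => (obs M b X s).p_E x) 0 t
  F : ∀ x a, HasDerivAt (fun s => (obs M b X s).F x a) 0 t
  p_F : ∀ x a, HasDerivAt (fun s => (obs M b X s).p_F x a)
    ((digamma M b t - 4 * b.hubble t) * nu X t x a) t
  phi : ∀ x, HasDerivAt (fun s => (obs M b X s).phi x)
    (2 * b.hubble t * (bardeen b X t x - upsilon M b X t x)) t
  B : ∀ x, HasDerivAt (fun s => (obs M b X s).B x) 0 t
  S : ∀ x a, HasDerivAt (fun s => (obs M b X s).S x a)
    ((4 * deriv b.hubble t - 16 * b.hubble t ^ 2 + 4 * digamma M b t * b.hubble t)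
      * nu X t x a) t
  p_phi : ∀ x, HasDerivAt (fun s => (obs M b X s).p_phi x) 0 t
  p_B : ∀ x, HasDerivAt (fun s => (obs M b X s).p_B x) 0 t
  p_S : ∀ x a, HasDerivAt (fun s => (obs M b X s).p_S x a) 0 t
  dfield : ∀ x, HasDerivAt (fun s => (obs M b X s).dfield x)
    (b.N t * (M.lam / Real.sqrt (b.A t) ^ 3)
      * (-4 * b.mom t * bardeen b X t x + (obs M b X t).dmom x)) t
  dmom : ∀ x, HasDerivAt (fun s => (obs M b X s).dmom x)
    (- (b.N t * (Real.sqrt (b.A t) ^ 3 / M.lam))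
      * (deriv M.V (b.field t) * bardeen b X t x
          - 1 / b.A t * lap (obs M b X t).dfield x
          + (1 / 2) * deriv (deriv M.V) (b.field t) * (obs M b X t).dfield x)) t

end Cosmo

end

/-!
A decaying harmonic function on `ℝ³` vanishes, so the scalar, vector and tensor parts of a decaying
perturbation are unique, and an identity between assembled perturbations splits into one identity
for each component. At the homogeneous background the first variations of the ADM vector field and
of the constraints act on the components through constants and the Laplacian only. On these, the
matrix `𝒜 = {T, C}` of the longitudinal clocks is the identity, so the Dirac observable of a
component is its value after the gauge transformation that sets `E`, `p_E`, `F` and `B` to zero;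
this gives the explicit form `Ψ`, `-Ψ`, `Υ`, `ν`, `4 ℋ ν` of the observables. Their evolution
equations follow by differentiating these formulas along the linearized flow, using the background
equations and the Friedmann constraint. The linearized constraints are gauge invariant, hence hold
for the observables as well: the momentum constraint expresses `δφ` through `Ψ` and `Υ`, the
Hamiltonian constraint expresses `δπ`, and the two first-order equations for `Ψ` and `Υ` become the
second-order equation for `Ψ`.
-/

noncomputable section

namespace Cosmo

/-! ### Interchange of derivatives -/

section Interchange

variable {E F : Type*} [NormedAddCommGroup E] [NormedSpace ℝ E]
  [NormedAddCommGroup F] [NormedSpace ℝ F] {G : ℝ → E → F} {t : ℝ} {x : E}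

theorem hasFDerivAt_right (h : DifferentiableAt ℝ (fun p : ℝ × E => G p.1 p.2) (t, x)) :
    HasFDerivAt (G t)
      ((fderiv ℝ (fun p : ℝ × E => G p.1 p.2) (t, x)).comp (.inr ℝ ℝ E)) x :=
  h.hasFDerivAt.comp (f := fun y => (t, y)) x (hasFDerivAt_prodMk_right t x)

theorem hasDerivAt_left (h : DifferentiableAt ℝ (fun p : ℝ × E => G p.1 p.2) (t, x)) :
    HasDerivAt (fun s => G s x) (fderiv ℝ (fun p : ℝ × E => G p.1 p.2) (t, x) (1, 0)) t := by
  have hcomp : HasFDerivAt (fun s => G s x) _ t :=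
    h.hasFDerivAt.comp (f := fun s => (s, x)) t (hasFDerivAt_prodMk_left t x)
  simpa using hcomp.hasDerivAt

theorem eventually_differentiableAt {n : WithTop ℕ∞} (hn : 1 ≤ n)
    (h : ContDiffAt ℝ n (fun p : ℝ × E => G p.1 p.2) (t, x)) :
    ∀ᶠ p in 𝓝 (t, x), DifferentiableAt ℝ (fun p : ℝ × E => G p.1 p.2) (p.1, p.2) :=
  ((h.of_le hn).eventually (by simp)).mono fun _ hp => hp.differentiableAt one_ne_zero

theorem contDiffAt_fderiv_right (v : E)
    (h : ContDiffAt ℝ ∞ (fun p : ℝ × E => G p.1 p.2) (t, x)) :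
    ContDiffAt ℝ ∞ (fun p : ℝ × E => fderiv ℝ (G p.1) p.2 v) (t, x) := by
  refine ((h.fderiv_right (m := ∞) (by simp)).clm_apply
    (contDiffAt_const (c := ((0 : ℝ), v)))).congr_of_eventuallyEq ?_
  filter_upwards [eventually_differentiableAt (by simp) h] with p hp
  simp [(hasFDerivAt_right hp).fderiv]

theorem hasDerivAt_fderiv_right (v : E)
    (h : ContDiffAt ℝ 2 (fun p : ℝ × E => G p.1 p.2) (t, x)) :
    HasDerivAt (fun s => fderiv ℝ (G s) x v)
      (fderiv ℝ (fun y => deriv (fun s => G s y) t) x v) t := by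
  set g : ℝ × E → F := fun p => G p.1 p.2
  have hd : HasFDerivAt (fderiv ℝ g) (fderiv ℝ (fderiv ℝ g) (t, x)) (t, x) :=
    ((h.fderiv_right (m := 1) (by norm_num)).differentiableAt one_ne_zero).hasFDerivAt
  have hdiff := eventually_differentiableAt (by norm_num) h
  have htime : HasDerivAt (fun s => fderiv ℝ (G s) x v)
      (fderiv ℝ (fderiv ℝ g) (t, x) (1, 0) (0, v)) t := by
    have hcomp := (hd.comp (f := fun s => (s, x)) t (hasFDerivAt_prodMk_left t x)).clm_apply
      (hasFDerivAt_const ((0 : ℝ), v) t)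
    refine HasDerivAt.congr_of_eventuallyEq (by simpa using hcomp.hasDerivAt) ?_
    filter_upwards [(Continuous.prodMk_left x).continuousAt.eventually hdiff] with s hs
    simp [(hasFDerivAt_right hs).fderiv, g]
  have hspace : HasFDerivAt (fun y => deriv (fun s => G s y) t)
      ((fderiv ℝ (fderiv ℝ g) (t, x)).flip (1, 0) ∘L .inr ℝ ℝ E) x := by
    have hcomp := (hd.comp (f := fun y => (t, y)) x (hasFDerivAt_prodMk_right t x)).clm_apply
      (hasFDerivAt_const ((1 : ℝ), (0 : E)) x)
    refine (hcomp.congr_fderiv (by ext; simp)).congr_of_eventuallyEq ?_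
    filter_upwards [(Continuous.prodMk_right t).continuousAt.eventually hdiff] with y hy
    exact (hasDerivAt_left hy).deriv
  have hsymm := h.isSymmSndFDerivAt (by simp)
  simpa [hspace.fderiv, hsymm.eq (1, 0)] using htime

end Interchange

/-! ### Decaying harmonic functions -/

section Harmonic

open InnerProductSpace Laplacian

theorem deriv_deriv_nonpos_of_isLocalMax {f : ℝ → ℝ} {a : ℝ} (hf : ContinuousAt f a)
    (hmax : IsLocalMax f a) : deriv (deriv f) a ≤ 0 := by
  by_contra! hpos
  have hmin : IsLocalMin f a := isLocalMin_of_deriv_deriv_pos hpos hmax.deriv_eq_zero hf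
  have hconst : f =ᶠ[𝓝 a] fun _ => f a := by
    filter_upwards [hmax, hmin] with s h₁ h₂ using le_antisymm h₁ h₂
  simp [hconst.deriv.deriv_eq] at hpos

theorem fderiv_fderiv_nonpos_of_isLocalMax {E : Type*} [NormedAddCommGroup E] [NormedSpace ℝ E]
    {f : E → ℝ} {x : E} (hf : ContDiffAt ℝ 2 f x) (hmax : IsLocalMax f x) (v : E) :
    fderiv ℝ (fderiv ℝ f) x v v ≤ 0 := by
  set c : ℝ → E := fun s => x + s • v
  have hc : ∀ s, HasDerivAt c v s := fun s =>
    (((hasDerivAt_id s).smul_const v).const_add x).congr_deriv (one_smul ℝ v)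
  have hc0 : c 0 = x := by simp [c]
  have hfirst : deriv (f ∘ c) =ᶠ[𝓝 0] fun s => fderiv ℝ f (c s) v := by
    have hdiff : ∀ᶠ y in 𝓝 (c 0), DifferentiableAt ℝ f y := by
      rw [hc0]
      exact (hf.eventually (by simp)).mono fun y hy => hy.differentiableAt two_ne_zero
    filter_upwards [(hc 0).continuousAt.eventually hdiff] with s hs
    exact (hs.hasFDerivAt.comp_hasDerivAt s (hc s)).deriv
  have hsecond : HasDerivAt (fun s => fderiv ℝ f (c s) v) (fderiv ℝ (fderiv ℝ f) x v v) 0 := by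
    have hd : HasFDerivAt (fderiv ℝ f) (fderiv ℝ (fderiv ℝ f) x) (c 0) := by
      rw [hc0]
      exact ((hf.fderiv_right (m := 1) (by norm_num)).differentiableAt one_ne_zero).hasFDerivAt
    simpa using (hd.comp_hasDerivAt (0 : ℝ) (hc 0)).clm_apply (hasDerivAt_const (0 : ℝ) v)
  rw [← hsecond.deriv, ← hfirst.deriv_eq]
  rw [← hc0] at hmax hf
  exact deriv_deriv_nonpos_of_isLocalMax (hf.continuousAt.comp (hc 0).continuousAt)
    (hmax.comp_continuous (hc 0).continuousAt)

variable {E : Type*} [NormedAddCommGroup E] [InnerProductSpace ℝ E] [FiniteDimensional ℝ E]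
  {f : E → ℝ}

theorem laplacian_nonpos_of_isLocalMax {x : E} (hf : ContDiffAt ℝ 2 f x)
    (hmax : IsLocalMax f x) : Δ f x ≤ 0 := by
  rw [laplacian_eq_iteratedFDeriv_stdOrthonormalBasis]
  refine Finset.sum_nonpos fun i _ => ?_
  simpa [iteratedFDeriv_two_apply] using fderiv_fderiv_nonpos_of_isLocalMax hf hmax _

theorem laplacian_norm_sq (x : E) : Δ (fun y : E => ‖y‖ ^ 2) x = 2 * Module.finrank ℝ E := by
  have hsecond (v : E) : fderiv ℝ (fderiv ℝ fun y : E => ‖y‖ ^ 2) x v v = 2 * ‖v‖ ^ 2 := by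
    rw [fderiv_norm_sq, ← FunLike.coe_smul, ContinuousLinearMap.fderiv,
      ← real_inner_self_eq_norm_sq]
    exact two_nsmul _ |>.trans (two_mul _).symm
  rw [laplacian_eq_iteratedFDeriv_stdOrthonormalBasis]
  simp [iteratedFDeriv_two_apply, hsecond, mul_comm]

/-- The quadratic perturbation `f + ε ‖·‖²` is strictly subharmonic, so its maximum is not attained
in the interior. -/
theorem exists_mem_frontier_le_add [Nontrivial E] {U : Set E} (hU : IsOpen U)
    (hbdd : Bornology.IsBounded U) (hcont : ContinuousOn f (closure U))
    (hf : ∀ y ∈ U, ContDiffAt ℝ 2 f y) (hΔ : ∀ y ∈ U, 0 ≤ Δ f y) {ε : ℝ} (hε : 0 < ε)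
    {x : E} (hx : x ∈ closure U) : ∃ y ∈ frontier U, f x ≤ f y + ε * ‖y‖ ^ 2 := by
  have hnorm : ContDiff ℝ 2 (ε • fun y : E => ‖y‖ ^ 2) := (contDiff_norm_sq ℝ).const_smul ε
  obtain ⟨y, hy, hmax⟩ := hbdd.isCompact_closure.exists_isMaxOn ⟨x, hx⟩
    (hcont.add hnorm.continuous.continuousOn)
  refine ⟨y, hU.frontier_eq ▸ ⟨hy, fun hyU => ?_⟩, ?_⟩
  · have hlocal := laplacian_nonpos_of_isLocalMax ((hf y hyU).add hnorm.contDiffAt)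
      (hmax.isLocalMax (mem_of_superset (hU.mem_nhds hyU) subset_closure))
    rw [← Pi.add_def, (hf y hyU).laplacian_add hnorm.contDiffAt,
      laplacian_smul ε (contDiff_norm_sq ℝ).contDiffAt, laplacian_norm_sq, smul_eq_mul] at hlocal
    have hdim : (0 : ℝ) < Module.finrank ℝ E := mod_cast Module.finrank_pos
    nlinarith [hΔ y hyU, mul_pos hε hdim]
  · calc f x ≤ f x + ε * ‖x‖ ^ 2 := le_add_of_nonneg_right (by positivity)
      _ ≤ f y + ε * ‖y‖ ^ 2 := hmax hx

theorem le_of_laplacian_nonneg_of_le_frontier [Nontrivial E] {U : Set E} (hU : IsOpen U)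
    (hbdd : Bornology.IsBounded U) (hcont : ContinuousOn f (closure U))
    (hf : ∀ y ∈ U, ContDiffAt ℝ 2 f y) (hΔ : ∀ y ∈ U, 0 ≤ Δ f y) {m : ℝ}
    (hm : ∀ y ∈ frontier U, f y ≤ m) {x : E} (hx : x ∈ closure U) : f x ≤ m := by
  obtain ⟨R, hR, hUR⟩ := hbdd.closure.exists_pos_norm_le
  refine le_of_forall_pos_le_add fun δ hδ => ?_
  obtain ⟨y, hy, hxy⟩ := exists_mem_frontier_le_add hU hbdd hcont hf hΔ
    (ε := δ / R ^ 2) (by positivity) hx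
  calc f x ≤ f y + δ / R ^ 2 * ‖y‖ ^ 2 := hxy
    _ ≤ m + δ / R ^ 2 * R ^ 2 := by gcongr; exacts [hm y hy, hUR y (frontier_subset_closure hy)]
    _ = m + δ := by field_simp

theorem nonpos_of_laplacian_nonneg_of_tendsto_zero [Nontrivial E] (hf : ContDiff ℝ 2 f)
    (hΔ : ∀ y, 0 ≤ Δ f y) (hlim : Tendsto f (cocompact E) (𝓝 0)) (x : E) : f x ≤ 0 := by
  refine le_of_forall_pos_le_add fun δ hδ => ?_
  obtain ⟨K, hK, hKf⟩ := mem_cocompact.1 (hlim.eventually (gt_mem_nhds hδ))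
  obtain ⟨R, hR⟩ := (hK.isBounded.insert x).subset_ball 0
  have hxR : x ∈ Metric.ball (0 : E) R := hR (Set.mem_insert x K)
  rw [zero_add]
  refine le_of_laplacian_nonneg_of_le_frontier Metric.isOpen_ball Metric.isBounded_ball
    hf.continuous.continuousOn (fun _ _ => hf.contDiffAt) (fun y _ => hΔ y) (fun y hy => ?_)
    (subset_closure hxR)
  rw [Metric.isOpen_ball.frontier_eq] at hy
  exact (hKf fun hyK => hy.2 (hR (Set.mem_insert_of_mem x hyK))).le

theorem eq_zero_of_laplacian_eq_zero_of_tendsto_zero [Nontrivial E] (hf : ContDiff ℝ 2 f)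
    (hΔ : Δ f = 0) (hlim : Tendsto f (cocompact E) (𝓝 0)) : f = 0 := by
  refine funext fun x => le_antisymm
    (nonpos_of_laplacian_nonneg_of_tendsto_zero hf (fun y => by simp [hΔ]) hlim x) ?_
  have := nonpos_of_laplacian_nonneg_of_tendsto_zero hf.neg
    (fun y => by simp [← Pi.neg_def, laplacian_neg, hΔ]) (by simpa using hlim.neg) x
  simpa using this

end Harmonic

/-! ### Decaying scalar, vector and tensor fields -/

section PartialDerivatives

variable {f g : E3 → ℝ}

theorem contDiff_pd (hf : ContDiff ℝ ∞ f) (i : Fin 3) : ContDiff ℝ ∞ (pd i f) :=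
  (hf.fderiv_right (m := ∞) (by simp)).clm_apply contDiff_const

theorem pd_pd_apply (hf : ContDiff ℝ ∞ f) (i j : Fin 3) (x : E3) :
    pd i (pd j f) x
      = fderiv ℝ (fderiv ℝ f) x (EuclideanSpace.single i 1) (EuclideanSpace.single j 1) := by
  have hd : DifferentiableAt ℝ (fderiv ℝ f) x :=
    (hf.fderiv_right (m := ∞) (by simp)).contDiffAt.differentiableAt (by simp)
  have h : HasFDerivAt (pd j f) _ x :=
    hd.hasFDerivAt.clm_apply (hasFDerivAt_const (EuclideanSpace.single j (1 : ℝ)) x)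
  simp [pd, h.fderiv]

theorem pd_comm (hf : ContDiff ℝ ∞ f) (i j : Fin 3) : pd i (pd j f) = pd j (pd i f) := by
  funext x
  have hsymm : IsSymmSndFDerivAt ℝ f x :=
    (contDiff_infty.1 hf 2).contDiffAt.isSymmSndFDerivAt (by simp)
  rw [pd_pd_apply hf, pd_pd_apply hf, hsymm.eq]

theorem pd_const (i : Fin 3) (c : ℝ) : pd i (fun _ => c) = 0 := by
  funext x; simp [pd]

theorem pd_add (hf : ContDiff ℝ ∞ f) (hg : ContDiff ℝ ∞ g) (i : Fin 3) :
    pd i (f + g) = pd i f + pd i g := by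
  funext x
  simp [pd, fderiv_add (hf.differentiable (by simp) x) (hg.differentiable (by simp) x)]

theorem pd_smul (c : ℝ) (f : E3 → ℝ) (i : Fin 3) : pd i (c • f) = c • pd i f := by
  funext x; simp [pd, fderiv_const_smul_field]

theorem contDiff_foldr_pd (hf : ContDiff ℝ ∞ f) (l : List (Fin 3)) :
    ContDiff ℝ ∞ (l.foldr pd f) := by
  induction l with
  | nil => exact hf
  | cons i l ih => exact contDiff_pd ih i

theorem foldr_pd_add (hf : ContDiff ℝ ∞ f) (hg : ContDiff ℝ ∞ g) (l : List (Fin 3)) :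
    l.foldr pd (f + g) = l.foldr pd f + l.foldr pd g := by
  induction l with
  | nil => rfl
  | cons i l ih =>
    rw [List.foldr_cons, ih, pd_add (contDiff_foldr_pd hf l) (contDiff_foldr_pd hg l)]; rfl

theorem foldr_pd_smul (c : ℝ) (f : E3 → ℝ) (l : List (Fin 3)) :
    l.foldr pd (c • f) = c • l.foldr pd f := by
  induction l with
  | nil => rfl
  | cons i l ih => rw [List.foldr_cons, ih, pd_smul]; rfl

open Laplacian in
theorem laplacian_eq_lap (hf : ContDiff ℝ ∞ f) : Δ f = lap f := by
  funext x
  simp [InnerProductSpace.laplacian_eq_iteratedFDeriv_orthonormalBasis f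
    (EuclideanSpace.basisFun (Fin 3) ℝ), iteratedFDeriv_two_apply, lap, pd_pd_apply hf]

end PartialDerivatives

namespace Decays

variable {f g : E3 → ℝ}

protected theorem pd (hf : Decays f) (i : Fin 3) : Decays (pd i f) :=
  ⟨contDiff_pd hf.1 i, fun l => by simpa using hf.2 (l ++ [i])⟩

protected theorem add (hf : Decays f) (hg : Decays g) : Decays (f + g) :=
  ⟨hf.1.add hg.1, fun l => by
    have hsum := (hf.2 l).add (hg.2 l)
    rw [add_zero] at hsum
    rwa [foldr_pd_add hf.1 hg.1]⟩

protected theorem smul (c : ℝ) (hf : Decays f) : Decays (c • f) :=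
  ⟨contDiff_const.smul hf.1, fun l => by
    have hsmul := (hf.2 l).const_smul c
    rw [smul_zero] at hsmul
    rwa [foldr_pd_smul]⟩

protected theorem zero : Decays 0 :=
  ⟨contDiff_const, fun l => by
    have hzero := foldr_pd_smul 0 0 l
    rw [zero_smul, zero_smul] at hzero
    rw [hzero]
    exact tendsto_const_nhds⟩

end Decays

/-- The space of smooth functions that decay together with all their derivatives. -/
def DecaySpace : Submodule ℝ (E3 → ℝ) where
  carrier := {f | Decays f}
  add_mem' := Decays.add
  zero_mem' := Decays.zero
  smul_mem' c _ hf := Decays.smul c hf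

namespace DecaySpace

instance : CoeFun DecaySpace fun _ => E3 → ℝ := ⟨fun f => f.1⟩

@[simp] theorem coe_add_apply (f g : DecaySpace) (x : E3) : (f + g).1 x = f x + g x := rfl
@[simp] theorem coe_sub_apply (f g : DecaySpace) (x : E3) : (f - g).1 x = f x - g x := rfl
@[simp] theorem coe_neg_apply (f : DecaySpace) (x : E3) : (-f).1 x = -f x := rfl
@[simp] theorem coe_smul_apply (c : ℝ) (f : DecaySpace) (x : E3) : (c • f).1 x = c * f x := rfl
@[simp] theorem coe_zero_apply (x : E3) : (0 : DecaySpace).1 x = 0 := rfl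

@[simp] theorem coe_sum_apply {ι : Type*} (s : Finset ι) (f : ι → DecaySpace) (x : E3) :
    (∑ i ∈ s, f i).1 x = ∑ i ∈ s, f i x := by
  rw [Submodule.coe_sum, Finset.sum_apply]

theorem ext_apply {f g : DecaySpace} (h : ∀ x, f x = g x) : f = g := Subtype.ext (funext h)

theorem apply_congr {f g : DecaySpace} (h : f = g) (x : E3) : f x = g x := h ▸ rfl

/-- The partial derivative `∂_i` as an operator on decaying functions. -/
def pdₗ (i : Fin 3) : DecaySpace →ₗ[ℝ] DecaySpace where
  toFun f := ⟨pd i f, f.2.pd i⟩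
  map_add' f g := Subtype.ext (pd_add f.2.1 g.2.1 i)
  map_smul' c f := Subtype.ext (pd_smul c f i)

/-- The flat Laplacian as an operator on decaying functions. -/
def lapₗ : DecaySpace →ₗ[ℝ] DecaySpace := ∑ i, pdₗ i ∘ₗ pdₗ i

/-- The flat divergence as an operator on decaying vector fields. -/
def divₗ : (Fin 3 → DecaySpace) →ₗ[ℝ] DecaySpace := ∑ i, pdₗ i ∘ₗ LinearMap.proj i

theorem pd_coe (i : Fin 3) (f : DecaySpace) : pd i f.1 = (pdₗ i f).1 := rfl

theorem pdₗ_comm (i j : Fin 3) (f : DecaySpace) : pdₗ i (pdₗ j f) = pdₗ j (pdₗ i f) :=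
  Subtype.ext (pd_comm f.2.1 i j)

theorem lapₗ_eq (f : DecaySpace) : lapₗ f = ∑ i, pdₗ i (pdₗ i f) := by simp [lapₗ]

theorem divₗ_eq (w : Fin 3 → DecaySpace) : divₗ w = ∑ i, pdₗ i (w i) := by simp [divₗ]

theorem lap_coe (f : DecaySpace) : lap f.1 = (lapₗ f).1 := by
  funext x
  simp [lap, lapₗ_eq, pd_coe]

theorem divergence_coe (w : Fin 3 → DecaySpace) (x : E3) :
    divergence (fun y a => w a y) x = divₗ w x := by
  simp [divergence, divₗ_eq, pd_coe]

theorem pdₗ_lapₗ (i : Fin 3) (f : DecaySpace) : pdₗ i (lapₗ f) = lapₗ (pdₗ i f) := by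
  simp only [lapₗ_eq, map_sum, pdₗ_comm i]

theorem divₗ_grad (f : DecaySpace) : divₗ (fun a => pdₗ a f) = lapₗ f := by
  simp only [divₗ_eq, lapₗ_eq]

theorem divₗ_lapₗ (w : Fin 3 → DecaySpace) :
    divₗ (fun a => lapₗ (w a)) = lapₗ (divₗ w) := by
  simp only [divₗ_eq, map_sum, pdₗ_lapₗ]

theorem lapₗ_injective : Function.Injective lapₗ := by
  refine (injective_iff_map_eq_zero lapₗ).2 fun f hf => Subtype.ext ?_
  refine eq_zero_of_laplacian_eq_zero_of_tendsto_zero (contDiff_infty.1 f.2.1 2) ?_ (f.2.2 [])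
  rw [laplacian_eq_lap f.2.1, lap_coe, hf]
  rfl

end DecaySpace

open DecaySpace

/-- Decaying divergence-free vector fields. -/
def Solenoidal : Submodule ℝ (Fin 3 → DecaySpace) := LinearMap.ker divₗ

namespace Solenoidal

theorem divₗ_eq_zero (w : Solenoidal) : divₗ w.1 = 0 := w.2

theorem mem_iff {w : Fin 3 → DecaySpace} :
    (∀ x, divergence (fun y a => w a y) x = 0) ↔ w ∈ Solenoidal := by
  simp only [divergence_coe]
  exact ⟨fun h => ext_apply h, fun h => apply_congr h⟩

theorem grad_add_injective {u u' : DecaySpace} {w w' : Solenoidal}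
    (h : ∀ a, pdₗ a u + w.1 a = pdₗ a u' + w'.1 a) : u = u' ∧ w = w' := by
  have hu : u = u' := lapₗ_injective <| by
    have hdiv := congrArg divₗ (funext h : (fun a => pdₗ a u) + w.1 = (fun a => pdₗ a u') + w'.1)
    simpa only [map_add, divₗ_grad, divₗ_eq_zero, add_zero] using hdiv
  subst hu
  exact ⟨rfl, Subtype.ext (funext fun a => add_left_cancel (h a))⟩

/-- The Laplacian of a divergence-free vector field, taken componentwise. -/
def lap : Solenoidal →ₗ[ℝ] Solenoidal :=
  (lapₗ.compLeft (Fin 3)).restrict fun w hw => by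
    rw [Solenoidal, LinearMap.mem_ker] at hw ⊢
    exact (divₗ_lapₗ w).trans (by rw [hw, map_zero])

@[simp] theorem lap_apply (w : Solenoidal) (a : Fin 3) : (lap w).1 a = lapₗ (w.1 a) := rfl

theorem lap_injective : Function.Injective lap := fun _ _ h =>
  Subtype.ext (funext fun a => lapₗ_injective (congrFun (congrArg Subtype.val h) a))

end Solenoidal

/-- Decaying symmetric, trace-free and divergence-free tensor fields. -/
def TTSpace : Submodule ℝ (Fin 3 → Fin 3 → DecaySpace) where
  carrier := {h | (∀ a b, h a b = h b a) ∧ ∑ a, h a a = 0 ∧ ∀ a, divₗ (fun c => h c a) = 0}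
  add_mem' {h k} hh hk := by
    refine ⟨fun a b => ?_, ?_, fun a => ?_⟩
    · simp only [Pi.add_apply, hh.1 a b, hk.1 a b]
    · simp only [Pi.add_apply, Finset.sum_add_distrib, hh.2.1, hk.2.1, add_zero]
    · exact (map_add divₗ (fun c => h c a) fun c => k c a).trans (by
        rw [hh.2.2 a, hk.2.2 a, add_zero])
  zero_mem' := ⟨fun _ _ => rfl, by simp, fun _ => map_zero divₗ⟩
  smul_mem' r h hh := by
    refine ⟨fun a b => ?_, ?_, fun a => ?_⟩
    · simp only [Pi.smul_apply, hh.1 a b]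
    · simp only [Pi.smul_apply, ← Finset.smul_sum, hh.2.1, smul_zero]
    · exact (map_smul divₗ r fun c => h c a).trans (by rw [hh.2.2 a, smul_zero])

namespace TTSpace

theorem symm (h : TTSpace) (a b : Fin 3) : h.1 a b = h.1 b a := h.2.1 a b

theorem trace_eq_zero (h : TTSpace) : ∑ a, h.1 a a = 0 := h.2.2.1

theorem divₗ_eq_zero (h : TTSpace) (a : Fin 3) : divₗ (h.1 a) = 0 := by
  simpa only [TTSpace.symm h _ a] using h.2.2.2 a

/-- The Laplacian of a transverse traceless tensor field, taken componentwise. -/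
def lap : TTSpace →ₗ[ℝ] TTSpace :=
  ((lapₗ.compLeft (Fin 3)).compLeft (Fin 3)).restrict fun h hh =>
    ⟨fun a b => congrArg lapₗ (hh.1 a b),
      (map_sum lapₗ _ _).symm.trans (by rw [hh.2.1, map_zero]),
      fun a => (divₗ_lapₗ fun c => h c a).trans (by rw [hh.2.2 a, map_zero])⟩

@[simp] theorem lap_apply (h : TTSpace) (a b : Fin 3) : (lap h).1 a b = lapₗ (h.1 a b) := rfl

theorem isTT_iff {h : Fin 3 → Fin 3 → DecaySpace} :
    IsTT (fun y => Matrix.of fun a b => h a b y) ↔ h ∈ TTSpace := by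
  have hdiv (a : Fin 3) (x : E3) :
      ∑ c, pd c (fun y => h c a y) x = divₗ (fun c => h c a) x := divergence_coe _ x
  constructor
  · rintro ⟨hsymm, htrace, htrans⟩
    exact ⟨fun a b => ext_apply fun x => (hsymm x).apply b a,
      ext_apply fun x => by simpa [Matrix.trace] using htrace x,
      fun a => ext_apply fun x => by simpa [hdiv] using htrans x a⟩
  · rintro ⟨hsymm, htrace, htrans⟩
    refine ⟨fun x => Matrix.IsSymm.ext fun a b => ?_, fun x => ?_, fun x a => ?_⟩
    · simp [hsymm a b]
    · simpa [Matrix.trace] using apply_congr htrace x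
    · simpa [hdiv] using apply_congr (htrans a) x

end TTSpace

theorem kron_self (i : Fin 3) : kron i i = 1 := if_pos rfl

theorem kron_comm (i j : Fin 3) : kron i j = kron j i := by simp [kron, eq_comm]

theorem sum_kron_smul {W : Type*} [AddCommGroup W] [Module ℝ W] (f : Fin 3 → W) (a : Fin 3) :
    ∑ b, kron a b • f b = f a := by
  simp [kron]

/-- Decaying components `ψ, E, F, h` of a symmetric tensor field. -/
@[ext]
structure TensorModes where
  psi : DecaySpace
  E : DecaySpace
  F : Solenoidal
  h : TTSpace

namespace TensorModes

/-- The tensor field `ψ δ_ab + (∂_a∂_b - δ_ab Δ/3) E + ∂_(a F_b) + h_ab / 2`. -/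
def tensor (T : TensorModes) (a b : Fin 3) : DecaySpace :=
  kron a b • T.psi + (pdₗ a (pdₗ b T.E) - ((1 / 3) * kron a b) • lapₗ T.E)
    + (1 / 2 : ℝ) • (pdₗ b (T.F.1 a) + pdₗ a (T.F.1 b)) + (1 / 2 : ℝ) • T.h.1 a b

theorem svtTensor_apply (T : TensorModes) (x : E3) (a b : Fin 3) :
    svtTensor T.psi T.E (fun y c => T.F.1 c y) (fun y => Matrix.of fun c d => T.h.1 c d y) x a b
      = T.tensor a b x := by
  simp only [svtTensor, tensor, Matrix.of_apply, lap_coe, pd_coe, coe_add_apply, coe_sub_apply,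
    coe_smul_apply]
  ring

theorem tensor_symm (T : TensorModes) (a b : Fin 3) : T.tensor a b = T.tensor b a := by
  simp only [tensor, kron_comm a b, pdₗ_comm a b, TTSpace.symm T.h a b, add_comm (pdₗ b (T.F.1 a))]

theorem tensor_trace (T : TensorModes) : ∑ a, T.tensor a a = (3 : ℝ) • T.psi := by
  have hF : ∑ a, pdₗ a (T.F.1 a) = 0 := by rw [← divₗ_eq, Solenoidal.divₗ_eq_zero T.F]
  have hlap := lapₗ_eq T.E
  simp only [tensor, kron_self, Finset.sum_add_distrib, Finset.sum_sub_distrib, ← hlap,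
    ← Finset.smul_sum, hF, TTSpace.trace_eq_zero T.h, Finset.sum_const, Finset.card_univ,
    Fintype.card_fin]
  module

theorem tensor_div (T : TensorModes) (a : Fin 3) :
    ∑ b, pdₗ b (T.tensor a b)
      = pdₗ a (T.psi + (2 / 3 : ℝ) • lapₗ T.E) + (1 / 2 : ℝ) • lapₗ (T.F.1 a) := by
  have hF : ∑ b, pdₗ b (pdₗ a (T.F.1 b)) = 0 := by
    simp only [pdₗ_comm _ a, ← map_sum, ← divₗ_eq, Solenoidal.divₗ_eq_zero T.F, map_zero]
  have hh : ∑ b, pdₗ b (T.h.1 a b) = 0 := by rw [← divₗ_eq, TTSpace.divₗ_eq_zero T.h]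
  have hE : ∑ b, pdₗ b (pdₗ a (pdₗ b T.E)) = pdₗ a (lapₗ T.E) := by
    simp only [pdₗ_comm _ a, ← map_sum, ← lapₗ_eq]
  have hkron (f : DecaySpace) : ∑ b, kron a b • pdₗ b f = pdₗ a f := sum_kron_smul (pdₗ · f) a
  simp only [tensor, map_add, map_sub, map_smul, Finset.sum_add_distrib, Finset.sum_sub_distrib,
    ← Finset.smul_sum, mul_smul, hkron, ← lapₗ_eq, hF, hh, hE]
  module

theorem tensor_injective : Function.Injective tensor := by
  intro T T' h
  have hpsi : T.psi = T'.psi :=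
    smul_right_injective _ (three_ne_zero (α := ℝ)) <| by
      simpa only [tensor_trace] using congrArg (fun t => ∑ a, t a a) h
  have hdiv (a : Fin 3) := congrArg (fun t => ∑ b, pdₗ b (t a b)) h
  simp only [tensor_div] at hdiv
  obtain ⟨hE, hF⟩ := Solenoidal.grad_add_injective
    (w := (1 / 2 : ℝ) • Solenoidal.lap T.F) (w' := (1 / 2 : ℝ) • Solenoidal.lap T'.F) hdiv
  replace hE : T.E = T'.E := lapₗ_injective
    (smul_right_injective _ (by norm_num : (2 / 3 : ℝ) ≠ 0) (add_left_cancel (hpsi ▸ hE)))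
  replace hF : T.F = T'.F := Solenoidal.lap_injective
    (smul_right_injective _ (by norm_num : (1 / 2 : ℝ) ≠ 0) hF)
  refine TensorModes.ext hpsi hE hF (Subtype.ext (funext₂ fun a b => ?_))
  have hab := congrFun₂ h a b
  simp only [tensor, hpsi, hE, hF] at hab
  exact smul_right_injective _ (by norm_num : (1 / 2 : ℝ) ≠ 0) (add_left_cancel hab)

end TensorModes

/-- Decaying components of a perturbation of the extended phase space: the bundled counterpart of
an admissible `SVT`. -/
@[ext]
structure Modes where
  q : TensorModes
  p : TensorModes
  phi : DecaySpace
  B : DecaySpace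
  S : Solenoidal
  p_phi : DecaySpace
  p_B : DecaySpace
  p_S : Solenoidal
  dfield : DecaySpace
  dmom : DecaySpace

namespace Modes

/-- The unbundled components. -/
def toSVT (c : Modes) : SVT where
  psi := c.q.psi
  E := c.q.E
  F y a := c.q.F.1 a y
  h y := Matrix.of fun a b => c.q.h.1 a b y
  p_psi := c.p.psi
  p_E := c.p.E
  p_F y a := c.p.F.1 a y
  p_h y := Matrix.of fun a b => c.p.h.1 a b y
  phi := c.phi
  B := c.B
  S y a := c.S.1 a y
  p_phi := c.p_phi
  p_B := c.p_B
  p_S y a := c.p_S.1 a y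
  dfield := c.dfield
  dmom := c.dmom

theorem isAdmissible_iff {X : SVT} : X.IsAdmissible ↔ ∃ c : Modes, c.toSVT = X := by
  constructor
  · rintro ⟨⟨hF, hpF, hS, hpS, hh, hph⟩, ⟨psi, E, F, h⟩, ⟨p_psi, p_E, p_F, p_h⟩, ⟨phi, B, S⟩,
      ⟨p_phi, p_B, p_S⟩, dfield, dmom⟩
    exact ⟨⟨⟨⟨_, psi⟩, ⟨_, E⟩, ⟨_, (Solenoidal.mem_iff (w := fun a => ⟨_, F a⟩)).1 hF⟩,
        ⟨_, (TTSpace.isTT_iff (h := fun a b => ⟨_, h a b⟩)).1 hh⟩⟩,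
      ⟨⟨_, p_psi⟩, ⟨_, p_E⟩, ⟨_, (Solenoidal.mem_iff (w := fun a => ⟨_, p_F a⟩)).1 hpF⟩,
        ⟨_, (TTSpace.isTT_iff (h := fun a b => ⟨_, p_h a b⟩)).1 hph⟩⟩,
      ⟨_, phi⟩, ⟨_, B⟩, ⟨_, (Solenoidal.mem_iff (w := fun a => ⟨_, S a⟩)).1 hS⟩,
      ⟨_, p_phi⟩, ⟨_, p_B⟩, ⟨_, (Solenoidal.mem_iff (w := fun a => ⟨_, p_S a⟩)).1 hpS⟩,
      ⟨_, dfield⟩, ⟨_, dmom⟩⟩, rfl⟩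
  · rintro ⟨c, rfl⟩
    exact ⟨⟨Solenoidal.mem_iff.2 c.q.F.2, Solenoidal.mem_iff.2 c.p.F.2, Solenoidal.mem_iff.2 c.S.2,
        Solenoidal.mem_iff.2 c.p_S.2, TTSpace.isTT_iff.2 c.q.h.2, TTSpace.isTT_iff.2 c.p.h.2⟩,
      ⟨c.q.psi.2, c.q.E.2, fun a => (c.q.F.1 a).2, fun a b => (c.q.h.1 a b).2⟩,
      ⟨c.p.psi.2, c.p.E.2, fun a => (c.p.F.1 a).2, fun a b => (c.p.h.1 a b).2⟩,
      ⟨c.phi.2, c.B.2, fun a => (c.S.1 a).2⟩, ⟨c.p_phi.2, c.p_B.2, fun a => (c.p_S.1 a).2⟩,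
      c.dfield.2, c.dmom.2⟩

variable {b : Background} {t : ℝ} {c c' : Modes}

theorem assemble_q_apply (b : Background) (t : ℝ) (c : Modes) (x : E3) (i j : Fin 3) :
    (assemble b t c.toSVT).q x i j = 2 * b.A t * c.q.tensor i j x := by
  rw [← TensorModes.svtTensor_apply]; rfl

theorem assemble_P_apply (b : Background) (t : ℝ) (c : Modes) (x : E3) (i j : Fin 3) :
    (assemble b t c.toSVT).P x i j = 2 * b.P t * c.p.tensor i j x := by
  rw [← TensorModes.svtTensor_apply]; rfl

theorem assemble_injective (hA : b.A t ≠ 0) (hP : b.P t ≠ 0) (hN : b.N t ≠ 0)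
    (h : assemble b t c.toSVT = assemble b t c'.toSVT) : c = c' := by
  have hq : c.q = c'.q := TensorModes.tensor_injective <| funext₂ fun i j => ext_apply fun x => by
    simpa [assemble_q_apply, hA] using congrFun₂ (congrFun (congrArg ADM.q h) x) i j
  have hp : c.p = c'.p := TensorModes.tensor_injective <| funext₂ fun i j => ext_apply fun x => by
    simpa [assemble_P_apply, hP] using congrFun₂ (congrFun (congrArg ADM.P h) x) i j
  obtain ⟨hB, hS⟩ := Solenoidal.grad_add_injective fun a => ext_apply fun x =>
    congrFun₂ (congrArg ADM.Nv h) x a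
  obtain ⟨hpB, hpS⟩ := Solenoidal.grad_add_injective fun a => ext_apply fun x =>
    congrFun₂ (congrArg ADM.Piv h) x a
  exact Modes.ext hq hp
    (ext_apply fun x => mul_left_cancel₀ hN (congrFun (congrArg ADM.N h) x)) hB hS
    (ext_apply fun x => mul_left_cancel₀ hN (congrFun (congrArg ADM.Pi h) x)) hpB hpS
    (ext_apply fun x => congrFun (congrArg ADM.field h) x)
    (ext_apply fun x => congrFun (congrArg ADM.mom h) x)

theorem svt_assemble (hA : b.A t ≠ 0) (hP : b.P t ≠ 0) (hN : b.N t ≠ 0) :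
    svt b t (assemble b t c.toSVT) = c.toSVT := by
  obtain ⟨hadm, heq⟩ := Classical.epsilon_spec
    (p := fun X : SVT => X.IsAdmissible ∧ assemble b t X = assemble b t c.toSVT)
    ⟨c.toSVT, isAdmissible_iff.2 ⟨c, rfl⟩, rfl⟩
  obtain ⟨c', hc'⟩ := isAdmissible_iff.1 hadm
  rw [← hc'] at heq
  rw [svt, ← hc', assemble_injective hA hP hN heq]

end Modes

/-! ### First variations at homogeneous, isotropic configurations -/

/-- `G` is a smooth one-parameter family of functions with the constant value `c` at parameter `0`
and the first variation `f` there. -/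
structure HasVariation (G : ℝ → E3 → ℝ) (c : ℝ) (f : DecaySpace) : Prop where
  smooth : ∀ x, ContDiffAt ℝ ∞ (fun z : ℝ × E3 => G z.1 z.2) (0, x)
  base : ∀ x, G 0 x = c
  hasDerivAt : ∀ x, HasDerivAt (fun r => G r x) (f x) 0

namespace HasVariation

variable {F G : ℝ → E3 → ℝ} {c d : ℝ} {f g : DecaySpace}

protected theorem congr {c' : ℝ} {f' : DecaySpace} (h : HasVariation F c f) (hc : c = c')
    (hf : f = f') : HasVariation F c' f' := hc ▸ hf ▸ h

theorem affine (c : ℝ) (f : DecaySpace) : HasVariation (fun r x => c + r * f x) c f where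
  smooth x := contDiffAt_const.add (contDiffAt_fst.mul (f.2.1.contDiffAt.comp (0, x)
    contDiffAt_snd))
  base x := by simp
  hasDerivAt x := by simpa using ((hasDerivAt_id (0 : ℝ)).mul_const (f x)).const_add c

protected theorem const (c : ℝ) : HasVariation (fun _ _ => c) c 0 where
  smooth _ := contDiffAt_const
  base _ := rfl
  hasDerivAt _ := hasDerivAt_const _ _

protected theorem add (hF : HasVariation F c f) (hG : HasVariation G d g) :
    HasVariation (fun r x => F r x + G r x) (c + d) (f + g) where
  smooth x := (hF.smooth x).add (hG.smooth x)
  base x := by rw [hF.base, hG.base]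
  hasDerivAt x := (hF.hasDerivAt x).add (hG.hasDerivAt x)

protected theorem sub (hF : HasVariation F c f) (hG : HasVariation G d g) :
    HasVariation (fun r x => F r x - G r x) (c - d) (f - g) where
  smooth x := (hF.smooth x).sub (hG.smooth x)
  base x := by rw [hF.base, hG.base]
  hasDerivAt x := (hF.hasDerivAt x).sub (hG.hasDerivAt x)

protected theorem sum {ι : Type*} [Fintype ι] {F : ι → ℝ → E3 → ℝ} {c : ι → ℝ}
    {f : ι → DecaySpace}
    (h : ∀ i, HasVariation (F i) (c i) (f i)) :
    HasVariation (fun r x => ∑ i, F i r x) (∑ i, c i) (∑ i, f i) where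
  smooth x := ContDiffAt.sum fun i _ => (h i).smooth x
  base x := Finset.sum_congr rfl fun i _ => (h i).base x
  hasDerivAt x := by
    rw [coe_sum_apply]
    exact HasDerivAt.fun_sum fun i _ => (h i).hasDerivAt x

protected theorem mul (hF : HasVariation F c f) (hG : HasVariation G d g) :
    HasVariation (fun r x => F r x * G r x) (c * d) (d • f + c • g) where
  smooth x := (hF.smooth x).mul (hG.smooth x)
  base x := by rw [hF.base, hG.base]
  hasDerivAt x := by
    have h := (hF.hasDerivAt x).mul (hG.hasDerivAt x)
    rw [hF.base, hG.base, mul_comm (f x)] at h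
    exact h

protected theorem const_mul (d : ℝ) (hF : HasVariation F c f) :
    HasVariation (fun r x => d * F r x) (d * c) (d • f) :=
  ((HasVariation.const d).mul hF).congr rfl (by rw [smul_zero, zero_add])

protected theorem comp {φ : ℝ → ℝ} (hφ : ContDiffAt ℝ ∞ φ c) (hF : HasVariation F c f) :
    HasVariation (fun r x => φ (F r x)) (φ c) (deriv φ c • f) where
  smooth x := ContDiffAt.comp (g := φ) (0, x) (by rwa [hF.base]) (hF.smooth x)
  base x := by rw [hF.base]
  hasDerivAt x := by
    have h := hφ.differentiableAt (by simp)
    rw [← hF.base x] at h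
    have := h.hasDerivAt.comp 0 (hF.hasDerivAt x)
    rwa [hF.base] at this

protected theorem pow (n : ℕ) (hF : HasVariation F c f) :
    HasVariation (fun r x => F r x ^ n) (c ^ n) ((n * c ^ (n - 1)) • f) := by
  simpa using hF.comp (φ := (· ^ n)) (contDiff_id.pow n).contDiffAt

protected theorem inv (hc : c ≠ 0) (hF : HasVariation F c f) :
    HasVariation (fun r x => (F r x)⁻¹) c⁻¹ (-(c ^ 2)⁻¹ • f) := by
  simpa using hF.comp (φ := (·⁻¹)) (contDiffAt_inv ℝ hc)

protected theorem div (hd : d ≠ 0) (hF : HasVariation F c f) (hG : HasVariation G d g) :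
    HasVariation (fun r x => F r x / G r x) (c / d) (d⁻¹ • f - (c / d ^ 2) • g) := by
  simp only [div_eq_mul_inv]
  exact (hF.mul (hG.inv hd)).congr rfl (by module)

protected theorem sqrt (hc : 0 < c) (hF : HasVariation F (c ^ 2) f) :
    HasVariation (fun r x => Real.sqrt (F r x)) c ((2 * c)⁻¹ • f) := by
  have hne : c ^ 2 ≠ 0 := by positivity
  refine (hF.comp (φ := Real.sqrt) (Real.contDiffAt_sqrt hne)).congr (Real.sqrt_sq hc.le) ?_
  rw [(Real.hasDerivAt_sqrt hne).deriv, Real.sqrt_sq hc.le, one_div]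

protected theorem pd (i : Fin 3) (hF : HasVariation F c f) :
    HasVariation (fun r => Cosmo.pd i (F r)) 0 (pdₗ i f) where
  smooth x := contDiffAt_fderiv_right _ (hF.smooth x)
  base x := by
    rw [show F 0 = fun _ => c from funext hF.base, pd_const]
    rfl
  hasDerivAt x := by
    have h := hasDerivAt_fderiv_right (EuclideanSpace.single i (1 : ℝ))
      ((hF.smooth x).of_le (WithTop.coe_le_coe.2 le_top))
    rwa [show (fun y => deriv (fun s => F s y) 0) = f.1 from
      funext fun y => (hF.hasDerivAt y).deriv] at h

end HasVariation

theorem adjugate_apply (A : Mat3) (i j : Fin 3) :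
    A.adjugate i j
      = A (j + 1) (i + 1) * A (j + 2) (i + 2) - A (j + 1) (i + 2) * A (j + 2) (i + 1) := by
  fin_cases i <;> fin_cases j <;> simp [Matrix.adjugate_fin_three] <;> ring

/-- `F` is a smooth one-parameter family of tensor fields with the value `c δ_ij` at parameter `0`
and the first variation `T` there. -/
def HasTensorVariation (F : ℝ → E3 → Mat3) (c : ℝ) (T : Fin 3 → Fin 3 → DecaySpace) : Prop :=
  ∀ i j, HasVariation (fun r x => F r x i j) (c * kron i j) (T i j)

namespace HasTensorVariation

variable {F G : ℝ → E3 → Mat3} {c d : ℝ} {T U : Fin 3 → Fin 3 → DecaySpace}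

protected theorem congr {c' : ℝ} {T' : Fin 3 → Fin 3 → DecaySpace}
    (h : HasTensorVariation F c T) (hc : c = c') (hT : ∀ i j, T i j = T' i j) :
    HasTensorVariation F c' T' := fun i j => (h i j).congr (by rw [hc]) (hT i j)

protected theorem mul (hF : HasTensorVariation F c T) (hG : HasTensorVariation G d U) :
    HasTensorVariation (fun r x => F r x * G r x) (c * d) (d • T + c • U) := by
  intro i j
  simp only [Matrix.mul_apply]
  refine (HasVariation.sum fun k => (hF i k).mul (hG k j)).congr ?_ ?_
  · simp [kron]
  · simp [Finset.sum_add_distrib, kron]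

protected theorem trace (hF : HasTensorVariation F c T) :
    HasVariation (fun r x => (F r x).trace) (3 * c) (∑ i, T i i) :=
  (HasVariation.sum fun i => hF i i).congr (by simp [kron_self]) rfl

protected theorem det (hF : HasTensorVariation F c T) :
    HasVariation (fun r x => (F r x).det) (c ^ 3) (c ^ 2 • ∑ i, T i i) := by
  have hexpand (r : ℝ) (x : E3) : (F r x).det
      = F r x 0 0 * (F r x 1 1 * F r x 2 2 - F r x 1 2 * F r x 2 1)
        - F r x 0 1 * (F r x 1 0 * F r x 2 2 - F r x 1 2 * F r x 2 0)
        + F r x 0 2 * (F r x 1 0 * F r x 2 1 - F r x 1 1 * F r x 2 0) := by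
    rw [Matrix.det_fin_three]; ring
  simp only [hexpand]
  refine ((((hF 0 0).mul (((hF 1 1).mul (hF 2 2)).sub ((hF 1 2).mul (hF 2 1)))).sub
    ((hF 0 1).mul (((hF 1 0).mul (hF 2 2)).sub ((hF 1 2).mul (hF 2 0))))).add
    ((hF 0 2).mul (((hF 1 0).mul (hF 2 1)).sub ((hF 1 1).mul (hF 2 0))))).congr ?_ ?_
  · simp [kron]; ring
  · simp [kron, Fin.sum_univ_three]; module

protected theorem adjugate (hF : HasTensorVariation F c T) :
    HasTensorVariation (fun r x => (F r x).adjugate) (c ^ 2)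
      (fun i j => c • (kron i j • ∑ k, T k k - T i j)) := by
  intro i j
  simp only [adjugate_apply]
  refine (((hF (j + 1) (i + 1)).mul (hF (j + 2) (i + 2))).sub
    ((hF (j + 1) (i + 2)).mul (hF (j + 2) (i + 1)))).congr ?_ ?_
  · fin_cases i <;> fin_cases j <;> simp [kron] <;> ring
  · fin_cases i <;> fin_cases j <;> simp [kron, Fin.sum_univ_three] <;> module

protected theorem inv (hc : c ≠ 0) (hF : HasTensorVariation F c T) :
    HasTensorVariation (fun r x => (F r x)⁻¹) c⁻¹ (-(c ^ 2)⁻¹ • T) := by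
  intro i j
  simp only [Matrix.inv_def, Ring.inverse_eq_inv', Matrix.smul_apply, smul_eq_mul]
  refine ((hF.det.inv (by positivity)).mul (hF.adjugate i j)).congr ?_ ?_
  · field_simp
  · simp only [Pi.smul_apply]
    match_scalars <;> field_simp; ring

end HasTensorVariation

/-- The linearized Christoffel symbols of the metric `A (δ + 2 T)`, at first order in `T`. -/
def linChristoffel (T : Fin 3 → Fin 3 → DecaySpace) (c a b : Fin 3) : DecaySpace :=
  pdₗ a (T b c) + pdₗ b (T a c) - pdₗ c (T a b)

/-- The linearized Ricci tensor of the metric `A (δ + 2 T)`, at first order in `T`. -/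
def linRicci (T : Fin 3 → Fin 3 → DecaySpace) (a b : Fin 3) : DecaySpace :=
  ∑ c, pdₗ c (linChristoffel T c a b) - ∑ c, pdₗ b (linChristoffel T c a c)

namespace HasTensorVariation

variable {q : ℝ → E3 → Mat3} {f : ℝ → E3 → ℝ} {a f₀ : ℝ} {T : Fin 3 → Fin 3 → DecaySpace}
  {δf : DecaySpace}

theorem inv_metric (ha : 0 < a) (hq : HasTensorVariation q (a ^ 2) ((2 * a ^ 2) • T)) :
    HasTensorVariation (fun r x => (q r x)⁻¹) (a ^ 2)⁻¹ ((-2 * (a ^ 2)⁻¹) • T) :=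
  (hq.inv (by positivity)).congr rfl fun i j => by
    simp only [Pi.smul_apply]
    match_scalars; field_simp

theorem sqrtDet (ha : 0 < a) (hq : HasTensorVariation q (a ^ 2) ((2 * a ^ 2) • T)) :
    HasVariation (fun r => Cosmo.sqrtDet (q r)) (a ^ 3) (a ^ 3 • ∑ i, T i i) :=
  ((hq.det.congr (by ring) rfl).sqrt (c := a ^ 3) (by positivity)).congr rfl (by
    simp only [Pi.smul_apply, ← Finset.smul_sum]
    match_scalars; field_simp)

theorem christoffel (ha : 0 < a) (hq : HasTensorVariation q (a ^ 2) ((2 * a ^ 2) • T))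
    (c i j : Fin 3) :
    HasVariation (fun r => Cosmo.christoffel (q r) c i j) 0 (linChristoffel T c i j) := by
  refine ((HasVariation.sum fun d => (hq.inv_metric ha c d).mul
    ((((hq j d).pd i).add ((hq i d).pd j)).sub ((hq i j).pd d))).const_mul (1 / 2)).congr
      (by simp) ?_
  simp only [add_zero, sub_zero, zero_smul, zero_add, mul_smul, Pi.smul_apply, map_smul,
    ← Finset.smul_sum, sum_kron_smul, linChristoffel]
  match_scalars <;> field_simp

theorem ricci (ha : 0 < a) (hq : HasTensorVariation q (a ^ 2) ((2 * a ^ 2) • T)) :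
    HasTensorVariation (fun r => Cosmo.ricci (q r)) 0 (linRicci T) := by
  intro i j
  have hΓ := hq.christoffel ha
  refine (((HasVariation.sum fun c => (hΓ c i j).pd c).sub
    (HasVariation.sum fun c => (hΓ c i c).pd j)).add
    (HasVariation.sum fun c => HasVariation.sum fun d =>
      ((hΓ c c d).mul (hΓ d i j)).sub ((hΓ c j d).mul (hΓ d i c)))).congr (by simp) ?_
  simp [linRicci]

theorem scalarCurv (ha : 0 < a) (hq : HasTensorVariation q (a ^ 2) ((2 * a ^ 2) • T)) :
    HasVariation (fun r => Cosmo.scalarCurv (q r)) 0 ((a ^ 2)⁻¹ • ∑ i, linRicci T i i) :=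
  (((hq.inv_metric ha).mul (hq.ricci ha)).trace).congr (by simp) (by simp [Finset.smul_sum])

theorem covHess (ha : 0 < a) (hq : HasTensorVariation q (a ^ 2) ((2 * a ^ 2) • T))
    (hf : HasVariation f f₀ δf) :
    HasTensorVariation (fun r => Cosmo.covHess (q r) (f r)) 0 (fun i j => pdₗ i (pdₗ j δf)) :=
  fun i j => (((hf.pd j).pd i).sub (HasVariation.sum fun c =>
    (hq.christoffel ha c i j).mul (hf.pd c))).congr (by simp) (by simp)

theorem gradUp (ha : 0 < a) (hq : HasTensorVariation q (a ^ 2) ((2 * a ^ 2) • T))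
    (hf : HasVariation f f₀ δf) (i : Fin 3) :
    HasVariation (fun r x => Cosmo.gradUp (q r) (f r) x i) 0 ((a ^ 2)⁻¹ • pdₗ i δf) := by
  refine (HasVariation.sum fun j => (hq.inv_metric ha i j).mul (hf.pd j)).congr (by simp) ?_
  simp only [zero_smul, zero_add, mul_smul, ← Finset.smul_sum, sum_kron_smul]

theorem gradSq (ha : 0 < a) (hq : HasTensorVariation q (a ^ 2) ((2 * a ^ 2) • T))
    (hf : HasVariation f f₀ δf) :
    HasVariation (fun r => Cosmo.gradSq (q r) (f r)) 0 0 :=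
  (HasVariation.sum fun i => (hf.pd i).mul (hq.gradUp ha hf i)).congr (by simp) (by simp)

end HasTensorVariation

/-- A smooth one-parameter family of phase space points with the value `q_ij = a² δ_ij`,
`P^ij = p δ^ij`, `φ = f`, `π = m` at parameter `0` and with the first variations
`δq_ij = 2 a² T_ij`, `δP^ij = 2 p R_ij`, `δφ = δf`, `δπ = δm`. -/
structure HasADMVariation (X : ℝ → ADM) (a p f m : ℝ) (T R : Fin 3 → Fin 3 → DecaySpace)
    (δf δm : DecaySpace) : Prop where
  q : HasTensorVariation (fun r => (X r).q) (a ^ 2) ((2 * a ^ 2) • T)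
  P : HasTensorVariation (fun r => (X r).P) p ((2 * p) • R)
  field : HasVariation (fun r => (X r).field) f δf
  mom : HasVariation (fun r => (X r).mom) m δm

/-- A smooth one-parameter family of descriptors with a constant lapse `n₀` and no shift at
parameter `0`, and with the first variations `ν` of the lapse and `w` of the shift. -/
structure HasDescriptorVariation (d : ℝ → Descriptor) (n₀ : ℝ) (ν : DecaySpace)
    (w : Fin 3 → DecaySpace) : Prop where
  n : HasVariation (fun r => (d r).n) n₀ ν
  v : ∀ i, HasVariation (fun r x => (d r).v x i) 0 (w i)

namespace HasADMVariation

variable {M : Model} {X : ℝ → ADM} {d : ℝ → Descriptor} {a p f m n₀ : ℝ}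
  {T R : Fin 3 → Fin 3 → DecaySpace} {δf δm ν : DecaySpace} {w : Fin 3 → DecaySpace}

theorem trP (hX : HasADMVariation X a p f m T R δf δm) :
    HasVariation (fun r => Cosmo.trP (X r)) (3 * (a ^ 2 * p))
      ((2 * (a ^ 2 * p)) • ∑ i, (T i i + R i i)) := by
  refine (hX.q.mul hX.P).trace.congr rfl ?_
  simp only [Pi.add_apply, Pi.smul_apply, Finset.smul_sum]
  exact Finset.sum_congr rfl fun i _ => by module

theorem kinP (hX : HasADMVariation X a p f m T R δf δm) :
    HasVariation (fun r => Cosmo.kinP (X r)) (-(3 / 2) * (a ^ 2 * p) ^ 2)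
      ((-2 * (a ^ 2 * p) ^ 2) • ∑ i, (T i i + R i i)) := by
  refine ((((hX.q.mul hX.P).mul hX.q).mul hX.P).trace.sub
    ((hX.trP.pow 2).const_mul (1 / 2))).congr (by ring) ?_
  simp only [Pi.add_apply, Pi.smul_apply, Finset.sum_add_distrib, ← Finset.smul_sum]
  module

theorem hamC (hX : HasADMVariation X a p f m T R δf δm) (ha : 0 < a) (hlam : M.lam ≠ 0)
    (hV : ContDiff ℝ ∞ M.V) :
    HasVariation (fun r => Cosmo.hamC M (X r))
      (-(3 / 2) * a * p ^ 2
        + M.kappa * (M.lam * m ^ 2 / (2 * a ^ 3) + a ^ 3 * M.V f / (2 * M.lam)))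
      ((-(a * p ^ 2) / 2) • ∑ i, T i i - (2 * a * p ^ 2) • ∑ i, R i i
        - a • ∑ i, linRicci T i i
        + M.kappa • ((M.lam * m / a ^ 3) • δm
          + ((a ^ 3 * M.V f / M.lam - M.lam * m ^ 2 / a ^ 3) / 2) • ∑ i, T i i
          + (a ^ 3 * deriv M.V f / (2 * M.lam)) • δf)) := by
  have hs := hX.q.sqrtDet ha
  refine (((hX.kinP.div (by positivity) hs).sub (hs.mul (hX.q.scalarCurv ha))).add
    (((((hX.mom.pow 2).const_mul M.lam).div (by positivity) (hs.const_mul 2)).add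
      ((hs.mul ((hX.q.gradSq ha hX.field).add (hX.field.comp hV.contDiffAt))).div
        (by positivity) (HasVariation.const (2 * M.lam)))).const_mul M.kappa)).congr ?_ ?_
  · field_simp; ring
  · simp only [Finset.sum_add_distrib]
    match_scalars <;> field_simp <;> ring

theorem diffC (hX : HasADMVariation X a p f m T R δf δm) (i : Fin 3) :
    HasVariation (fun r x => Cosmo.diffC M (X r) x i) 0
      ((-4 * a ^ 2 * p) • ∑ j, pdₗ j (T i j + R j i) + (2 * a ^ 2 * p) • pdₗ i (∑ j, T j j)
        + (M.kappa * m) • pdₗ i δf) := by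
  refine ((((HasVariation.sum fun j => (HasVariation.sum fun k =>
      (hX.q i k).mul (hX.P j k)).pd j).const_mul (-2)).add
    (HasVariation.sum fun j => HasVariation.sum fun k => (hX.P j k).mul ((hX.q j k).pd i))).add
    ((hX.mom.const_mul M.kappa).mul (hX.field.pd i))).congr (by simp) ?_
  simp only [Pi.smul_apply, Finset.sum_add_distrib, mul_smul, ← Finset.smul_sum, sum_kron_smul,
    map_add, map_smul, map_sum, zero_smul, zero_add]
  module

theorem secVF_q (hX : HasADMVariation X a p f m T R δf δm) (ha : 0 < a)
    (hd : HasDescriptorVariation d n₀ ν w) :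
    HasTensorVariation (fun r => (secVF M (d r) (X r)).q) (-(n₀ * a * p)) fun i j =>
      (a * p) • ((2 * n₀) • (T i j + (2 : ℝ) • R i j)
          - kron i j • (ν + n₀ • ∑ k, (T k k + (2 : ℝ) • R k k)))
        + a ^ 2 • (pdₗ i (w j) + pdₗ j (w i)) := by
  intro i j
  have hs := hX.q.sqrtDet ha
  refine ((((hd.n.const_mul 2).div (by positivity) hs).mul
      ((((hX.q.mul hX.P).mul hX.q) i j).sub ((hX.trP.const_mul (1 / 2)).mul (hX.q i j)))).add
    (HasVariation.sum fun c => (((hd.v c).mul ((hX.q i j).pd c)).add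
      ((hX.q c j).mul ((hd.v c).pd i))).add ((hX.q i c).mul ((hd.v c).pd j)))).congr ?_ ?_
  · simp; field_simp; ring
  · simp only [Pi.add_apply, Pi.smul_apply, Finset.sum_add_distrib, mul_smul, zero_smul,
      zero_add, ← Finset.smul_sum, sum_kron_smul, kron_comm _ j]
    match_scalars <;> field_simp <;> ring

theorem secVF_P_kinetic (hX : HasADMVariation X a p f m T R δf δm) (ha : 0 < a)
    {n : ℝ → E3 → ℝ} (hn : HasVariation n n₀ ν) :
    HasTensorVariation (fun r x => Matrix.of fun i j =>
        n r x / (2 * Cosmo.sqrtDet (X r).q x) * Cosmo.kinP (X r) x * ((X r).q x)⁻¹ i j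
          - 2 * n r x / Cosmo.sqrtDet (X r).q x * (((X r).P x * (X r).q x * (X r).P x) i j
            - (1 / 2) * Cosmo.trP (X r) x * (X r).P x i j))
      (n₀ * p ^ 2 / (4 * a)) fun i j =>
      (p ^ 2 / a) • (kron i j • ((1 / 4 : ℝ) • ν
          + n₀ • ((3 / 4 : ℝ) • ∑ k, T k k + ∑ k, R k k))
        - n₀ • ((5 / 2 : ℝ) • T i j + (2 : ℝ) • R i j)) := by
  intro i j
  have hs := hX.q.sqrtDet ha
  refine ((((hn.div (by positivity) (hs.const_mul 2)).mul hX.kinP).mul (hX.q.inv_metric ha i j)).sub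
    (((hn.const_mul 2).div (by positivity) hs).mul
      ((((hX.P.mul hX.q).mul hX.P) i j).sub ((hX.trP.const_mul (1 / 2)).mul (hX.P i j))))).congr
    ?_ ?_
  · field_simp; ring
  · simp only [Pi.add_apply, Pi.smul_apply, Finset.sum_add_distrib]
    match_scalars <;> field_simp <;> ring

theorem secVF_P_curvature (hX : HasADMVariation X a p f m T R δf δm) (ha : 0 < a)
    {n : ℝ → E3 → ℝ} (hn : HasVariation n n₀ ν) :
    HasTensorVariation (fun r x => Matrix.of fun i j =>
        n r x * Cosmo.sqrtDet (X r).q x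
          * ((((X r).q x)⁻¹ * Cosmo.ricci (X r).q x * ((X r).q x)⁻¹) i j
            - (1 / 2) * Cosmo.scalarCurv (X r).q x * ((X r).q x)⁻¹ i j))
      0 fun i j =>
      (n₀ / a) • (linRicci T i j - ((1 / 2) * kron i j) • ∑ k, linRicci T k k) := by
  intro i j
  have hi := hX.q.inv_metric ha
  refine ((hn.mul (hX.q.sqrtDet ha)).mul ((((hi.mul (hX.q.ricci ha)).mul hi) i j).sub
    (((hX.q.scalarCurv ha).const_mul (1 / 2)).mul (hi i j)))).congr (by simp) ?_
  simp only [Pi.add_apply, Pi.smul_apply]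
  match_scalars <;> field_simp <;> ring

theorem secVF_P_hessian (hX : HasADMVariation X a p f m T R δf δm) (ha : 0 < a)
    {n : ℝ → E3 → ℝ} (hn : HasVariation n n₀ ν) :
    HasTensorVariation (fun r x => Matrix.of fun i j =>
        Cosmo.sqrtDet (X r).q x
          * ((((X r).q x)⁻¹ * Cosmo.covHess (X r).q (n r) x * ((X r).q x)⁻¹) i j
            - (((X r).q x)⁻¹ * Cosmo.covHess (X r).q (n r) x).trace * ((X r).q x)⁻¹ i j))
      0 fun i j => a⁻¹ • (pdₗ i (pdₗ j ν) - kron i j • lapₗ ν) := by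
  intro i j
  have hi := hX.q.inv_metric ha
  have hH := hX.q.covHess ha hn
  refine ((hX.q.sqrtDet ha).mul ((((hi.mul hH).mul hi) i j).sub
    ((hi.mul hH).trace.mul (hi i j)))).congr (by simp) ?_
  simp only [Pi.add_apply, Pi.smul_apply, Finset.sum_add_distrib, ← Finset.smul_sum, lapₗ_eq]
  match_scalars <;> field_simp <;> ring

theorem secVF_P_matter (hX : HasADMVariation X a p f m T R δf δm) (ha : 0 < a)
    (hlam : M.lam ≠ 0) (hV : ContDiff ℝ ∞ M.V)
    {n : ℝ → E3 → ℝ} (hn : HasVariation n n₀ ν) :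
    HasTensorVariation (fun r x => Matrix.of fun i j =>
        M.kappa * n r x
          * (M.lam * (X r).mom x ^ 2 / (4 * Cosmo.sqrtDet (X r).q x) * ((X r).q x)⁻¹ i j
              - Cosmo.sqrtDet (X r).q x * (Cosmo.gradSq (X r).q (X r).field x + M.V ((X r).field x))
                  / (4 * M.lam) * ((X r).q x)⁻¹ i j
              + Cosmo.sqrtDet (X r).q x / (2 * M.lam) * Cosmo.gradUp (X r).q (X r).field x i
                  * Cosmo.gradUp (X r).q (X r).field x j))
      (M.kappa * n₀ * (M.lam * m ^ 2 / (4 * a ^ 5) - a * M.V f / (4 * M.lam))) fun i j =>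
      M.kappa • ((M.lam * m ^ 2 / (4 * a ^ 5) - a * M.V f / (4 * M.lam)) •
          (kron i j • ν - (2 * n₀) • T i j)
        + (n₀ * kron i j) • ((M.lam * m / (2 * a ^ 5)) • δm
          - (M.lam * m ^ 2 / (4 * a ^ 5) + a * M.V f / (4 * M.lam)) • ∑ k, T k k
          - (a * deriv M.V f / (4 * M.lam)) • δf)) := by
  intro i j
  have hi := hX.q.inv_metric ha
  have hs := hX.q.sqrtDet ha
  have hup := hX.q.gradUp ha hX.field
  refine ((hn.const_mul M.kappa).mul ((((((hX.mom.pow 2).const_mul M.lam).div (by positivity)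
      (hs.const_mul 4)).mul (hi i j)).sub
    (((hs.mul ((hX.q.gradSq ha hX.field).add (hX.field.comp hV.contDiffAt))).div
      (by positivity) (HasVariation.const (4 * M.lam))).mul (hi i j))).add
    (((hs.div (by positivity) (HasVariation.const (2 * M.lam))).mul (hup i)).mul (hup j)))).congr
    ?_ ?_
  · field_simp; ring
  · simp only [Pi.smul_apply]
    match_scalars <;> field_simp <;> ring

theorem secVF_P_lie (hX : HasADMVariation X a p f m T R δf δm)
    {v : ℝ → E3 → Fin 3 → ℝ} (hv : ∀ i, HasVariation (fun r x => v r x i) 0 (w i)) :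
    HasTensorVariation (fun r x => Matrix.of fun i j =>
        ∑ c, (pd c (fun y => v r y c * (X r).P y i j) x
          - (X r).P x c j * pd c (fun y => v r y i) x
          - (X r).P x i c * pd c (fun y => v r y j) x))
      0 fun i j => p • (kron i j • divₗ w - pdₗ j (w i) - pdₗ i (w j)) := by
  intro i j
  refine (HasVariation.sum fun c => ((((hv c).mul (hX.P i j)).pd c).sub
    ((hX.P c j).mul ((hv i).pd c))).sub ((hX.P i c).mul ((hv j).pd c))).congr (by simp) ?_
  simp only [Finset.sum_sub_distrib, map_smul, mul_smul, zero_smul, add_zero, zero_add,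
    ← Finset.smul_sum, kron_comm _ j, sum_kron_smul (fun c => pdₗ c _), divₗ_eq]
  module

theorem secVF_P (hX : HasADMVariation X a p f m T R δf δm) (ha : 0 < a) (hlam : M.lam ≠ 0)
    (hV : ContDiff ℝ ∞ M.V) (hd : HasDescriptorVariation d n₀ ν w) :
    HasTensorVariation (fun r => (secVF M (d r) (X r)).P)
      (n₀ * (p ^ 2 / (4 * a)
        + M.kappa * (M.lam * m ^ 2 / (4 * a ^ 5) - a * M.V f / (4 * M.lam)))) fun i j =>
      (p ^ 2 / a) • (kron i j • ((1 / 4 : ℝ) • ν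
          + n₀ • ((3 / 4 : ℝ) • ∑ k, T k k + ∑ k, R k k))
        - n₀ • ((5 / 2 : ℝ) • T i j + (2 : ℝ) • R i j))
      - (n₀ / a) • (linRicci T i j - ((1 / 2) * kron i j) • ∑ k, linRicci T k k)
      + a⁻¹ • (pdₗ i (pdₗ j ν) - kron i j • lapₗ ν)
      + M.kappa • ((M.lam * m ^ 2 / (4 * a ^ 5) - a * M.V f / (4 * M.lam)) •
          (kron i j • ν - (2 * n₀) • T i j)
        + (n₀ * kron i j) • ((M.lam * m / (2 * a ^ 5)) • δm
          - (M.lam * m ^ 2 / (4 * a ^ 5) + a * M.V f / (4 * M.lam)) • ∑ k, T k k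
          - (a * deriv M.V f / (4 * M.lam)) • δf))
      + p • (kron i j • divₗ w - pdₗ j (w i) - pdₗ i (w j)) := fun i j =>
  (((((hX.secVF_P_kinetic ha hd.n i j).sub (hX.secVF_P_curvature ha hd.n i j)).add
    (hX.secVF_P_hessian ha hd.n i j)).add (hX.secVF_P_matter ha hlam hV hd.n i j)).add
    (hX.secVF_P_lie hd.v i j)).congr (by ring) rfl

theorem secVF_field (hX : HasADMVariation X a p f m T R δf δm) (ha : 0 < a)
    (hd : HasDescriptorVariation d n₀ ν w) :
    HasVariation (fun r => (secVF M (d r) (X r)).field) (n₀ * M.lam * m / a ^ 3)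
      ((M.lam / a ^ 3) • (m • ν + n₀ • δm - (n₀ * m) • ∑ k, T k k)) := by
  refine ((((hd.n.mul (HasVariation.const M.lam)).mul hX.mom).div (by positivity)
    (hX.q.sqrtDet ha)).add (HasVariation.sum fun i => (hd.v i).mul (hX.field.pd i))).congr
    (by simp) ?_
  simp only [zero_smul, add_zero, Finset.sum_const_zero]
  match_scalars <;> field_simp

theorem secVF_mom (hX : HasADMVariation X a p f m T R δf δm) (ha : 0 < a) (hlam : M.lam ≠ 0)
    (hV : ContDiff ℝ ∞ M.V) (hd : HasDescriptorVariation d n₀ ν w) :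
    HasVariation (fun r => (secVF M (d r) (X r)).mom)
      (-(n₀ * a ^ 3 * deriv M.V f / (2 * M.lam)))
      ((n₀ * a / M.lam) • lapₗ δf
        - (a ^ 3 / (2 * M.lam)) • (deriv M.V f • ν + (n₀ * deriv M.V f) • ∑ k, T k k
          + (n₀ * deriv (deriv M.V) f) • δf)
        + m • divₗ w) := by
  have hs := hX.q.sqrtDet ha
  have hV' : ContDiff ℝ ∞ (deriv M.V) := (contDiff_infty_iff_deriv.1 hV).2
  refine (((HasVariation.sum fun i => (((hd.n.mul hs).mul (hX.q.gradUp ha hX.field i)).div hlam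
      (HasVariation.const M.lam)).pd i).sub
    (((hd.n.mul hs).mul (hX.field.comp hV'.contDiffAt)).div (by positivity)
      (HasVariation.const (2 * M.lam)))).add
    (HasVariation.sum fun i => ((hd.v i).mul hX.mom).pd i)).congr (by simp) ?_
  simp only [zero_smul, add_zero, zero_add, smul_zero, sub_zero, map_smul,
    ← Finset.smul_sum, divₗ_eq, lapₗ_eq]
  match_scalars <;> field_simp

end HasADMVariation

/-! ### The linearized equations in terms of the modes -/

theorem linRicci_eq (T : Fin 3 → Fin 3 → DecaySpace) (i j : Fin 3) :
    linRicci T i j = pdₗ i (∑ k, pdₗ k (T j k)) + pdₗ j (∑ k, pdₗ k (T i k)) - lapₗ (T i j)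
      - pdₗ i (pdₗ j (∑ k, T k k)) := by
  simp only [linRicci, linChristoffel, map_add, map_sub, map_sum, Finset.sum_add_distrib,
    Finset.sum_sub_distrib, lapₗ_eq, pdₗ_comm i, pdₗ_comm j _ (T i _)]
  simp only [pdₗ_comm j i]
  abel

namespace TensorModes

/-- The combination `ψ - ΔE/3`, in terms of which the scalar part of the curvature of the perturbed
metric is expressed. -/
def curvPot (T : TensorModes) : DecaySpace := T.psi - (1 / 3 : ℝ) • lapₗ T.E

theorem linRicci_tensor (T : TensorModes) (i j : Fin 3) :
    linRicci T.tensor i j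
      = -pdₗ i (pdₗ j T.curvPot) - kron i j • lapₗ T.curvPot - (1 / 2 : ℝ) • lapₗ (T.h.1 i j) := by
  rw [linRicci_eq, tensor_div, tensor_div, tensor_trace]
  simp only [tensor, curvPot, map_add, map_sub, map_smul, pdₗ_lapₗ, pdₗ_comm j i]
  module

theorem linRicci_tensor_trace (T : TensorModes) :
    ∑ i, linRicci T.tensor i i = (-4 : ℝ) • lapₗ T.curvPot := by
  simp only [linRicci_tensor, kron_self, one_smul, Finset.sum_sub_distrib, Finset.sum_neg_distrib,
    ← lapₗ_eq, ← Finset.smul_sum, ← map_sum, TTSpace.trace_eq_zero, map_zero, Finset.sum_const,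
    Finset.card_univ, Fintype.card_fin, map_nsmul]
  module

end TensorModes

theorem HasTimeDeriv.derivZero_eq {Y : ℝ → ADM} {Z : ADM} (h : HasTimeDeriv Y Z 0) :
    derivZero Y = Z := by
  obtain ⟨q, P, field, mom, N, Nv, Pi, Piv⟩ := Z
  simp only [derivZero, ADM.mk.injEq]
  exact ⟨funext fun x => Matrix.ext fun i j => ((h x).1 i j).deriv,
    funext fun x => Matrix.ext fun i j => ((h x).2.1 i j).deriv,
    funext fun x => (h x).2.2.1.deriv, funext fun x => (h x).2.2.2.1.deriv,
    funext fun x => (h x).2.2.2.2.1.deriv, funext₂ fun x i => ((h x).2.2.2.2.2.1 i).deriv,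
    funext fun x => (h x).2.2.2.2.2.2.1.deriv, funext₂ fun x i => ((h x).2.2.2.2.2.2.2 i).deriv⟩

/-- The descriptor with lapse part `n` and shift part `∂_a u + w_a`. -/
def descriptor (n u : DecaySpace) (w : Solenoidal) : Descriptor where
  n := n
  v x a := (pdₗ a u + w.1 a) x

theorem HasVariation.linear (f : DecaySpace) : HasVariation (fun r x => r * f x) 0 f := by
  simpa only [zero_add] using HasVariation.affine 0 f

theorem HasTensorVariation.smul_one (c : ℝ) :
    HasTensorVariation (fun _ _ => c • (1 : Mat3)) c 0 := fun i j =>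
  (HasVariation.const _).congr (by simp [kron, Matrix.one_apply]) rfl

theorem HasTensorVariation.smul_one_add (c : ℝ) {Z : E3 → Mat3} {T : Fin 3 → Fin 3 → DecaySpace}
    (hZ : ∀ x i j, Z x i j = T i j x) :
    HasTensorVariation (fun r x => c • (1 : Mat3) + r • Z x) c T := fun i j => by
  simpa [hZ, kron, Matrix.one_apply] using HasVariation.affine (c * kron i j) (T i j)

section Families

variable {b : Background} {t : ℝ}

theorem hasADMVariation_adm (hA : 0 < b.A t) :
    HasADMVariation (fun _ => b.adm t) √(b.A t) (b.P t) (b.field t) (b.mom t) 0 0 0 0 where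
  q := by
    rw [Real.sq_sqrt hA.le, smul_zero]
    exact HasTensorVariation.smul_one (b.A t)
  P := by
    rw [smul_zero]
    exact HasTensorVariation.smul_one (b.P t)
  field := HasVariation.const _
  mom := HasVariation.const _

theorem hasADMVariation_adm_add (hA : 0 < b.A t) (c : Modes) :
    HasADMVariation (fun r => b.adm t + r • assemble b t c.toSVT) √(b.A t) (b.P t) (b.field t)
      (b.mom t) c.q.tensor c.p.tensor c.dfield c.dmom where
  q := by
    rw [Real.sq_sqrt hA.le]
    exact HasTensorVariation.smul_one_add _ (Modes.assemble_q_apply b t c)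
  P := HasTensorVariation.smul_one_add _ (Modes.assemble_P_apply b t c)
  field := HasVariation.affine _ _
  mom := HasVariation.affine _ _

theorem hasDescriptorVariation_lapse_shift (c : Modes) :
    HasDescriptorVariation (fun r => ⟨(b.adm t + r • assemble b t c.toSVT).N,
        (b.adm t + r • assemble b t c.toSVT).Nv⟩) (b.N t) (b.N t • c.phi)
      fun i => pdₗ i c.B + c.S.1 i where
  n := HasVariation.affine _ (b.N t • c.phi)
  v i := HasVariation.affine 0 (pdₗ i c.B + c.S.1 i)

theorem hasDescriptorVariation_smul_descriptor (n u : DecaySpace) (w : Solenoidal) :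
    HasDescriptorVariation (fun r => r • descriptor n u w) 0 n fun i => pdₗ i u + w.1 i where
  n := HasVariation.linear n
  v i := HasVariation.linear (pdₗ i u + w.1 i)

end Families

section LinearizedFlow

/-- The linearized Hamiltonian constraint as a function of the modes. -/
def hamModes (M : Model) (b : Background) (t : ℝ) (c : Modes) : DecaySpace :=
  (-(3 / 2) * √(b.A t) * b.P t ^ 2) • (c.q.psi + (4 : ℝ) • c.p.psi)
    + (4 * √(b.A t)) • lapₗ c.q.curvPot
    + M.kappa • ((M.lam * b.mom t / √(b.A t) ^ 3) • c.dmom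
      + (3 / 2 * (√(b.A t) ^ 3 * M.V (b.field t) / M.lam
          - M.lam * b.mom t ^ 2 / √(b.A t) ^ 3)) • c.q.psi
      + (√(b.A t) ^ 3 * deriv M.V (b.field t) / (2 * M.lam)) • c.dfield)

/-- The potential of the gradient part of the linearized diffeomorphism constraint. -/
def diffScalar (M : Model) (b : Background) (t : ℝ) (c : Modes) : DecaySpace :=
  (-4 * b.A t * b.P t) • (c.p.psi - (1 / 2 : ℝ) • c.q.psi
      + (2 / 3 : ℝ) • lapₗ (c.q.E + c.p.E))
    + (M.kappa * b.mom t) • c.dfield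

/-- The divergence-free part of the linearized diffeomorphism constraint. -/
def diffVector (b : Background) (t : ℝ) (c : Modes) : Solenoidal :=
  (-2 * b.A t * b.P t) • Solenoidal.lap (c.q.F + c.p.F)

/-- The linearized canonical vector field, with vanishing perturbation of the multipliers, as an
operator on the modes. -/
def linModes (M : Model) (b : Background) (t : ℝ) (c : Modes) : Modes where
  q :=
    { psi := (-(b.N t * b.P t / (2 * √(b.A t)))) • (c.q.psi + (2 : ℝ) • c.p.psi + c.phi)
        + (1 / 3 : ℝ) • lapₗ c.B
      E := (b.N t * b.P t / √(b.A t)) • (c.q.E + (2 : ℝ) • c.p.E) + c.B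
      F := (b.N t * b.P t / √(b.A t)) • (c.q.F + (2 : ℝ) • c.p.F) + c.S
      h := (b.N t * b.P t / √(b.A t)) • (c.q.h + (2 : ℝ) • c.p.h) }
  p :=
    { psi := (b.N t * b.P t / √(b.A t)) •
          ((1 / 8 : ℝ) • (c.phi - c.q.psi) + (1 / 2 : ℝ) • c.p.psi)
        - (b.N t / (3 * √(b.A t) * b.P t)) • lapₗ (c.q.curvPot + c.phi)
        + (M.kappa * b.N t * √(b.A t) / (4 * b.P t)) •
          (b.pressure M t • (c.phi - (2 : ℝ) • c.q.psi)
            + (M.lam * b.mom t / b.A t ^ 3) • c.dmom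
            - (3 / 2 * (M.lam * b.mom t ^ 2 / b.A t ^ 3 + M.V (b.field t) / M.lam)) • c.q.psi
            - (deriv M.V (b.field t) / (2 * M.lam)) • c.dfield)
        + (1 / 6 : ℝ) • lapₗ c.B
      E := -(b.N t * b.P t / √(b.A t)) • ((5 / 4 : ℝ) • c.q.E + c.p.E)
        + (b.N t / (2 * √(b.A t) * b.P t)) • (c.q.curvPot + c.phi)
        - (M.kappa * b.N t * √(b.A t) * b.pressure M t / (2 * b.P t)) • c.q.E - c.B
      F := -(b.N t * b.P t / √(b.A t)) • ((5 / 4 : ℝ) • c.q.F + c.p.F)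
        - (M.kappa * b.N t * √(b.A t) * b.pressure M t / (2 * b.P t)) • c.q.F - c.S
      h := -(b.N t * b.P t / √(b.A t)) • ((5 / 4 : ℝ) • c.q.h + c.p.h)
        + (b.N t / (2 * √(b.A t) * b.P t)) • TTSpace.lap c.q.h
        - (M.kappa * b.N t * √(b.A t) * b.pressure M t / (2 * b.P t)) • c.q.h }
  phi := 0
  B := 0
  S := 0
  p_phi := (-(b.N t)⁻¹) • hamModes M b t c
  p_B := -diffScalar M b t c
  p_S := -diffVector b t c
  dfield := (M.lam * b.N t / √(b.A t) ^ 3) •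
    (b.mom t • c.phi + c.dmom - (3 * b.mom t) • c.q.psi)
  dmom := (b.N t * √(b.A t) / M.lam) • lapₗ c.dfield
    - (b.N t * √(b.A t) ^ 3 / (2 * M.lam)) •
      (deriv M.V (b.field t) • (c.phi + (3 : ℝ) • c.q.psi)
        + deriv (deriv M.V) (b.field t) • c.dfield)
    + b.mom t • lapₗ c.B

/-- The bracket of the phase space variables with the constraints smeared with `descriptor n u w`,
evaluated at the background and expressed in terms of modes. -/
def gaugeModes (M : Model) (b : Background) (t : ℝ) (n u : DecaySpace) (w : Solenoidal) :
    Modes where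
  q :=
    { psi := (-(b.P t / (2 * √(b.A t)))) • n + (1 / 3 : ℝ) • lapₗ u
      E := u
      F := w
      h := 0 }
  p :=
    { psi := (b.P t / (8 * √(b.A t))
          + M.kappa * √(b.A t) * b.pressure M t / (4 * b.P t)) • n
        - (1 / (3 * √(b.A t) * b.P t)) • lapₗ n + (1 / 6 : ℝ) • lapₗ u
      E := (1 / (2 * √(b.A t) * b.P t)) • n - u
      F := -w
      h := 0 }
  phi := 0
  B := 0
  S := 0
  p_phi := 0
  p_B := 0
  p_S := 0
  dfield := (M.lam * b.mom t / √(b.A t) ^ 3) • n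
  dmom := (-(√(b.A t) ^ 3 * deriv M.V (b.field t) / (2 * M.lam))) • n + b.mom t • lapₗ u

variable {M : Model} {b : Background} {t : ℝ}

theorem divₗ_grad_add (u : DecaySpace) (w : Solenoidal) :
    divₗ (fun i => pdₗ i u + w.1 i) = lapₗ u :=
  (map_add divₗ (fun i => pdₗ i u) w.1).trans (by
    rw [divₗ_grad, Solenoidal.divₗ_eq_zero, add_zero])

variable {X : ℝ → ADM} {d : ℝ → Descriptor}

theorem hasTensorVariation_secVF_q_linModes (hA : 0 < b.A t) {c : Modes}
    (hX : HasADMVariation X √(b.A t) (b.P t) (b.field t) (b.mom t) c.q.tensor c.p.tensor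
      c.dfield c.dmom)
    (hd : HasDescriptorVariation d (b.N t) (b.N t • c.phi) fun i => pdₗ i c.B + c.S.1 i) :
    HasTensorVariation (fun r => (secVF M (d r) (X r)).q) (-(b.N t * √(b.A t) * b.P t))
      ((2 * b.A t) • (linModes M b t c).q.tensor) := by
  have ha : 0 < √(b.A t) := Real.sqrt_pos.2 hA
  refine (hX.secVF_q ha hd).congr rfl fun i j => ?_
  simp only [Finset.sum_add_distrib, ← Finset.smul_sum, TensorModes.tensor_trace, Pi.smul_apply]
  simp only [linModes, TensorModes.tensor, map_add, map_smul, pdₗ_comm j i, Submodule.coe_add,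
    Submodule.coe_smul, Pi.add_apply, Pi.smul_apply]
  have hAa := Real.sq_sqrt hA.le
  generalize √(b.A t) = a at *
  rw [← hAa]
  match_scalars <;> field_simp <;> ring

theorem hasTensorVariation_secVF_q_gaugeModes (hA : 0 < b.A t) {n u : DecaySpace} {w : Solenoidal}
    (hX : HasADMVariation X √(b.A t) (b.P t) (b.field t) (b.mom t) 0 0 0 0)
    (hd : HasDescriptorVariation d 0 n fun i => pdₗ i u + w.1 i) :
    HasTensorVariation (fun r => (secVF M (d r) (X r)).q) 0
      ((2 * b.A t) • (gaugeModes M b t n u w).q.tensor) := by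
  have ha : 0 < √(b.A t) := Real.sqrt_pos.2 hA
  refine (hX.secVF_q ha hd).congr (by simp) fun i j => ?_
  simp only [gaugeModes, TensorModes.tensor, map_add, pdₗ_comm j i, Submodule.coe_zero,
    Pi.zero_apply, Pi.smul_apply, smul_zero]
  have hAa := Real.sq_sqrt hA.le
  generalize √(b.A t) = a at *
  rw [← hAa]
  match_scalars <;> field_simp <;> ring

theorem hasTensorVariation_secVF_P_linModes (hA : 0 < b.A t) (hP : b.P t ≠ 0) (hlam : M.lam ≠ 0)
    (hV : ContDiff ℝ ∞ M.V) {c : Modes}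
    (hX : HasADMVariation X √(b.A t) (b.P t) (b.field t) (b.mom t) c.q.tensor c.p.tensor
      c.dfield c.dmom)
    (hd : HasDescriptorVariation d (b.N t) (b.N t • c.phi) fun i => pdₗ i c.B + c.S.1 i) :
    HasTensorVariation (fun r => (secVF M (d r) (X r)).P)
      (b.N t * (b.P t ^ 2 / (4 * √(b.A t)) + M.kappa * √(b.A t) * b.pressure M t / 2))
      ((2 * b.P t) • (linModes M b t c).p.tensor) := by
  have ha : 0 < √(b.A t) := Real.sqrt_pos.2 hA
  have hAa := Real.sq_sqrt hA.le
  refine (hX.secVF_P ha hlam hV hd).congr ?_ fun i j => ?_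
  · unfold Background.pressure
    generalize √(b.A t) = a at *
    rw [← hAa]
    field_simp
    ring
  simp only [TensorModes.linRicci_tensor_trace]
  simp only [TensorModes.linRicci_tensor, TensorModes.tensor_trace, divₗ_grad_add]
  simp only [linModes, Background.pressure, TensorModes.tensor, TensorModes.curvPot, map_add,
    map_sub, map_smul, pdₗ_comm j i, pdₗ_lapₗ, Submodule.coe_add, Submodule.coe_sub,
    Submodule.coe_smul, Pi.add_apply, Pi.sub_apply, Pi.smul_apply, TTSpace.lap_apply]
  generalize √(b.A t) = a at *
  rw [← hAa]
  match_scalars <;> field_simp <;> ring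

theorem hasTensorVariation_secVF_P_gaugeModes (hA : 0 < b.A t) (hP : b.P t ≠ 0) (hlam : M.lam ≠ 0)
    (hV : ContDiff ℝ ∞ M.V) {n u : DecaySpace} {w : Solenoidal}
    (hX : HasADMVariation X √(b.A t) (b.P t) (b.field t) (b.mom t) 0 0 0 0)
    (hd : HasDescriptorVariation d 0 n fun i => pdₗ i u + w.1 i) :
    HasTensorVariation (fun r => (secVF M (d r) (X r)).P) 0
      ((2 * b.P t) • (gaugeModes M b t n u w).p.tensor) := by
  have ha : 0 < √(b.A t) := Real.sqrt_pos.2 hA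
  have hAa := Real.sq_sqrt hA.le
  refine (hX.secVF_P ha hlam hV hd).congr (by simp) fun i j => ?_
  simp only [gaugeModes, Background.pressure, TensorModes.tensor, divₗ_grad_add, map_add,
    map_sub, map_smul, pdₗ_comm j i, Submodule.coe_zero, Submodule.coe_neg, map_neg,
    Pi.zero_apply, Pi.neg_apply, Pi.smul_apply]
  generalize √(b.A t) = a at *
  rw [← hAa]
  match_scalars <;> field_simp <;> ring

theorem hasVariation_secVF_field_linModes (hA : 0 < b.A t) {c : Modes}
    (hX : HasADMVariation X √(b.A t) (b.P t) (b.field t) (b.mom t) c.q.tensor c.p.tensor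
      c.dfield c.dmom)
    (hd : HasDescriptorVariation d (b.N t) (b.N t • c.phi) fun i => pdₗ i c.B + c.S.1 i) :
    HasVariation (fun r => (secVF M (d r) (X r)).field) (M.lam * b.mom t / √(b.A t) ^ 3 * b.N t)
      (linModes M b t c).dfield := by
  refine (hX.secVF_field (Real.sqrt_pos.2 hA) hd).congr (by ring) ?_
  simp only [linModes, TensorModes.tensor_trace]
  module

theorem hasVariation_secVF_field_gaugeModes (hA : 0 < b.A t) {n u : DecaySpace} {w : Solenoidal}
    (hX : HasADMVariation X √(b.A t) (b.P t) (b.field t) (b.mom t) 0 0 0 0)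
    (hd : HasDescriptorVariation d 0 n fun i => pdₗ i u + w.1 i) :
    HasVariation (fun r => (secVF M (d r) (X r)).field) 0 (gaugeModes M b t n u w).dfield := by
  refine (hX.secVF_field (Real.sqrt_pos.2 hA) hd).congr (by simp) ?_
  simp only [gaugeModes]
  module

theorem hasVariation_secVF_mom_linModes (hA : 0 < b.A t) (hlam : M.lam ≠ 0)
    (hV : ContDiff ℝ ∞ M.V) {c : Modes}
    (hX : HasADMVariation X √(b.A t) (b.P t) (b.field t) (b.mom t) c.q.tensor c.p.tensor
      c.dfield c.dmom)
    (hd : HasDescriptorVariation d (b.N t) (b.N t • c.phi) fun i => pdₗ i c.B + c.S.1 i) :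
    HasVariation (fun r => (secVF M (d r) (X r)).mom)
      (-(√(b.A t) ^ 3 * deriv M.V (b.field t) / (2 * M.lam)) * b.N t)
      (linModes M b t c).dmom := by
  refine (hX.secVF_mom (Real.sqrt_pos.2 hA) hlam hV hd).congr (by ring) ?_
  simp only [linModes, TensorModes.tensor_trace, divₗ_grad_add]
  module

theorem hasVariation_secVF_mom_gaugeModes (hA : 0 < b.A t) (hlam : M.lam ≠ 0)
    (hV : ContDiff ℝ ∞ M.V) {n u : DecaySpace} {w : Solenoidal}
    (hX : HasADMVariation X √(b.A t) (b.P t) (b.field t) (b.mom t) 0 0 0 0)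
    (hd : HasDescriptorVariation d 0 n fun i => pdₗ i u + w.1 i) :
    HasVariation (fun r => (secVF M (d r) (X r)).mom) 0 (gaugeModes M b t n u w).dmom := by
  refine (hX.secVF_mom (Real.sqrt_pos.2 hA) hlam hV hd).congr (by simp) ?_
  simp only [gaugeModes, divₗ_grad_add, map_zero]
  module

theorem hasVariation_hamC_hamModes (hA : 0 < b.A t) (hlam : M.lam ≠ 0)
    (hV : ContDiff ℝ ∞ M.V) {c : Modes}
    (hX : HasADMVariation X √(b.A t) (b.P t) (b.field t) (b.mom t) c.q.tensor c.p.tensor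
      c.dfield c.dmom) :
    HasVariation (fun r => hamC M (X r))
      (-(3 / 2) * √(b.A t) * b.P t ^ 2
        + M.kappa * (M.lam * b.mom t ^ 2 / (2 * √(b.A t) ^ 3)
          + √(b.A t) ^ 3 * M.V (b.field t) / (2 * M.lam)))
      (hamModes M b t c) := by
  refine (hX.hamC (Real.sqrt_pos.2 hA) hlam hV).congr rfl ?_
  simp only [hamModes, TensorModes.tensor_trace, TensorModes.linRicci_tensor_trace]
  module

theorem hasVariation_diffC_diffModes (hA : 0 < b.A t) {c : Modes}
    (hX : HasADMVariation X √(b.A t) (b.P t) (b.field t) (b.mom t) c.q.tensor c.p.tensor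
      c.dfield c.dmom) (i : Fin 3) :
    HasVariation (fun r x => diffC M (X r) x i) 0
      (pdₗ i (diffScalar M b t c) + (diffVector b t c).1 i) := by
  refine (hX.diffC i).congr rfl ?_
  simp only [diffScalar, diffVector, TensorModes.tensor_trace, map_add, map_sub, map_smul,
    Finset.sum_add_distrib, TensorModes.tensor_symm _ _ i, TensorModes.tensor_div,
    Real.sq_sqrt hA.le, Submodule.coe_add, Submodule.coe_smul, Pi.add_apply, Pi.smul_apply,
    Solenoidal.lap_apply]
  module

theorem linVF_assemble (hA : 0 < b.A t) (hP : b.P t ≠ 0) (hN : b.N t ≠ 0) (hlam : M.lam ≠ 0)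
    (hV : ContDiff ℝ ∞ M.V) (m : Descriptor) (c : Modes) :
    linVF M b t m (assemble b t c.toSVT)
      = { assemble b t (linModes M b t c).toSVT with N := m.n, Nv := m.v } := by
  have hX := hasADMVariation_adm_add hA c
  have hd := hasDescriptorVariation_lapse_shift (b := b) (t := t) c
  refine HasTimeDeriv.derivZero_eq fun x => ⟨fun i j => ?_, fun i j => ?_,
    (hasVariation_secVF_field_linModes hA hX hd).hasDerivAt x,
    (hasVariation_secVF_mom_linModes hA hlam hV hX hd).hasDerivAt x, ?_, fun i => ?_, ?_,
    fun i => ?_⟩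
  · rw [Modes.assemble_q_apply]
    exact (hasTensorVariation_secVF_q_linModes hA hX hd i j).hasDerivAt x
  · rw [Modes.assemble_P_apply]
    exact (hasTensorVariation_secVF_P_linModes hA hP hlam hV hX hd i j).hasDerivAt x
  · exact (hasDerivAt_mul_const (m.n x)).const_add _
  · exact (hasDerivAt_mul_const (m.v x i)).const_add _
  · have hPi : (assemble b t (linModes M b t c).toSVT).Pi x = -hamModes M b t c x :=
      (congrArg (b.N t * ·) (neg_mul _ _)).trans (by field_simp)
    rw [hPi]
    exact ((hasVariation_hamC_hamModes hA hlam hV hX).hasDerivAt x).fun_neg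
  · have hPiv : (assemble b t (linModes M b t c).toSVT).Piv x i
        = -(pdₗ i (diffScalar M b t c) + (diffVector b t c).1 i).1 x := by
      change (pdₗ i (-diffScalar M b t c)).1 x + (-(diffVector b t c).1 i).1 x = _
      rw [map_neg, ← coe_add_apply, ← neg_add, coe_neg_apply]
    rw [hPiv]
    exact ((hasVariation_diffC_diffModes hA hX i).hasDerivAt x).fun_neg

theorem linVF_default_assemble (hA : 0 < b.A t) (hP : b.P t ≠ 0) (hN : b.N t ≠ 0)
    (hlam : M.lam ≠ 0) (hV : ContDiff ℝ ∞ M.V) (c : Modes) :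
    linVF M b t default (assemble b t c.toSVT) = assemble b t (linModes M b t c).toSVT := by
  rw [linVF_assemble hA hP hN hlam hV]
  have hn : (default : Descriptor).n = (assemble b t (linModes M b t c).toSVT).N :=
    funext fun _ => (mul_zero _).symm
  have hv : (default : Descriptor).v = (assemble b t (linModes M b t c).toSVT).Nv :=
    funext₂ fun x i => by
      change 0 = (pdₗ i 0).1 x + (0 : DecaySpace).1 x
      rw [map_zero, coe_zero_apply, add_zero]
  rw [hn, hv]

theorem linHamC_assemble (hA : 0 < b.A t) (hlam : M.lam ≠ 0) (hV : ContDiff ℝ ∞ M.V)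
    (c : Modes) (x : E3) : linHamC M b t (assemble b t c.toSVT) x = hamModes M b t c x :=
  ((hasVariation_hamC_hamModes hA hlam hV (hasADMVariation_adm_add hA c)).hasDerivAt x).deriv

theorem linDiffC_assemble (hA : 0 < b.A t) (c : Modes) (x : E3) (i : Fin 3) :
    linDiffC M b t (assemble b t c.toSVT) x i
      = (pdₗ i (diffScalar M b t c) + (diffVector b t c).1 i) x :=
  ((hasVariation_diffC_diffModes hA (hasADMVariation_adm_add hA c) i).hasDerivAt x).deriv

theorem derivZero_smul (W : ADM) : derivZero (fun r => r • W) = W :=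
  HasTimeDeriv.derivZero_eq fun x =>
    ⟨fun i j => hasDerivAt_mul_const (W.q x i j), fun i j => hasDerivAt_mul_const (W.P x i j),
      hasDerivAt_mul_const (W.field x), hasDerivAt_mul_const (W.mom x),
      hasDerivAt_mul_const (W.N x), fun i => hasDerivAt_mul_const (W.Nv x i),
      hasDerivAt_mul_const (W.Pi x), fun i => hasDerivAt_mul_const (W.Piv x i)⟩

theorem covHess_smul (q : E3 → Mat3) (r : ℝ) (n : E3 → ℝ) (x : E3) :
    covHess q (r • n) x = r • covHess q n x := by
  ext i j
  simp only [covHess, pd_smul, Matrix.of_apply, Matrix.smul_apply, Pi.smul_apply, smul_eq_mul,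
    mul_left_comm _ r, ← Finset.mul_sum, mul_sub]

theorem secVF_smul (M : Model) (r : ℝ) (d : Descriptor) (Y : ADM) :
    secVF M (r • d) Y = r • secVF M d Y := by
  have hn (x : E3) : (r • d).n x = r * d.n x := rfl
  have hv (x : E3) (i : Fin 3) : (r • d).v x i = r * d.v x i := rfl
  have hpd (i : Fin 3) (f : E3 → ℝ) (x : E3) : pd i (fun y => r * f y) x = r * pd i f x :=
    congrFun (pd_smul r f i) x
  refine (ADM.mk.injEq ..).mpr ⟨?_, ?_, ?_, ?_, (smul_zero r).symm, (smul_zero r).symm,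
    (smul_zero r).symm, (smul_zero r).symm⟩
  · funext x
    ext i j
    simp only [secVF, hn, hv, hpd, Matrix.of_apply, Pi.smul_apply, Matrix.smul_apply, smul_eq_mul,
      mul_left_comm _ r, mul_assoc r, ← mul_add, ← Finset.mul_sum, mul_div_assoc]
  · funext x
    ext i j
    have hcov : covHess Y.q (r • d).n x = r • covHess Y.q d.n x := covHess_smul Y.q r d.n x
    simp only [secVF, hn, hv, hcov, hpd, Matrix.of_apply, Pi.smul_apply, Matrix.smul_apply,
      smul_eq_mul, mul_assoc r, mul_smul_comm, smul_mul_assoc, Matrix.trace_smul, mul_add,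
      Finset.mul_sum]
    congr 1
    · ring
    · exact Finset.sum_congr rfl fun c _ => by ring
  · funext x
    simp only [secVF, hn, hv, Pi.smul_apply, smul_eq_mul, mul_assoc r, ← mul_add,
      ← Finset.mul_sum, mul_div_assoc]
  · funext x
    simp only [secVF, hn, hv, hpd, Pi.smul_apply, smul_eq_mul, mul_assoc r, ← mul_add,
      ← mul_sub, ← Finset.mul_sum, mul_div_assoc]

theorem secVF_descriptor (hA : 0 < b.A t) (hP : b.P t ≠ 0) (hlam : M.lam ≠ 0)
    (hV : ContDiff ℝ ∞ M.V) (n u : DecaySpace) (w : Solenoidal) :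
    secVF M (descriptor n u w) (b.adm t) = assemble b t (gaugeModes M b t n u w).toSVT := by
  have hX := hasADMVariation_adm (b := b) hA
  have hd := hasDescriptorVariation_smul_descriptor n u w
  have hzero (i : Fin 3) (x : E3) : 0 = (pdₗ i 0).1 x + (0 : DecaySpace).1 x := by
    rw [map_zero, coe_zero_apply, add_zero]
  rw [← derivZero_smul (secVF M (descriptor n u w) (b.adm t))]
  simp only [← secVF_smul]
  refine HasTimeDeriv.derivZero_eq fun x => ⟨fun i j => ?_, fun i j => ?_,
    (hasVariation_secVF_field_gaugeModes hA hX hd).hasDerivAt x,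
    (hasVariation_secVF_mom_gaugeModes hA hlam hV hX hd).hasDerivAt x, ?_, fun i => ?_, ?_,
    fun i => ?_⟩
  · rw [Modes.assemble_q_apply]
    exact (hasTensorVariation_secVF_q_gaugeModes (M := M) hA hX hd i j).hasDerivAt x
  · rw [Modes.assemble_P_apply]
    exact (hasTensorVariation_secVF_P_gaugeModes hA hP hlam hV hX hd i j).hasDerivAt x
  · exact (hasDerivAt_const 0 0).congr_deriv (mul_zero _).symm
  · exact (hasDerivAt_const 0 0).congr_deriv (hzero i x)
  · exact (hasDerivAt_const 0 0).congr_deriv (mul_zero _).symm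
  · exact (hasDerivAt_const 0 0).congr_deriv (hzero i x)

end LinearizedFlow

theorem hasDescriptorVariation_const (b : Background) (t : ℝ) :
    HasDescriptorVariation (fun _ => ⟨(b.adm t).N, (b.adm t).Nv⟩) (b.N t) 0 0 where
  n := HasVariation.const _
  v _ := HasVariation.const 0

namespace Background.IsSolution

variable {M : Model} {I : Set ℝ} {b : Background} {t : ℝ}

theorem sqrt_A_pos (hb : b.IsSolution M I) (ht : t ∈ I) : 0 < √(b.A t) :=
  Real.sqrt_pos.2 (hb.A_pos t ht)

theorem hasDerivAt_A (hb : b.IsSolution M I) (ht : t ∈ I) :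
    HasDerivAt b.A (-(b.N t * √(b.A t) * b.P t)) t := by
  have hq := (hb.evolution t ht 0).1 0 0
  have hbase := ((hasADMVariation_adm (hb.A_pos t ht)).secVF_q (M := M) (hb.sqrt_A_pos ht)
    (hasDescriptorVariation_const b t) 0 0).base 0
  simpa [Background.adm, kron] using hq.congr_deriv hbase

theorem hasDerivAt_P (hlam : M.lam ≠ 0) (hV : ContDiff ℝ ∞ M.V) (hb : b.IsSolution M I)
    (ht : t ∈ I) :
    HasDerivAt b.P (b.N t * (b.P t ^ 2 / (4 * √(b.A t))
      + M.kappa * √(b.A t) * b.pressure M t / 2)) t := by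
  have hA := hb.A_pos t ht
  have ha := hb.sqrt_A_pos ht
  have hP := (hb.evolution t ht 0).2.1 0 0
  have hbase := ((hasADMVariation_adm hA).secVF_P ha hlam hV
    (hasDescriptorVariation_const b t) 0 0).base 0
  have hderiv := hP.congr_deriv hbase
  simp only [Background.adm, kron_self, Matrix.smul_apply, Matrix.one_apply_eq, smul_eq_mul,
    mul_one] at hderiv
  refine hderiv.congr_deriv ?_
  have hAa : √(b.A t) ^ 2 = b.A t := Real.sq_sqrt hA.le
  rw [Background.pressure]
  generalize √(b.A t) = a at *
  rw [← hAa]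
  field_simp
  ring

theorem hasDerivAt_field (hb : b.IsSolution M I) (ht : t ∈ I) :
    HasDerivAt b.field (b.N t * M.lam * b.mom t / √(b.A t) ^ 3) t :=
  (hb.evolution t ht 0).2.2.1.congr_deriv <|
    ((hasADMVariation_adm (hb.A_pos t ht)).secVF_field (hb.sqrt_A_pos ht)
      (hasDescriptorVariation_const b t)).base 0

theorem hasDerivAt_mom (hlam : M.lam ≠ 0) (hV : ContDiff ℝ ∞ M.V) (hb : b.IsSolution M I)
    (ht : t ∈ I) :
    HasDerivAt b.mom (-(b.N t * √(b.A t) ^ 3 * deriv M.V (b.field t) / (2 * M.lam))) t :=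
  (hb.evolution t ht 0).2.2.2.1.congr_deriv <|
    ((hasADMVariation_adm (hb.A_pos t ht)).secVF_mom (hb.sqrt_A_pos ht) hlam hV
      (hasDescriptorVariation_const b t)).base 0

theorem hasDerivAt_N (hI : IsOpen I) (hb : b.IsSolution M I) (ht : t ∈ I) :
    HasDerivAt b.N (deriv b.N t) t :=
  ((hb.smooth_N.contDiffAt (hI.mem_nhds ht)).differentiableAt (by simp)).hasDerivAt

theorem friedmann (hlam : M.lam ≠ 0) (hV : ContDiff ℝ ∞ M.V) (hb : b.IsSolution M I)
    (ht : t ∈ I) :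
    -(3 / 2) * √(b.A t) * b.P t ^ 2
      + M.kappa * (M.lam * b.mom t ^ 2 / (2 * √(b.A t) ^ 3)
        + √(b.A t) ^ 3 * M.V (b.field t) / (2 * M.lam)) = 0 :=
  (((hasADMVariation_adm (hb.A_pos t ht)).hamC (hb.sqrt_A_pos ht) hlam hV).base 0).symm.trans
    (hb.ham t ht 0)

theorem P_ne (hb : b.IsSolution M I) (ht : t ∈ I) : b.P t ≠ 0 := fun hP =>
  hb.A_deriv_ne t ht <| by rw [(hb.hasDerivAt_A ht).deriv, hP, mul_zero, neg_zero]

theorem hubble_eq (hb : b.IsSolution M I) (ht : t ∈ I) :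
    b.hubble t = -(b.N t * b.P t) / (2 * √(b.A t)) := by
  have ha := hb.sqrt_A_pos ht
  have hAa : √(b.A t) ^ 2 = b.A t := Real.sq_sqrt (hb.A_pos t ht).le
  rw [Background.hubble, (hb.hasDerivAt_A ht).deriv]
  generalize √(b.A t) = a at *
  rw [← hAa]
  field_simp

theorem hasDerivAt_sqrt_A (hb : b.IsSolution M I) (ht : t ∈ I) :
    HasDerivAt (fun s => √(b.A s)) (-(b.N t * b.P t) / 2) t := by
  have ha := hb.sqrt_A_pos ht
  refine ((hb.hasDerivAt_A ht).sqrt (hb.A_pos t ht).ne').congr_deriv ?_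
  field_simp

end Background.IsSolution

theorem Descriptor.isAdmissible_iff {d : Descriptor} :
    d.IsAdmissible ↔ ∃ n u w, descriptor n u w = d := by
  constructor
  · rintro ⟨hn, u, w, hu, hw, hdiv, hv⟩
    refine ⟨⟨d.n, hn⟩, ⟨u, hu⟩,
      ⟨_, (Solenoidal.mem_iff (w := fun a => ⟨fun x => w x a, hw a⟩)).1 hdiv⟩,
      (Descriptor.mk.injEq ..).mpr ⟨rfl, funext₂ fun x a => (hv x a).symm⟩⟩
  · rintro ⟨n, u, w, rfl⟩
    exact ⟨n.2, u, fun x a => w.1 a x, u.2, fun a => (w.1 a).2, Solenoidal.mem_iff.2 w.2,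
      fun x a => rfl⟩

theorem descriptor_add (n n' u u' : DecaySpace) (w w' : Solenoidal) :
    descriptor n u w + descriptor n' u' w' = descriptor (n + n') (u + u') (w + w') := by
  refine (Descriptor.mk.injEq ..).mpr ⟨rfl, funext₂ fun x a => apply_congr (?_ :
    (pdₗ a u + w.1 a) + (pdₗ a u' + w'.1 a) = pdₗ a (u + u') + (w + w').1 a) x⟩
  rw [map_add, Submodule.coe_add, Pi.add_apply, add_add_add_comm]

theorem descriptor_smul (r : ℝ) (n u : DecaySpace) (w : Solenoidal) :
    r • descriptor n u w = descriptor (r • n) (r • u) (r • w) := by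
  refine (Descriptor.mk.injEq ..).mpr ⟨rfl, funext₂ fun x a => apply_congr (?_ :
    r • (pdₗ a u + w.1 a) = pdₗ a (r • u) + (r • w).1 a) x⟩
  rw [map_smul, Submodule.coe_smul, Pi.smul_apply, smul_add]

section Clocks

variable {M : Model} {b : Background} {t : ℝ}

theorem clock_assemble (hA : b.A t ≠ 0) (hP : b.P t ≠ 0) (hN : b.N t ≠ 0) (c : Modes) :
    clock b t (assemble b t c.toSVT)
      = descriptor ((2 * b.P t * √(b.A t)) • (c.q.E + c.p.E)) c.q.E c.q.F := by
  simp only [clock, Modes.svt_assemble hA hP hN]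
  rfl

variable (hA : 0 < b.A t) (hP : b.P t ≠ 0) (hN : b.N t ≠ 0) (hlam : M.lam ≠ 0)
  (hV : ContDiff ℝ ∞ M.V)
include hA hP hN hlam hV

theorem clockMatrix_descriptor (n u : DecaySpace) (w : Solenoidal) :
    clockMatrix M b t (descriptor n u w) = descriptor n u w := by
  rw [clockMatrix, secVF_descriptor hA hP hlam hV, clock_assemble hA.ne' hP hN]
  congr 1
  simp only [gaugeModes]
  match_scalars <;> field_simp
  ring

theorem clockMatrixInv_descriptor (n u : DecaySpace) (w : Solenoidal) :
    clockMatrixInv M b t (descriptor n u w) = descriptor n u w := by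
  obtain ⟨hadm, heq⟩ := Classical.epsilon_spec
    (p := fun β : Descriptor => β.IsAdmissible ∧ clockMatrix M b t β = descriptor n u w)
    ⟨descriptor n u w, Descriptor.isAdmissible_iff.2 ⟨n, u, w, rfl⟩,
      clockMatrix_descriptor hA hP hN hlam hV n u w⟩
  obtain ⟨n', u', w', hβ⟩ := Descriptor.isAdmissible_iff.1 hadm
  rwa [← hβ, clockMatrix_descriptor hA hP hN hlam hV, hβ] at heq

end Clocks

namespace TensorModes

theorem tensor_smul (r : ℝ) (T : TensorModes) (i j : Fin 3) :
    (⟨r • T.psi, r • T.E, r • T.F, r • T.h⟩ : TensorModes).tensor i j = r • T.tensor i j := by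
  simp only [tensor, Submodule.coe_smul, Pi.smul_apply, map_smul]
  module

end TensorModes

/-- The modes at time `s` of the phase space perturbation that has the modes `c` at time `t`. -/
def Modes.rescale (b : Background) (t s : ℝ) (c : Modes) : Modes where
  q := ⟨(b.A t / b.A s) • c.q.psi, (b.A t / b.A s) • c.q.E, (b.A t / b.A s) • c.q.F,
    (b.A t / b.A s) • c.q.h⟩
  p := ⟨(b.P t / b.P s) • c.p.psi, (b.P t / b.P s) • c.p.E, (b.P t / b.P s) • c.p.F,
    (b.P t / b.P s) • c.p.h⟩
  phi := (b.N t / b.N s) • c.phi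
  B := c.B
  S := c.S
  p_phi := (b.N t / b.N s) • c.p_phi
  p_B := c.p_B
  p_S := c.p_S
  dfield := c.dfield
  dmom := c.dmom

theorem Modes.assemble_rescale {b : Background} {s : ℝ} (hA : b.A s ≠ 0) (hP : b.P s ≠ 0)
    (hN : b.N s ≠ 0) (t : ℝ) (c : Modes) :
    assemble b s (c.rescale b t s).toSVT = assemble b t c.toSVT := by
  refine (ADM.mk.injEq ..).mpr ⟨funext fun x => Matrix.ext fun i j => ?_,
    funext fun x => Matrix.ext fun i j => ?_, rfl, rfl, funext fun x => ?_, rfl,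
    funext fun x => ?_, rfl⟩
  · refine (assemble_q_apply b s _ x i j).trans (.trans ?_ (assemble_q_apply b t c x i j).symm)
    rw [rescale, TensorModes.tensor_smul, coe_smul_apply]
    field_simp
  · refine (assemble_P_apply b s _ x i j).trans (.trans ?_ (assemble_P_apply b t c x i j).symm)
    rw [rescale, TensorModes.tensor_smul, coe_smul_apply]
    field_simp
  · change b.N s * (b.N t / b.N s * c.phi x) = b.N t * c.phi x
    field_simp
  · change b.N s * (b.N t / b.N s * c.p_phi x) = b.N t * c.p_phi x
    field_simp

section ClockDot

variable {M : Model} {I : Set ℝ} {b : Background} {t : ℝ}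

theorem clock_assemble_eventuallyEq (hI : IsOpen I) (hb : b.IsSolution M I) (ht : t ∈ I)
    (c : Modes) : (fun s => clock b s (assemble b t c.toSVT)) =ᶠ[𝓝 t] fun s =>
      descriptor ((2 * b.P s * √(b.A s)) • ((b.A t / b.A s) • c.q.E + (b.P t / b.P s) • c.p.E))
        ((b.A t / b.A s) • c.q.E) ((b.A t / b.A s) • c.q.F) := by
  filter_upwards [hI.mem_nhds ht] with s hs
  have hA := (hb.A_pos s hs).ne'
  have hN := (hb.N_pos s hs).ne'
  rw [← Modes.assemble_rescale hA (hb.P_ne hs) hN t c, clock_assemble hA (hb.P_ne hs) hN]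
  rfl

theorem hasDerivAt_clock_n (hlam : M.lam ≠ 0) (hV : ContDiff ℝ ∞ M.V) (hI : IsOpen I)
    (hb : b.IsSolution M I) (ht : t ∈ I) (c : Modes) (x : E3) :
    HasDerivAt (fun s => (clock b s (assemble b t c.toSVT)).n x)
      (((b.N t * (3 / 2 * b.P t ^ 2 + M.kappa * b.A t * b.pressure M t)) • c.q.E
        - (b.N t * b.P t ^ 2) • c.p.E) x) t := by
  have hA := hb.A_pos t ht
  have hP := hb.P_ne ht
  have ha := hb.sqrt_A_pos ht
  have hderiv := ((((hb.hasDerivAt_P hlam hV ht).const_mul 2).fun_mul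
    (hb.hasDerivAt_sqrt_A ht)).fun_mul
      ((((hasDerivAt_const t (b.A t)).fun_div (hb.hasDerivAt_A ht) hA.ne').mul_const
        (c.q.E x)).fun_add
      (((hasDerivAt_const t (b.P t)).fun_div (hb.hasDerivAt_P hlam hV ht) hP).mul_const
        (c.p.E x)))).congr_of_eventuallyEq
    ((clock_assemble_eventuallyEq hI hb ht c).fun_comp fun d => d.n x)
  refine hderiv.congr_deriv ?_
  have hAa : √(b.A t) ^ 2 = b.A t := Real.sq_sqrt hA.le
  simp only [coe_sub_apply, coe_smul_apply]
  generalize √(b.A t) = a at *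
  rw [← hAa]
  field_simp
  ring

theorem hasDerivAt_clock_v (hI : IsOpen I) (hb : b.IsSolution M I) (ht : t ∈ I) (c : Modes)
    (x : E3) (i : Fin 3) :
    HasDerivAt (fun s => (clock b s (assemble b t c.toSVT)).v x i)
      (((b.N t * b.P t / √(b.A t)) • (pdₗ i c.q.E + c.q.F.1 i)) x) t := by
  have hA := hb.A_pos t ht
  have ha := hb.sqrt_A_pos ht
  have hderiv := (((hasDerivAt_const t (b.A t)).fun_div (hb.hasDerivAt_A ht) hA.ne').mul_const
    ((pdₗ i c.q.E + c.q.F.1 i) x)).congr_of_eventuallyEq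
    (((clock_assemble_eventuallyEq hI hb ht c).fun_comp fun d => d.v x i).trans
      (.of_eq (funext fun s => apply_congr (?_ : pdₗ i ((b.A t / b.A s) • c.q.E)
          + ((b.A t / b.A s) • c.q.F).1 i = (b.A t / b.A s) • (pdₗ i c.q.E + c.q.F.1 i)) x)))
  · refine hderiv.congr_deriv ?_
    have hAa : √(b.A t) ^ 2 = b.A t := Real.sq_sqrt hA.le
    rw [coe_smul_apply]
    generalize √(b.A t) = a at *
    rw [← hAa]
    field_simp
    ring
  · rw [map_smul, Submodule.coe_smul, Pi.smul_apply, smul_add]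

theorem clockDot_assemble (hlam : M.lam ≠ 0) (hV : ContDiff ℝ ∞ M.V) (hI : IsOpen I)
    (hb : b.IsSolution M I) (ht : t ∈ I) (c : Modes) :
    clockDot M b t (assemble b t c.toSVT)
      = descriptor ((b.N t * b.P t ^ 2) • (c.q.E + c.p.E) + b.N t • (c.q.curvPot + c.phi))
          ((2 * b.N t * b.P t / √(b.A t)) • (c.q.E + c.p.E) + c.B)
          ((2 * b.N t * b.P t / √(b.A t)) • (c.q.F + c.p.F) + c.S) := by
  have hA := hb.A_pos t ht
  have hP := hb.P_ne ht
  have hN := (hb.N_pos t ht).ne'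
  have ha := hb.sqrt_A_pos ht
  have hAa : √(b.A t) ^ 2 = b.A t := Real.sq_sqrt hA.le
  rw [clockDot, linVF_default_assemble hA hP hN hlam hV, clock_assemble hA.ne' hP hN]
  refine (Descriptor.mk.injEq ..).mpr ⟨funext fun x => ?_, funext₂ fun x i => ?_⟩
  · rw [(hasDerivAt_clock_n hlam hV hI hb ht c x).deriv]
    refine apply_congr (f := _ + (2 * b.P t * √(b.A t))
      • ((linModes M b t c).q.E + (linModes M b t c).p.E)) ?_ x
    simp only [linModes]
    generalize √(b.A t) = a at *
    rw [← hAa]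
    match_scalars <;> field_simp <;> ring
  · rw [(hasDerivAt_clock_v hI hb ht c x i).deriv]
    refine apply_congr (f := _ + (pdₗ i (linModes M b t c).q.E + (linModes M b t c).q.F.1 i)) ?_ x
    simp only [linModes, map_add, map_smul, Submodule.coe_add, Submodule.coe_smul, Pi.add_apply,
      Pi.smul_apply]
    match_scalars <;> field_simp <;> ring

end ClockDot

/-- The observables of the longitudinal clocks as functions of the modes. -/
def obsModes (M : Model) (b : Background) (t : ℝ) (c : Modes) : Modes where
  q :=
    { psi := c.q.curvPot + b.P t ^ 2 • (c.q.E + c.p.E)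
      E := 0
      F := 0
      h := c.q.h }
  p :=
    { psi := c.p.psi + (1 / 2 : ℝ) • lapₗ c.q.E + (2 / 3 : ℝ) • lapₗ c.p.E
        - (b.P t ^ 2 / 4 + M.kappa * b.A t / 2 * b.pressure M t) • (c.q.E + c.p.E)
      E := 0
      F := c.p.F + c.q.F
      h := c.p.h }
  phi := -(c.q.curvPot + b.P t ^ 2 • (c.q.E + c.p.E))
  B := 0
  S := (-(2 * b.N t * b.P t / √(b.A t))) • (c.p.F + c.q.F)
  p_phi := c.p_phi
  p_B := c.p_B
  p_S := c.p_S
  dfield := c.dfield - (2 * b.P t * M.lam * b.mom t / b.A t) • (c.q.E + c.p.E)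
  dmom := c.dmom + (b.A t ^ 2 * b.P t * deriv M.V (b.field t) / M.lam) • (c.q.E + c.p.E)
    - b.mom t • lapₗ c.q.E

/-- The modes of the gauge transformation `{·, C_ν} (B δG)^ν` that moves a perturbation to the
longitudinal gauge. -/
def gaugeFixingModes (M : Model) (b : Background) (t : ℝ) (c : Modes) : Modes :=
  gaugeModes M b t ((-(2 * b.P t * √(b.A t))) • (c.q.E + c.p.E)) (-c.q.E) (-c.q.F)

section Observables

variable {M : Model} {I : Set ℝ} {b : Background} {t : ℝ}

theorem obsModes_q_tensor (hA : 0 < b.A t) (c : Modes) (i j : Fin 3) :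
    c.q.tensor i j + (gaugeFixingModes M b t c).q.tensor i j = (obsModes M b t c).q.tensor i j := by
  simp only [obsModes, gaugeFixingModes, gaugeModes, TensorModes.tensor, TensorModes.curvPot,
    map_neg, map_zero, Submodule.coe_zero, Submodule.coe_neg, Pi.zero_apply, Pi.neg_apply]
  match_scalars <;> field_simp <;> ring

theorem obsModes_p_tensor (hA : 0 < b.A t) (hP : b.P t ≠ 0) (c : Modes) (i j : Fin 3) :
    c.p.tensor i j + (gaugeFixingModes M b t c).p.tensor i j = (obsModes M b t c).p.tensor i j := by
  have ha : 0 < √(b.A t) := Real.sqrt_pos.2 hA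
  have hAa : √(b.A t) ^ 2 = b.A t := Real.sq_sqrt hA.le
  simp only [obsModes, gaugeFixingModes, gaugeModes, TensorModes.tensor, map_add, map_sub,
    map_smul, map_neg, map_zero, Submodule.coe_add, Submodule.coe_zero, Submodule.coe_neg,
    Pi.add_apply, Pi.zero_apply, Pi.neg_apply]
  generalize √(b.A t) = a at *
  rw [← hAa]
  match_scalars <;> field_simp <;> ring

theorem obsModes_dfield (hA : 0 < b.A t) (c : Modes) :
    c.dfield + (gaugeFixingModes M b t c).dfield = (obsModes M b t c).dfield := by
  have ha : 0 < √(b.A t) := Real.sqrt_pos.2 hA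
  have hAa : √(b.A t) ^ 2 = b.A t := Real.sq_sqrt hA.le
  simp only [obsModes, gaugeFixingModes, gaugeModes]
  generalize √(b.A t) = a at *
  rw [← hAa]
  match_scalars <;> field_simp

theorem obsModes_dmom (hA : 0 < b.A t) (c : Modes) :
    c.dmom + (gaugeFixingModes M b t c).dmom = (obsModes M b t c).dmom := by
  have hAa : √(b.A t) ^ 2 = b.A t := Real.sq_sqrt hA.le
  simp only [obsModes, gaugeFixingModes, gaugeModes, map_neg]
  generalize √(b.A t) = a at *
  rw [← hAa]
  match_scalars <;> ring

theorem obsModes_phi (b : Background) (t : ℝ) (c : Modes) :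
    b.N t • c.phi + b.N t • (gaugeFixingModes M b t c).phi
        + (-b.N t) • (c.q.curvPot + b.P t ^ 2 • (c.q.E + c.p.E) + c.phi)
      = b.N t • (obsModes M b t c).phi := by
  simp only [gaugeFixingModes, gaugeModes, obsModes]
  module

theorem obsModes_shift (b : Background) (t : ℝ) (c : Modes) (i : Fin 3) :
    pdₗ i c.B + c.S.1 i + (pdₗ i (gaugeFixingModes M b t c).B + (gaugeFixingModes M b t c).S.1 i)
        + (pdₗ i (-c.B) + ((-(2 * b.N t * b.P t / √(b.A t))) • (c.p.F + c.q.F) - c.S).1 i)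
      = pdₗ i (obsModes M b t c).B + (obsModes M b t c).S.1 i := by
  simp only [gaugeFixingModes, gaugeModes, obsModes, map_neg, map_zero, Submodule.coe_sub,
    Submodule.coe_zero, Pi.sub_apply, Pi.zero_apply]
  module

theorem clockDot_add_clockDot_gaugeFixingModes (hlam : M.lam ≠ 0) (hV : ContDiff ℝ ∞ M.V)
    (hI : IsOpen I) (hb : b.IsSolution M I) (ht : t ∈ I) (c : Modes) :
    (-1 : ℝ) • clockDot M b t (assemble b t c.toSVT)
        + (-1 : ℝ) • clockDot M b t (assemble b t (gaugeFixingModes M b t c).toSVT)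
      = descriptor ((-b.N t) • (c.q.curvPot + b.P t ^ 2 • (c.q.E + c.p.E) + c.phi)) (-c.B)
          ((-(2 * b.N t * b.P t / √(b.A t))) • (c.p.F + c.q.F) - c.S) := by
  have hP := hb.P_ne ht
  have ha := hb.sqrt_A_pos ht
  rw [clockDot_assemble hlam hV hI hb ht, clockDot_assemble hlam hV hI hb ht, descriptor_smul,
    descriptor_smul, descriptor_add]
  simp only [gaugeFixingModes, gaugeModes, TensorModes.curvPot, map_neg]
  congr 1
  · match_scalars <;> field_simp <;> ring
  · match_scalars <;> field_simp <;> ring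
  · module

theorem observable_assemble (hlam : M.lam ≠ 0) (hV : ContDiff ℝ ∞ M.V) (hI : IsOpen I)
    (hb : b.IsSolution M I) (ht : t ∈ I) (c : Modes) :
    observable M b t (assemble b t c.toSVT) = assemble b t (obsModes M b t c).toSVT := by
  have hA := hb.A_pos t ht
  have hP := hb.P_ne ht
  have hN := (hb.N_pos t ht).ne'
  have hY : secVF M (clockMatrixInv M b t ((-1 : ℝ) • clock b t (assemble b t c.toSVT)))
      (b.adm t) = assemble b t (gaugeFixingModes M b t c).toSVT := by
    rw [clock_assemble hA.ne' hP hN, descriptor_smul, clockMatrixInv_descriptor hA hP hN hlam hV,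
      secVF_descriptor hA hP hlam hV, smul_smul, neg_one_mul, neg_one_smul ℝ c.q.E,
      neg_one_smul ℝ c.q.F]
    rfl
  simp only [observable, hY]
  rw [clockDot_add_clockDot_gaugeFixingModes hlam hV hI hb ht,
    clockMatrixInv_descriptor hA hP hN hlam hV]
  refine (ADM.mk.injEq ..).mpr ⟨funext fun x => Matrix.ext fun i j => ?_,
    funext fun x => Matrix.ext fun i j => ?_,
    funext fun x => (add_zero _).trans (apply_congr (obsModes_dfield hA c) x),
    funext fun x => (add_zero _).trans (apply_congr (obsModes_dmom hA c) x),
    funext fun x => ?_, funext₂ fun x i => ?_, funext fun x => ?_, funext₂ fun x i => ?_⟩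
  · refine (add_zero _).trans (.trans ?_ (Modes.assemble_q_apply b t _ x i j).symm)
    rw [← obsModes_q_tensor hA, coe_add_apply, mul_add, ← Modes.assemble_q_apply,
      ← Modes.assemble_q_apply]
    rfl
  · refine (add_zero _).trans (.trans ?_ (Modes.assemble_P_apply b t _ x i j).symm)
    rw [← obsModes_p_tensor hA hP, coe_add_apply, mul_add, ← Modes.assemble_P_apply,
      ← Modes.assemble_P_apply]
    rfl
  · exact apply_congr (obsModes_phi (M := M) b t c) x
  · exact apply_congr (obsModes_shift (M := M) b t c i) x
  · refine apply_congr (?_ : b.N t • c.p_phi + b.N t • 0 + 0 = b.N t • c.p_phi) x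
    rw [smul_zero, add_zero, add_zero]
  · refine apply_congr
      (?_ : pdₗ i c.p_B + c.p_S.1 i + (pdₗ i 0 + 0) + 0 = pdₗ i c.p_B + c.p_S.1 i) x
    rw [map_zero, add_zero, add_zero, add_zero]

end Observables

/-- The curve `f` of decaying functions is jointly smooth near time `t` and has the time
derivative `f'` at `t`. -/
structure HasModeDeriv (f : ℝ → DecaySpace) (f' : DecaySpace) (t : ℝ) : Prop where
  smooth : ∀ x, ContDiffAt ℝ ∞ (fun p : ℝ × E3 => f p.1 p.2) (t, x)
  hasDerivAt : ∀ x, HasDerivAt (fun s => f s x) (f' x) t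

namespace HasModeDeriv

variable {f : ℝ → DecaySpace} {f' : DecaySpace} {t : ℝ}

theorem pdₗ (h : HasModeDeriv f f' t) (i : Fin 3) :
    HasModeDeriv (fun s => pdₗ i (f s)) (pdₗ i f') t where
  smooth x := contDiffAt_fderiv_right (G := fun s => (f s).1) _ (h.smooth x)
  hasDerivAt x := by
    have hderiv : (fun y => deriv (fun s => f s y) t) = f'.1 :=
      funext fun y => (h.hasDerivAt y).deriv
    have hswap := hasDerivAt_fderiv_right (G := fun s => (f s).1)
      (EuclideanSpace.single i (1 : ℝ)) ((h.smooth x).of_le ENat.LEInfty.out)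
    rwa [hderiv] at hswap

theorem lapₗ (h : HasModeDeriv f f' t) (x : E3) :
    HasDerivAt (fun s => lapₗ (f s) x) (lapₗ f' x) t := by
  simp only [lapₗ_eq, coe_sum_apply]
  exact .fun_sum fun i _ => ((h.pdₗ i).pdₗ i).hasDerivAt x

theorem divₗ {v : ℝ → Fin 3 → DecaySpace} {v' : Fin 3 → DecaySpace}
    (h : ∀ i, HasModeDeriv (fun s => v s i) (v' i) t) (x : E3) :
    HasDerivAt (fun s => divₗ (v s) x) (divₗ v' x) t := by
  simp only [divₗ_eq, coe_sum_apply]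
  exact .fun_sum fun i _ => ((h i).pdₗ i).hasDerivAt x

end HasModeDeriv

theorem exists_hasModeDeriv {I : Set ℝ} {t : ℝ} (hI : IsOpen I) (ht : t ∈ I)
    {g : ℝ → E3 → ℝ} (hg : ContDiffOn ℝ ∞ (fun p : ℝ × E3 => g p.1 p.2) (I ×ˢ Set.univ))
    (hdecay : Decays fun x => deriv (fun s => g s x) t) {f : ℝ → DecaySpace}
    (hf : ∀ s ∈ I, (f s).1 = g s) : ∃ f', HasModeDeriv f f' t := by
  have hsmooth (x : E3) : ContDiffAt ℝ ∞ (fun p : ℝ × E3 => g p.1 p.2) (t, x) :=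
    hg.contDiffAt ((hI.prod isOpen_univ).mem_nhds ⟨ht, Set.mem_univ x⟩)
  refine ⟨⟨_, hdecay⟩, fun x => (hsmooth x).congr_of_eventuallyEq ?_, fun x => ?_⟩
  · filter_upwards [(hI.prod isOpen_univ).mem_nhds
      (show (t, x) ∈ I ×ˢ Set.univ from ⟨ht, Set.mem_univ x⟩)] with p hp
    exact congrFun (hf p.1 hp.1) p.2
  · have hg' := (hasDerivAt_left ((hsmooth x).differentiableAt (by simp)))
    refine hg'.differentiableAt.hasDerivAt.congr_of_eventuallyEq ?_
    filter_upwards [hI.mem_nhds ht] with s hs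
    exact congrFun (hf s hs) x

namespace DecaySpace

theorem eq_zero_of_hasDerivAt {g : ℝ → DecaySpace} {g' : DecaySpace} {t : ℝ}
    (hg : ∀ x, HasDerivAt (fun s => g s x) (g' x) t) (h0 : ∀ s, g s = 0) : g' = 0 :=
  ext_apply fun x => (hg x).unique <| by
    simpa only [h0, coe_zero_apply] using hasDerivAt_const t (0 : ℝ)

end DecaySpace

theorem Solenoidal.mem_of_hasModeDeriv {w : ℝ → Solenoidal} {w' : Fin 3 → DecaySpace} {t : ℝ}
    (h : ∀ i, HasModeDeriv (fun s => (w s).1 i) (w' i) t) : w' ∈ Solenoidal :=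
  eq_zero_of_hasDerivAt (HasModeDeriv.divₗ h) fun s => Solenoidal.divₗ_eq_zero (w s)

theorem TTSpace.mem_of_hasModeDeriv {h : ℝ → TTSpace} {h' : Fin 3 → Fin 3 → DecaySpace} {t : ℝ}
    (hh : ∀ i j, HasModeDeriv (fun s => (h s).1 i j) (h' i j) t) : h' ∈ TTSpace := by
  refine ⟨fun i j => sub_eq_zero.1 ?_, ?_, fun j => ?_⟩
  · exact eq_zero_of_hasDerivAt (g := fun s => (h s).1 i j - (h s).1 j i)
      (fun x => ((hh i j).hasDerivAt x).fun_sub ((hh j i).hasDerivAt x))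
      fun s => sub_eq_zero.2 (TTSpace.symm (h s) i j)
  · refine eq_zero_of_hasDerivAt (g := fun s => ∑ i, (h s).1 i i) (t := t) (fun x => ?_)
      fun s => TTSpace.trace_eq_zero (h s)
    simp only [coe_sum_apply]
    exact .fun_sum fun i _ => (hh i i).hasDerivAt x
  · exact eq_zero_of_hasDerivAt (HasModeDeriv.divₗ fun i => hh i j)
      fun s => (h s).2.2.2 j

/-- Componentwise time derivative of a curve of tensor modes. -/
structure HasTensorDeriv (T : ℝ → TensorModes) (T' : TensorModes) (t : ℝ) : Prop where
  psi : HasModeDeriv (fun s => (T s).psi) T'.psi t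
  E : HasModeDeriv (fun s => (T s).E) T'.E t
  F : ∀ i, HasModeDeriv (fun s => (T s).F.1 i) (T'.F.1 i) t
  h : ∀ i j, HasModeDeriv (fun s => (T s).h.1 i j) (T'.h.1 i j) t

theorem exists_hasTensorDeriv {T : ℝ → TensorModes} {t : ℝ}
    (hpsi : ∃ f', HasModeDeriv (fun s => (T s).psi) f' t)
    (hE : ∃ f', HasModeDeriv (fun s => (T s).E) f' t)
    (hF : ∀ i, ∃ f', HasModeDeriv (fun s => (T s).F.1 i) f' t)
    (hh : ∀ i j, ∃ f', HasModeDeriv (fun s => (T s).h.1 i j) f' t) :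
    ∃ T', HasTensorDeriv T T' t := by
  obtain ⟨psi', hpsi'⟩ := hpsi
  obtain ⟨E', hE'⟩ := hE
  choose F' hF' using hF
  choose h' hh' using hh
  exact ⟨⟨psi', E', ⟨F', Solenoidal.mem_of_hasModeDeriv hF'⟩,
    ⟨h', TTSpace.mem_of_hasModeDeriv hh'⟩⟩, hpsi', hE', hF', hh'⟩

namespace HasTensorDeriv

variable {T : ℝ → TensorModes} {T' : TensorModes} {t : ℝ}

theorem hasDerivAt_tensor (hT : HasTensorDeriv T T' t) (i j : Fin 3) (x : E3) :
    HasDerivAt (fun s => (T s).tensor i j x) (T'.tensor i j x) t :=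
  ((((hT.psi.hasDerivAt x).const_mul _).fun_add
    ((((hT.E.pdₗ j).pdₗ i).hasDerivAt x).fun_sub ((hT.E.lapₗ x).const_mul _))).fun_add
    (((((hT.F i).pdₗ j).hasDerivAt x).fun_add (((hT.F j).pdₗ i).hasDerivAt x)).const_mul _)).fun_add
    (((hT.h i j).hasDerivAt x).const_mul _)

theorem of_hasDerivAt_mul_tensor (hT : HasTensorDeriv T T' t) {L : TensorModes} {r : ℝ → ℝ}
    {k : ℝ} (hr : HasDerivAt r (k * r t) t) (hr0 : r t ≠ 0)
    (hL : ∀ i j x, HasDerivAt (fun s => 2 * r s * (T s).tensor i j x)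
      (2 * r t * L.tensor i j x) t) :
    HasTensorDeriv T ⟨L.psi - k • (T t).psi, L.E - k • (T t).E, L.F - k • (T t).F,
      L.h - k • (T t).h⟩ t := by
  suffices h : (⟨L.psi - k • (T t).psi, L.E - k • (T t).E, L.F - k • (T t).F,
      L.h - k • (T t).h⟩ : TensorModes) = T' by rwa [h]
  refine TensorModes.tensor_injective (funext₂ fun i j => ext_apply fun x => ?_)
  have hprod := ((hr.const_mul 2).fun_mul (hT.hasDerivAt_tensor i j x)).unique (hL i j x)
  have hquot : L.tensor i j x - k * (T t).tensor i j x = T'.tensor i j x :=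
    mul_left_cancel₀ (mul_ne_zero two_ne_zero hr0) (by linear_combination -hprod)
  rw [← hquot, ← coe_smul_apply, ← coe_sub_apply]
  refine apply_congr ?_ x
  simp only [TensorModes.tensor, Submodule.coe_sub, Submodule.coe_smul, Pi.sub_apply,
    Pi.smul_apply, map_sub, map_smul]
  module

end HasTensorDeriv

/-- On `I`, the components `X` are given by the modes `c`, and the modes of the metric, of its
momentum and of the matter are differentiable in time. -/
structure IsModeCurve (I : Set ℝ) (X : ℝ → SVT) (c : ℝ → Modes) : Prop where
  toSVT : ∀ t ∈ I, (c t).toSVT = X t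
  q : ∀ t ∈ I, ∃ T', HasTensorDeriv (fun s => (c s).q) T' t
  p : ∀ t ∈ I, ∃ T', HasTensorDeriv (fun s => (c s).p) T' t
  dfield : ∀ t ∈ I, ∃ f', HasModeDeriv (fun s => (c s).dfield) f' t
  dmom : ∀ t ∈ I, ∃ f', HasModeDeriv (fun s => (c s).dmom) f' t

theorem SVT.IsRegularCurve.isAdmissible {I : Set ℝ} {X : ℝ → SVT} (hX : SVT.IsRegularCurve I X)
    {t : ℝ} (ht : t ∈ I) : (X t).IsAdmissible := by
  obtain ⟨htrans, ⟨psi, E, F, h⟩, ⟨p_psi, p_E, p_F, p_h⟩, ⟨phi, B, S⟩, ⟨p_phi, p_B, p_S⟩,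
    dfield, dmom⟩ := hX
  exact ⟨htrans t ht,
    ⟨(psi.2 t ht).1, (E.2 t ht).1, fun a => ((F a).2 t ht).1, fun a b => ((h a b).2 t ht).1⟩,
    ⟨(p_psi.2 t ht).1, (p_E.2 t ht).1, fun a => ((p_F a).2 t ht).1,
      fun a b => ((p_h a b).2 t ht).1⟩,
    ⟨(phi.2 t ht).1, (B.2 t ht).1, fun a => ((S a).2 t ht).1⟩,
    ⟨(p_phi.2 t ht).1, (p_B.2 t ht).1, fun a => ((p_S a).2 t ht).1⟩,
    (dfield.2 t ht).1, (dmom.2 t ht).1⟩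

instance : Nonempty Modes := ⟨⟨0, 0, 0, 0⟩, ⟨0, 0, 0, 0⟩, 0, 0, 0, 0, 0, 0, 0, 0⟩

theorem SVT.IsRegularCurve.exists_isModeCurve {I : Set ℝ} (hI : IsOpen I) {X : ℝ → SVT}
    (hX : SVT.IsRegularCurve I X) : ∃ c, IsModeCurve I X c := by
  have hmodes : ∀ t ∈ I, ∃ c : Modes, c.toSVT = X t := fun t ht =>
    Modes.isAdmissible_iff.1 (hX.isAdmissible ht)
  choose! c hc using hmodes
  have hderiv {comp : SVT → E3 → ℝ}
      (hcomp : ContDiffOn ℝ ∞ (fun p : ℝ × E3 => comp (X p.1) p.2) (I ×ˢ Set.univ) ∧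
        ∀ t ∈ I, Decays (comp (X t)) ∧ Decays fun x => deriv (fun s => comp (X s) x) t)
      (f : Modes → DecaySpace) (hf : ∀ m, (f m).1 = comp m.toSVT) (t : ℝ) (ht : t ∈ I) :
      ∃ f', HasModeDeriv (fun s => f (c s)) f' t :=
    exists_hasModeDeriv hI ht hcomp.1 (hcomp.2 t ht).2 fun s hs =>
      (hf _).trans (congrArg comp (hc s hs))
  obtain ⟨-, ⟨psi, E, F, h⟩, ⟨p_psi, p_E, p_F, p_h⟩, -, -, dfield, dmom⟩ := hX
  exact ⟨c, hc,
    fun t ht => exists_hasTensorDeriv (hderiv psi (·.q.psi) (fun _ => rfl) t ht)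
      (hderiv E (·.q.E) (fun _ => rfl) t ht)
      (fun i => hderiv (comp := fun Y x => Y.F x i) (F i) (·.q.F.1 i) (fun _ => rfl) t ht)
      (fun i j => hderiv (comp := fun Y x => Y.h x i j) (h i j) (·.q.h.1 i j) (fun _ => rfl) t ht),
    fun t ht => exists_hasTensorDeriv (hderiv p_psi (·.p.psi) (fun _ => rfl) t ht)
      (hderiv p_E (·.p.E) (fun _ => rfl) t ht)
      (fun i => hderiv (comp := fun Y x => Y.p_F x i) (p_F i) (·.p.F.1 i) (fun _ => rfl) t ht)
      (fun i j => hderiv (comp := fun Y x => Y.p_h x i j) (p_h i j) (·.p.h.1 i j)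
        (fun _ => rfl) t ht),
    hderiv dfield (·.dfield) fun _ => rfl, hderiv dmom (·.dmom) fun _ => rfl⟩

theorem HasTimeDeriv.congr_of_eventuallyEq {Y Z : ℝ → ADM} {Y' : ADM} {t : ℝ}
    (hY : HasTimeDeriv Y Y' t) (h : Z =ᶠ[𝓝 t] Y) : HasTimeDeriv Z Y' t := fun x =>
  have ⟨q, P, field, mom, N, Nv, Pi, Piv⟩ := hY x
  ⟨fun i j => (q i j).congr_of_eventuallyEq (h.fun_comp (·.q x i j)),
    fun i j => (P i j).congr_of_eventuallyEq (h.fun_comp (·.P x i j)),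
    field.congr_of_eventuallyEq (h.fun_comp (·.field x)),
    mom.congr_of_eventuallyEq (h.fun_comp (·.mom x)),
    N.congr_of_eventuallyEq (h.fun_comp (·.N x)),
    fun i => (Nv i).congr_of_eventuallyEq (h.fun_comp (·.Nv x i)),
    Pi.congr_of_eventuallyEq (h.fun_comp (·.Pi x)),
    fun i => (Piv i).congr_of_eventuallyEq (h.fun_comp (·.Piv x i))⟩

namespace IsLinearSolution

variable {M : Model} {I : Set ℝ} {b : Background} {X : ℝ → SVT} {m : ℝ → Descriptor}
  {c : ℝ → Modes} {t : ℝ}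

theorem hasTimeDeriv_modes (hsol : IsLinearSolution M b I m fun t => assemble b t (X t))
    (hlam : M.lam ≠ 0) (hV : ContDiff ℝ ∞ M.V) (hI : IsOpen I) (hb : b.IsSolution M I)
    (hc : IsModeCurve I X c) (ht : t ∈ I) :
    HasTimeDeriv (fun s => assemble b s (c s).toSVT)
      { assemble b t (linModes M b t (c t)).toSVT with N := (m t).n, Nv := (m t).v } t := by
  rw [← linVF_assemble (hb.A_pos t ht) (hb.P_ne ht) (hb.N_pos t ht).ne' hlam hV, hc.toSVT t ht]
  refine (hsol.evolution t ht).congr_of_eventuallyEq ?_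
  filter_upwards [hI.mem_nhds ht] with s hs
  rw [hc.toSVT s hs]

theorem hasTensorDeriv_q (hsol : IsLinearSolution M b I m fun t => assemble b t (X t))
    (hlam : M.lam ≠ 0) (hV : ContDiff ℝ ∞ M.V) (hI : IsOpen I) (hb : b.IsSolution M I)
    (hc : IsModeCurve I X c) (ht : t ∈ I) :
    letI L := (linModes M b t (c t)).q
    letI k := -(b.N t * b.P t / √(b.A t))
    HasTensorDeriv (fun s => (c s).q) ⟨L.psi - k • (c t).q.psi, L.E - k • (c t).q.E,
      L.F - k • (c t).q.F, L.h - k • (c t).q.h⟩ t := by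
  have ha := hb.sqrt_A_pos ht
  have hAa : √(b.A t) ^ 2 = b.A t := Real.sq_sqrt (hb.A_pos t ht).le
  obtain ⟨T', hT'⟩ := hc.q t ht
  refine hT'.of_hasDerivAt_mul_tensor ((hb.hasDerivAt_A ht).congr_deriv ?_) (hb.A_pos t ht).ne'
    fun i j x => ?_
  · generalize √(b.A t) = a at *
    rw [← hAa]
    field_simp
  · simpa only [Modes.assemble_q_apply] using
      (hsol.hasTimeDeriv_modes hlam hV hI hb hc ht x).1 i j

theorem hasTensorDeriv_p (hsol : IsLinearSolution M b I m fun t => assemble b t (X t))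
    (hlam : M.lam ≠ 0) (hV : ContDiff ℝ ∞ M.V) (hI : IsOpen I) (hb : b.IsSolution M I)
    (hc : IsModeCurve I X c) (ht : t ∈ I) :
    letI L := (linModes M b t (c t)).p
    letI k := b.N t * b.P t / (4 * √(b.A t))
      + M.kappa * b.N t * √(b.A t) * b.pressure M t / (2 * b.P t)
    HasTensorDeriv (fun s => (c s).p) ⟨L.psi - k • (c t).p.psi, L.E - k • (c t).p.E,
      L.F - k • (c t).p.F, L.h - k • (c t).p.h⟩ t := by
  have ha := hb.sqrt_A_pos ht
  have hP := hb.P_ne ht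
  obtain ⟨T', hT'⟩ := hc.p t ht
  refine hT'.of_hasDerivAt_mul_tensor ((hb.hasDerivAt_P hlam hV ht).congr_deriv ?_) hP
    fun i j x => ?_
  · field_simp
  · simpa only [Modes.assemble_P_apply] using
      (hsol.hasTimeDeriv_modes hlam hV hI hb hc ht x).2.1 i j

theorem hasDerivAt_dfield (hsol : IsLinearSolution M b I m fun t => assemble b t (X t))
    (hlam : M.lam ≠ 0) (hV : ContDiff ℝ ∞ M.V) (hI : IsOpen I) (hb : b.IsSolution M I)
    (hc : IsModeCurve I X c) (ht : t ∈ I) (x : E3) :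
    HasDerivAt (fun s => (c s).dfield x) ((linModes M b t (c t)).dfield x) t :=
  (hsol.hasTimeDeriv_modes hlam hV hI hb hc ht x).2.2.1

theorem hasDerivAt_dmom (hsol : IsLinearSolution M b I m fun t => assemble b t (X t))
    (hlam : M.lam ≠ 0) (hV : ContDiff ℝ ∞ M.V) (hI : IsOpen I) (hb : b.IsSolution M I)
    (hc : IsModeCurve I X c) (ht : t ∈ I) (x : E3) :
    HasDerivAt (fun s => (c s).dmom x) ((linModes M b t (c t)).dmom x) t :=
  (hsol.hasTimeDeriv_modes hlam hV hI hb hc ht x).2.2.2.1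

theorem hamModes_eq_zero (hsol : IsLinearSolution M b I m fun t => assemble b t (X t))
    (hlam : M.lam ≠ 0) (hV : ContDiff ℝ ∞ M.V) (hb : b.IsSolution M I)
    (hc : IsModeCurve I X c) (ht : t ∈ I) : hamModes M b t (c t) = 0 :=
  ext_apply fun x => by
    rw [← linHamC_assemble (hb.A_pos t ht) hlam hV, hc.toSVT t ht]
    exact hsol.ham t ht x

theorem diffScalar_eq_zero (hsol : IsLinearSolution M b I m fun t => assemble b t (X t))
    (hb : b.IsSolution M I) (hc : IsModeCurve I X c) (ht : t ∈ I) :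
    diffScalar M b t (c t) = 0 := by
  refine (Solenoidal.grad_add_injective (w := diffVector b t (c t)) (w' := 0) fun i =>
    ext_apply fun x => ?_).1
  rw [← linDiffC_assemble (hb.A_pos t ht), hc.toSVT t ht, map_zero, Submodule.coe_zero,
    Pi.zero_apply, add_zero]
  exact hsol.diff t ht x i

theorem p_phi_eq_zero (hsol : IsLinearSolution M b I m fun t => assemble b t (X t))
    (hb : b.IsSolution M I) (hc : IsModeCurve I X c) (ht : t ∈ I) : (c t).p_phi = 0 :=
  ext_apply fun x => by
    have hPi := hsol.prim t ht x
    rw [← hc.toSVT t ht] at hPi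
    exact (mul_eq_zero.1 hPi).resolve_left (hb.N_pos t ht).ne'

theorem p_B_eq_zero_and_p_S_eq_zero
    (hsol : IsLinearSolution M b I m fun t => assemble b t (X t))
    (hc : IsModeCurve I X c) (ht : t ∈ I) : (c t).p_B = 0 ∧ (c t).p_S = 0 := by
  refine Solenoidal.grad_add_injective fun i => ext_apply fun x => ?_
  have hPiv := hsol.primv t ht x i
  rw [← hc.toSVT t ht] at hPiv
  rw [map_zero, Submodule.coe_zero, Pi.zero_apply, add_zero]
  exact hPiv

end IsLinearSolution

namespace Background.IsSolution

variable {M : Model} {I : Set ℝ} {b : Background} {t : ℝ}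

theorem hasDerivAt_V (hV : ContDiff ℝ ∞ M.V) (hb : b.IsSolution M I) (ht : t ∈ I) :
    HasDerivAt (fun s => M.V (b.field s))
      (deriv M.V (b.field t) * (b.N t * M.lam * b.mom t / √(b.A t) ^ 3)) t :=
  (hV.differentiable (by simp) (b.field t)).hasDerivAt.comp t (hb.hasDerivAt_field ht)

theorem hasDerivAt_deriv_V (hV : ContDiff ℝ ∞ M.V) (hb : b.IsSolution M I) (ht : t ∈ I) :
    HasDerivAt (fun s => deriv M.V (b.field s))
      (deriv (deriv M.V) (b.field t) * (b.N t * M.lam * b.mom t / √(b.A t) ^ 3)) t :=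
  ((contDiff_infty_iff_deriv.1 hV).2.differentiable (by simp) (b.field t)).hasDerivAt.comp t
    (hb.hasDerivAt_field ht)

theorem hasDerivAt_pressure (hlam : M.lam ≠ 0) (hV : ContDiff ℝ ∞ M.V) (hb : b.IsSolution M I)
    (ht : t ∈ I) :
    HasDerivAt (b.pressure M)
      (-(b.N t * b.mom t * deriv M.V (b.field t)) / √(b.A t) ^ 3
        + 3 / 2 * M.lam * b.N t * b.P t * b.mom t ^ 2 / √(b.A t) ^ 7) t := by
  have hA := hb.A_pos t ht
  have ha := hb.sqrt_A_pos ht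
  have hAa : √(b.A t) ^ 2 = b.A t := Real.sq_sqrt hA.le
  have h := ((((hasDerivAt_const t M.lam).fun_div ((hb.hasDerivAt_A ht).fun_pow 3)
    (pow_ne_zero 3 hA.ne')).fun_mul ((hb.hasDerivAt_mom hlam hV ht).fun_pow 2)).fun_sub
    ((hb.hasDerivAt_V hV ht).const_mul (1 / M.lam))).const_mul (1 / 2)
  refine h.congr_deriv ?_
  generalize √(b.A t) = a at *
  rw [← hAa]
  field_simp
  ring

theorem hasDerivAt_hubble (hlam : M.lam ≠ 0) (hV : ContDiff ℝ ∞ M.V) (hI : IsOpen I)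
    (hb : b.IsSolution M I) (ht : t ∈ I) :
    HasDerivAt b.hubble (-(deriv b.N t * b.P t) / (2 * √(b.A t))
      - 3 / 8 * b.N t ^ 2 * b.P t ^ 2 / √(b.A t) ^ 2
      - M.kappa * b.N t ^ 2 * b.pressure M t / 4) t := by
  have ha := hb.sqrt_A_pos ht
  have h := ((((hb.hasDerivAt_N hI ht).fun_mul (hb.hasDerivAt_P hlam hV ht)).fun_neg).fun_div
    ((hb.hasDerivAt_sqrt_A ht).const_mul 2) (by positivity))
  refine (h.congr_of_eventuallyEq ?_).congr_deriv ?_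
  · filter_upwards [hI.mem_nhds ht] with s hs using hb.hubble_eq hs
  · field_simp
    ring

theorem mom_ne (hb : b.IsSolution M I) (ht : t ∈ I) (hfield : deriv b.field t ≠ 0) :
    b.mom t ≠ 0 := fun hmom =>
  hfield <| by rw [(hb.hasDerivAt_field ht).deriv, hmom, mul_zero, zero_div]

theorem deriv_N_of_conformal (hI : IsOpen I) (hb : b.IsSolution M I)
    (hconf : ∀ t ∈ I, b.N t = √(b.A t)) (ht : t ∈ I) :
    deriv b.N t = -(b.N t * b.P t) / 2 :=
  ((hb.hasDerivAt_sqrt_A ht).congr_of_eventuallyEq <| by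
    filter_upwards [hI.mem_nhds ht] with s hs using hconf s hs).deriv

theorem deriv_deriv_field_of_conformal (hlam : M.lam ≠ 0) (hV : ContDiff ℝ ∞ M.V)
    (hI : IsOpen I) (hb : b.IsSolution M I) (hconf : ∀ t ∈ I, b.N t = √(b.A t)) (ht : t ∈ I) :
    deriv (deriv b.field) t = M.lam * b.mom t * b.P t / √(b.A t) ^ 2
      - √(b.A t) ^ 2 * deriv M.V (b.field t) / 2 := by
  have ha := hb.sqrt_A_pos ht
  have h := (((hb.hasDerivAt_N hI ht).mul_const M.lam).fun_mul
    (hb.hasDerivAt_mom hlam hV ht)).fun_div ((hb.hasDerivAt_sqrt_A ht).fun_pow 3) (by positivity)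
  refine ((h.congr_of_eventuallyEq ?_).deriv).trans ?_
  · filter_upwards [hI.mem_nhds ht] with s hs using (hb.hasDerivAt_field hs).deriv
  · rw [hb.deriv_N_of_conformal hI hconf ht, hconf t ht]
    field_simp
    ring

end Background.IsSolution

/-! ### Evolution of the observables -/

namespace IsLinearSolution

variable {M : Model} {I : Set ℝ} {b : Background} {X : ℝ → SVT} {m : ℝ → Descriptor}
  {c : ℝ → Modes} {t : ℝ}

theorem hasDerivAt_obsModes_psi (hsol : IsLinearSolution M b I m fun t => assemble b t (X t))
    (hlam : M.lam ≠ 0) (hV : ContDiff ℝ ∞ M.V) (hI : IsOpen I) (hb : b.IsSolution M I)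
    (hc : IsModeCurve I X c) (ht : t ∈ I) (x : E3) :
    HasDerivAt (fun s => (obsModes M b s (c s)).q.psi x)
      (2 * b.hubble t * ((obsModes M b t (c t)).p.psi x - (obsModes M b t (c t)).q.psi x)) t := by
  have hA := hb.A_pos t ht
  have ha := hb.sqrt_A_pos ht
  have hP := hb.P_ne ht
  have hAa : √(b.A t) ^ 2 = b.A t := Real.sq_sqrt hA.le
  have hq := hsol.hasTensorDeriv_q hlam hV hI hb hc ht
  have hp := hsol.hasTensorDeriv_p hlam hV hI hb hc ht
  have h := ((hq.psi.hasDerivAt x).fun_sub ((hq.E.lapₗ x).const_mul (1 / 3))).fun_add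
    (((hb.hasDerivAt_P hlam hV ht).fun_pow 2).fun_mul
      ((hq.E.hasDerivAt x).fun_add (hp.E.hasDerivAt x)))
  refine h.congr_deriv ?_
  rw [hb.hubble_eq ht]
  simp only [obsModes, linModes, TensorModes.curvPot, map_add, map_sub, map_smul,
    coe_add_apply, coe_sub_apply, coe_smul_apply]
  generalize √(b.A t) = a at *
  rw [← hAa]
  field_simp
  ring

theorem hasDerivAt_obsModes_p_psi (hsol : IsLinearSolution M b I m fun t => assemble b t (X t))
    (hlam : M.lam ≠ 0) (hV : ContDiff ℝ ∞ M.V) (hI : IsOpen I) (hb : b.IsSolution M I)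
    (hc : IsModeCurve I X c) (ht : t ∈ I) (x : E3) :
    HasDerivAt (fun s => (obsModes M b s (c s)).p.psi x)
      ((- b.hubble t / 2 + M.kappa / 4 * (b.N t ^ 2 * b.pressure M t / b.hubble t))
          * (obsModes M b t (c t)).p.psi x
        + b.hubble t / 2 * (obsModes M b t (c t)).q.psi x
        - M.kappa / 8 * (b.N t ^ 2 / b.hubble t)
          * deltaT M b t (obsModes M b t (c t)).toSVT x) t := by
  have hA := hb.A_pos t ht
  have ha := hb.sqrt_A_pos ht
  have hP := hb.P_ne ht
  have hAa : √(b.A t) ^ 2 = b.A t := Real.sq_sqrt hA.le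
  have hq := hsol.hasTensorDeriv_q hlam hV hI hb hc ht
  have hp := hsol.hasTensorDeriv_p hlam hV hI hb hc ht
  have hcoeff := (((hb.hasDerivAt_P hlam hV ht).fun_pow 2).div_const 4).fun_add
    ((((hb.hasDerivAt_A ht).const_mul M.kappa).div_const 2).fun_mul
      (hb.hasDerivAt_pressure hlam hV ht))
  have h := (((hp.psi.hasDerivAt x).fun_add ((hq.E.lapₗ x).const_mul (1 / 2))).fun_add
    ((hp.E.lapₗ x).const_mul (2 / 3))).fun_sub
    (hcoeff.fun_mul ((hq.E.hasDerivAt x).fun_add (hp.E.hasDerivAt x)))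
  refine h.congr_deriv ?_
  rw [hb.hubble_eq ht]
  simp only [obsModes, Modes.toSVT, deltaT, linModes, TensorModes.curvPot, map_add, map_sub,
    map_smul, coe_add_apply, coe_sub_apply, coe_smul_apply, Background.pressure]
  generalize √(b.A t) = a at *
  rw [← hAa]
  field_simp
  ring

theorem hasDerivAt_obsModes_p_F (hsol : IsLinearSolution M b I m fun t => assemble b t (X t))
    (hlam : M.lam ≠ 0) (hV : ContDiff ℝ ∞ M.V) (hI : IsOpen I) (hb : b.IsSolution M I)
    (hc : IsModeCurve I X c) (ht : t ∈ I) (x : E3) (i : Fin 3) :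
    HasDerivAt (fun s => (obsModes M b s (c s)).p.F.1 i x)
      ((digamma M b t - 4 * b.hubble t) * (obsModes M b t (c t)).p.F.1 i x) t := by
  have ha := hb.sqrt_A_pos ht
  have hP := hb.P_ne ht
  have h := (((hsol.hasTensorDeriv_p hlam hV hI hb hc ht).F i).hasDerivAt x).fun_add
    (((hsol.hasTensorDeriv_q hlam hV hI hb hc ht).F i).hasDerivAt x)
  refine h.congr_deriv ?_
  rw [digamma, hb.hubble_eq ht]
  simp only [obsModes, linModes, Submodule.coe_add, Submodule.coe_sub, Submodule.coe_smul,
    Pi.add_apply, Pi.sub_apply, Pi.smul_apply, coe_add_apply, coe_sub_apply, coe_smul_apply]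
  field_simp
  ring

theorem hasDerivAt_obsModes_dfield (hsol : IsLinearSolution M b I m fun t => assemble b t (X t))
    (hlam : M.lam ≠ 0) (hV : ContDiff ℝ ∞ M.V) (hI : IsOpen I) (hb : b.IsSolution M I)
    (hc : IsModeCurve I X c) (ht : t ∈ I) (x : E3) :
    HasDerivAt (fun s => (obsModes M b s (c s)).dfield x)
      (b.N t * (M.lam / √(b.A t) ^ 3)
        * (-4 * b.mom t * (obsModes M b t (c t)).q.psi x + (obsModes M b t (c t)).dmom x)) t := by
  have hA := hb.A_pos t ht
  have ha := hb.sqrt_A_pos ht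
  have hP := hb.P_ne ht
  have hAa : √(b.A t) ^ 2 = b.A t := Real.sq_sqrt hA.le
  have hcoeff := ((((hb.hasDerivAt_P hlam hV ht).const_mul 2).mul_const M.lam).fun_mul
    (hb.hasDerivAt_mom hlam hV ht)).fun_div (hb.hasDerivAt_A ht) hA.ne'
  have h := (hsol.hasDerivAt_dfield hlam hV hI hb hc ht x).fun_sub
    (hcoeff.fun_mul (((hsol.hasTensorDeriv_q hlam hV hI hb hc ht).E.hasDerivAt x).fun_add
      ((hsol.hasTensorDeriv_p hlam hV hI hb hc ht).E.hasDerivAt x)))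
  refine h.congr_deriv ?_
  simp only [obsModes, linModes, TensorModes.curvPot, map_add, map_sub, map_smul,
    coe_add_apply, coe_sub_apply, coe_smul_apply]
  generalize √(b.A t) = a at *
  rw [← hAa]
  field_simp
  ring

theorem hasDerivAt_obsModes_dmom (hsol : IsLinearSolution M b I m fun t => assemble b t (X t))
    (hlam : M.lam ≠ 0) (hV : ContDiff ℝ ∞ M.V) (hI : IsOpen I) (hb : b.IsSolution M I)
    (hc : IsModeCurve I X c) (ht : t ∈ I) (x : E3) :
    HasDerivAt (fun s => (obsModes M b s (c s)).dmom x)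
      (- (b.N t * (√(b.A t) ^ 3 / M.lam))
        * (deriv M.V (b.field t) * (obsModes M b t (c t)).q.psi x
          - 1 / b.A t * lapₗ (obsModes M b t (c t)).dfield x
          + (1 / 2) * deriv (deriv M.V) (b.field t) * (obsModes M b t (c t)).dfield x)) t := by
  have hA := hb.A_pos t ht
  have ha := hb.sqrt_A_pos ht
  have hP := hb.P_ne ht
  have hAa : √(b.A t) ^ 2 = b.A t := Real.sq_sqrt hA.le
  have hq := hsol.hasTensorDeriv_q hlam hV hI hb hc ht
  have hp := hsol.hasTensorDeriv_p hlam hV hI hb hc ht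
  have hcoeff := ((((hb.hasDerivAt_A ht).fun_pow 2).fun_mul
    (hb.hasDerivAt_P hlam hV ht)).fun_mul (hb.hasDerivAt_deriv_V hV ht)).div_const M.lam
  have h := ((hsol.hasDerivAt_dmom hlam hV hI hb hc ht x).fun_add
    (hcoeff.fun_mul ((hq.E.hasDerivAt x).fun_add (hp.E.hasDerivAt x)))).fun_sub
    ((hb.hasDerivAt_mom hlam hV ht).fun_mul (hq.E.lapₗ x))
  refine h.congr_deriv ?_
  simp only [obsModes, linModes, TensorModes.curvPot, map_add, map_sub, map_smul,
    coe_add_apply, coe_sub_apply, coe_smul_apply]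
  generalize √(b.A t) = a at *
  rw [← hAa]
  field_simp
  ring

theorem diffScalar_obsModes (hsol : IsLinearSolution M b I m fun t => assemble b t (X t))
    (hlam : M.lam ≠ 0) (hV : ContDiff ℝ ∞ M.V) (hb : b.IsSolution M I) (hc : IsModeCurve I X c)
    (ht : t ∈ I) : diffScalar M b t (obsModes M b t (c t)) = 0 := by
  have ha := hb.sqrt_A_pos ht
  have hAa : √(b.A t) ^ 2 = b.A t := Real.sq_sqrt (hb.A_pos t ht).le
  refine ext_apply fun x => ?_
  have h0 := apply_congr (hsol.diffScalar_eq_zero hb hc ht) x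
  have hF := hb.friedmann hlam hV ht
  simp only [diffScalar, obsModes, TensorModes.curvPot, map_add, map_zero,
    coe_add_apply, coe_sub_apply, coe_smul_apply, coe_zero_apply, Background.pressure] at h0 ⊢
  generalize √(b.A t) = a at *
  rw [← hAa] at h0 ⊢
  linear_combination (norm := skip) h0 - 2 * a * b.P t * ((c t).q.E x + (c t).p.E x) * hF
  field_simp
  ring

theorem hamModes_obsModes (hsol : IsLinearSolution M b I m fun t => assemble b t (X t))
    (hlam : M.lam ≠ 0) (hV : ContDiff ℝ ∞ M.V) (hb : b.IsSolution M I) (hc : IsModeCurve I X c)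
    (ht : t ∈ I) : hamModes M b t (obsModes M b t (c t)) = 0 := by
  have ha := hb.sqrt_A_pos ht
  have hAa : √(b.A t) ^ 2 = b.A t := Real.sq_sqrt (hb.A_pos t ht).le
  refine ext_apply fun x => ?_
  have h0 := apply_congr (hsol.hamModes_eq_zero hlam hV hb hc ht) x
  have hF := hb.friedmann hlam hV ht
  simp only [hamModes, obsModes, TensorModes.curvPot, map_add, map_sub, map_smul, map_zero,
    coe_add_apply, coe_sub_apply, coe_smul_apply, coe_zero_apply, Background.pressure] at h0 ⊢
  generalize √(b.A t) = a at *
  rw [← hAa]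
  linear_combination (norm := skip) h0 - lapₗ (c t).q.E x * hF
  field_simp
  ring

end IsLinearSolution

section GaugeInvariants

variable {M : Model} {I : Set ℝ} {b : Background} {X : ℝ → SVT} {c : ℝ → Modes} {t : ℝ}

theorem IsModeCurve.obs_eq (hc : IsModeCurve I X c) (hlam : M.lam ≠ 0) (hV : ContDiff ℝ ∞ M.V)
    (hI : IsOpen I) (hb : b.IsSolution M I) (ht : t ∈ I) :
    obs M b X t = (obsModes M b t (c t)).toSVT := by
  rw [obs, ← hc.toSVT t ht, observable_assemble hlam hV hI hb ht,
    Modes.svt_assemble (hb.A_pos t ht).ne' (hb.P_ne ht) (hb.N_pos t ht).ne']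

theorem IsModeCurve.bardeen_eq (hc : IsModeCurve I X c) (hb : b.IsSolution M I) (ht : t ∈ I) :
    bardeen b X t = (obsModes M b t (c t)).q.psi.1 := by
  have ha := hb.sqrt_A_pos ht
  have hN := (hb.N_pos t ht).ne'
  have hAa : √(b.A t) ^ 2 = b.A t := Real.sq_sqrt (hb.A_pos t ht).le
  funext x
  rw [bardeen, ← hc.toSVT t ht, hb.hubble_eq ht]
  simp only [Modes.toSVT, lap_coe, obsModes, TensorModes.curvPot, coe_add_apply, coe_sub_apply,
    coe_smul_apply]
  generalize √(b.A t) = a at *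
  rw [← hAa]
  field_simp
  ring

theorem IsModeCurve.upsilon_eq (hc : IsModeCurve I X c) (hb : b.IsSolution M I) (ht : t ∈ I)
    (x : E3) : upsilon M b X t x = (obsModes M b t (c t)).p.psi x := by
  have ha := hb.sqrt_A_pos ht
  have hN := (hb.N_pos t ht).ne'
  have hAa : √(b.A t) ^ 2 = b.A t := Real.sq_sqrt (hb.A_pos t ht).le
  rw [upsilon, ← hc.toSVT t ht, hb.hubble_eq ht]
  simp only [Modes.toSVT, lap_coe, obsModes, coe_add_apply, coe_sub_apply, coe_smul_apply]
  generalize √(b.A t) = a at *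
  rw [← hAa]
  field_simp
  ring

theorem IsModeCurve.nu_eq (hc : IsModeCurve I X c) (M : Model) (b : Background) (ht : t ∈ I)
    (x : E3) (i : Fin 3) : nu X t x i = (obsModes M b t (c t)).p.F.1 i x := by
  rw [nu, ← hc.toSVT t ht]
  rfl

theorem IsModeCurve.hasDerivAt_obs (hc : IsModeCurve I X c) (hlam : M.lam ≠ 0)
    (hV : ContDiff ℝ ∞ M.V) (hI : IsOpen I) (hb : b.IsSolution M I) (ht : t ∈ I)
    (comp : SVT → ℝ) {r : ℝ}
    (h : HasDerivAt (fun s => comp (obsModes M b s (c s)).toSVT) r t) :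
    HasDerivAt (fun s => comp (obs M b X s)) r t :=
  h.congr_of_eventuallyEq <| by
    filter_upwards [hI.mem_nhds ht] with s hs
    rw [hc.obs_eq hlam hV hI hb hs]

theorem IsModeCurve.hasDerivAt_obs_of_eq_zero (hc : IsModeCurve I X c) (hlam : M.lam ≠ 0)
    (hV : ContDiff ℝ ∞ M.V) (hI : IsOpen I) (hb : b.IsSolution M I) (ht : t ∈ I)
    (comp : SVT → ℝ) (h : ∀ s ∈ I, comp (obsModes M b s (c s)).toSVT = 0) :
    HasDerivAt (fun s => comp (obs M b X s)) 0 t :=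
  hc.hasDerivAt_obs hlam hV hI hb ht comp <|
    (hasDerivAt_const t (0 : ℝ)).congr_of_eventuallyEq <|
      Filter.mem_of_superset (hI.mem_nhds ht) h

theorem obsModes_S (hb : b.IsSolution M I) (ht : t ∈ I) (d : Modes) (x : E3) (i : Fin 3) :
    (obsModes M b t d).S.1 i x = 4 * b.hubble t * (obsModes M b t d).p.F.1 i x := by
  have ha := hb.sqrt_A_pos ht
  rw [hb.hubble_eq ht]
  simp only [obsModes, Submodule.coe_smul, Pi.smul_apply, coe_smul_apply]
  field_simp
  ring

theorem longitudinalObservables (hlam : M.lam ≠ 0) (hV : ContDiff ℝ ∞ M.V) (hI : IsOpen I)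
    (hb : b.IsSolution M I) (hc : IsModeCurve I X c) (ht : t ∈ I) :
    LongitudinalObservables M b X t := by
  have hobs := hc.obs_eq hlam hV hI hb ht
  have hpsi := hc.bardeen_eq hb ht
  have hnu := hc.nu_eq M b ht
  have hX := hc.toSVT t ht
  exact
    { psi x := by rw [hobs, hpsi]; rfl
      E x := by rw [hobs]; rfl
      F x a := by rw [hobs]; rfl
      p_psi x := by rw [hobs, hc.upsilon_eq hb ht]; rfl
      p_E x := by rw [hobs]; rfl
      p_F x a := by rw [hobs, hnu]; rfl
      phi x := by rw [hobs, hpsi]; rfl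
      B x := by rw [hobs]; rfl
      S x a := by rw [hobs, hnu]; exact obsModes_S hb ht _ x a
      p_phi x := by rw [hobs, ← hX]; rfl
      p_B x := by rw [hobs, ← hX]; rfl
      p_S x a := by rw [hobs, ← hX]; rfl }

end GaugeInvariants

namespace IsLinearSolution

variable {M : Model} {I : Set ℝ} {b : Background} {X : ℝ → SVT} {m : ℝ → Descriptor}
  {c : ℝ → Modes} {t : ℝ}

theorem hasDerivAt_obsModes_phi (hsol : IsLinearSolution M b I m fun t => assemble b t (X t))
    (hlam : M.lam ≠ 0) (hV : ContDiff ℝ ∞ M.V) (hI : IsOpen I) (hb : b.IsSolution M I)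
    (hc : IsModeCurve I X c) (ht : t ∈ I) (x : E3) :
    HasDerivAt (fun s => (obsModes M b s (c s)).phi x)
      (2 * b.hubble t * ((obsModes M b t (c t)).q.psi x - (obsModes M b t (c t)).p.psi x)) t :=
  (hsol.hasDerivAt_obsModes_psi hlam hV hI hb hc ht x).fun_neg.congr_deriv (by ring)

theorem hasDerivAt_obsModes_S (hsol : IsLinearSolution M b I m fun t => assemble b t (X t))
    (hlam : M.lam ≠ 0) (hV : ContDiff ℝ ∞ M.V) (hI : IsOpen I) (hb : b.IsSolution M I)
    (hc : IsModeCurve I X c) (ht : t ∈ I) (x : E3) (i : Fin 3) :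
    HasDerivAt (fun s => (obsModes M b s (c s)).S.1 i x)
      ((4 * deriv b.hubble t - 16 * b.hubble t ^ 2 + 4 * digamma M b t * b.hubble t)
        * (obsModes M b t (c t)).p.F.1 i x) t := by
  have hH := (hb.hasDerivAt_hubble hlam hV hI ht).differentiableAt.hasDerivAt
  have h := (hH.const_mul 4).fun_mul (hsol.hasDerivAt_obsModes_p_F hlam hV hI hb hc ht x i)
  refine (h.congr_of_eventuallyEq ?_).congr_deriv (by ring)
  filter_upwards [hI.mem_nhds ht] with s hs using obsModes_S hb hs _ x i

theorem longitudinalHamilton (hsol : IsLinearSolution M b I m fun t => assemble b t (X t))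
    (hlam : M.lam ≠ 0) (hV : ContDiff ℝ ∞ M.V) (hI : IsOpen I) (hb : b.IsSolution M I)
    (hc : IsModeCurve I X c) (ht : t ∈ I) : LongitudinalHamilton M b X t := by
  have hobs := hc.obs_eq hlam hV hI hb ht
  have hpsi := hc.bardeen_eq hb ht
  have hups := hc.upsilon_eq hb ht
  have hnu := hc.nu_eq M b ht
  have hprim (s) (hs : s ∈ I) := hsol.p_B_eq_zero_and_p_S_eq_zero hc hs
  have hobsDeriv {r : ℝ} := hc.hasDerivAt_obs hlam hV hI hb ht (r := r)
  have hconst := hc.hasDerivAt_obs_of_eq_zero hlam hV hI hb ht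
  exact
    { psi x := by
        rw [hpsi, hups]
        exact hobsDeriv (·.psi x) (hsol.hasDerivAt_obsModes_psi hlam hV hI hb hc ht x)
      E x := hconst (·.E x) fun _ _ => rfl
      p_psi x := by
        rw [hpsi, hups, hobs]
        exact hobsDeriv (·.p_psi x) (hsol.hasDerivAt_obsModes_p_psi hlam hV hI hb hc ht x)
      p_E x := hconst (·.p_E x) fun _ _ => rfl
      F x i := hconst (·.F x i) fun _ _ => rfl
      p_F x i := by
        rw [hnu]
        exact hobsDeriv (·.p_F x i) (hsol.hasDerivAt_obsModes_p_F hlam hV hI hb hc ht x i)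
      phi x := by
        rw [hpsi, hups]
        exact hobsDeriv (·.phi x) (hsol.hasDerivAt_obsModes_phi hlam hV hI hb hc ht x)
      B x := hconst (·.B x) fun _ _ => rfl
      S x i := by
        rw [hnu]
        exact hobsDeriv (·.S x i) (hsol.hasDerivAt_obsModes_S hlam hV hI hb hc ht x i)
      p_phi x := hconst (·.p_phi x) fun s hs => apply_congr (hsol.p_phi_eq_zero hb hc hs) x
      p_B x := hconst (·.p_B x) fun s hs => apply_congr (hprim s hs).1 x
      p_S x i := hconst (·.p_S x i) fun s hs =>
        apply_congr (congrFun (congrArg Subtype.val (hprim s hs).2) i) x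
      dfield x := by
        rw [hpsi, hobs]
        exact hobsDeriv (·.dfield x) (hsol.hasDerivAt_obsModes_dfield hlam hV hI hb hc ht x)
      dmom x := by
        rw [hpsi, hobs, show lap (obsModes M b t (c t)).toSVT.dfield = _ from lap_coe _]
        exact hobsDeriv (·.dmom x) (hsol.hasDerivAt_obsModes_dmom hlam hV hI hb hc ht x) }

/-! ### The closed equation for the Bardeen potential -/

theorem hasDerivAt_bardeen (hsol : IsLinearSolution M b I m fun t => assemble b t (X t))
    (hlam : M.lam ≠ 0) (hV : ContDiff ℝ ∞ M.V) (hI : IsOpen I) (hb : b.IsSolution M I)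
    (hc : IsModeCurve I X c) (ht : t ∈ I) (x : E3) :
    HasDerivAt (fun s => bardeen b X s x)
      (2 * b.hubble t * ((obsModes M b t (c t)).p.psi x - (obsModes M b t (c t)).q.psi x)) t := by
  refine (hsol.hasDerivAt_obsModes_psi hlam hV hI hb hc ht x).congr_of_eventuallyEq ?_
  filter_upwards [hI.mem_nhds ht] with s hs
  rw [hc.bardeen_eq hb hs]

theorem hasDerivAt_deriv_bardeen (hsol : IsLinearSolution M b I m fun t => assemble b t (X t))
    (hlam : M.lam ≠ 0) (hV : ContDiff ℝ ∞ M.V) (hI : IsOpen I) (hb : b.IsSolution M I)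
    (hc : IsModeCurve I X c) (ht : t ∈ I) (hfield : deriv b.field t ≠ 0) (x : E3) :
    HasDerivAt (deriv fun s => bardeen b X s x)
      (b.N t ^ 2 / b.A t * lap (bardeen b X t) x
        + (M.kappa / 2 * b.N t ^ 2 * b.pressure M t
            - b.N t ^ 2 * b.hubble t / deriv b.field t * deriv M.V (b.field t)
            - 3 * b.hubble t ^ 2) * bardeen b X t x
        + (deriv b.N t / b.N t - 7 * b.hubble t
            - b.N t ^ 2 / deriv b.field t * deriv M.V (b.field t))
          * deriv (fun s => bardeen b X s x) t) t := by
  have ha := hb.sqrt_A_pos ht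
  have hP := hb.P_ne ht
  have hN := (hb.N_pos t ht).ne'
  have hmom := hb.mom_ne ht hfield
  have hAa : √(b.A t) ^ 2 = b.A t := Real.sq_sqrt (hb.A_pos t ht).le
  have h := ((hb.hasDerivAt_hubble hlam hV hI ht).const_mul 2).fun_mul
    ((hsol.hasDerivAt_obsModes_p_psi hlam hV hI hb hc ht x).fun_sub
      (hsol.hasDerivAt_obsModes_psi hlam hV hI hb hc ht x))
  refine (h.congr_of_eventuallyEq ?_).congr_deriv ?_
  · filter_upwards [hI.mem_nhds ht] with s hs
      using (hsol.hasDerivAt_bardeen hlam hV hI hb hc hs x).deriv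
  have hdiff := apply_congr (hsol.diffScalar_obsModes hlam hV hb hc ht) x
  have hham := apply_congr (hsol.hamModes_obsModes hlam hV hb hc ht) x
  have hF := hb.friedmann hlam hV ht
  rw [(hsol.hasDerivAt_bardeen hlam hV hI hb hc ht x).deriv, hc.bardeen_eq hb ht, lap_coe,
    (hb.hasDerivAt_field ht).deriv, hb.hubble_eq ht]
  have hE : (obsModes M b t (c t)).q.E = 0 := rfl
  have hpE : (obsModes M b t (c t)).p.E = 0 := rfl
  generalize obsModes M b t (c t) = d at *
  simp only [diffScalar, hamModes, TensorModes.curvPot, hE, hpE, map_zero, smul_zero, sub_zero,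
    add_zero, coe_add_apply, coe_sub_apply, coe_smul_apply, coe_zero_apply] at hdiff hham
  simp only [deltaT, Modes.toSVT, Background.pressure]
  generalize √(b.A t) = a at *
  rw [← hAa] at hdiff ⊢
  -- `hham` eliminates `δπ` from `δT`, and `hdiff` the remaining `δφ`.
  linear_combination (norm := skip) (-(b.N t ^ 2) / (4 * a ^ 3)) * hham
    + (b.N t ^ 2 * deriv M.V (b.field t) / (4 * M.lam * b.mom t)) * hdiff
    + 3 / 4 * b.N t ^ 2 / a ^ 3 * d.q.psi x * hF
  field_simp
  ring

theorem bardeen_conformal (hsol : IsLinearSolution M b I m fun t => assemble b t (X t))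
    (hlam : M.lam ≠ 0) (hV : ContDiff ℝ ∞ M.V) (hI : IsOpen I) (hb : b.IsSolution M I)
    (hc : IsModeCurve I X c) (hconf : ∀ t ∈ I, b.N t = √(b.A t)) (ht : t ∈ I)
    (hfield : deriv b.field t ≠ 0) (x : E3) :
    deriv (deriv (fun s => bardeen b X s x)) t
      + 2 * (b.hubble t - deriv (deriv b.field) t / deriv b.field t)
        * deriv (fun s => bardeen b X s x) t
      - lap (bardeen b X t) x
      + 2 * (deriv b.hubble t
          - b.hubble t * deriv (deriv b.field) t / deriv b.field t)
        * bardeen b X t x = 0 := by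
  have ha := hb.sqrt_A_pos ht
  have hmom := hb.mom_ne ht hfield
  have hAa : √(b.A t) ^ 2 = b.A t := Real.sq_sqrt (hb.A_pos t ht).le
  rw [(hsol.hasDerivAt_deriv_bardeen hlam hV hI hb hc ht hfield x).deriv,
    hb.deriv_deriv_field_of_conformal hlam hV hI hconf ht, (hb.hasDerivAt_field ht).deriv,
    (hb.hasDerivAt_hubble hlam hV hI ht).deriv, hb.hubble_eq ht,
    hb.deriv_N_of_conformal hI hconf ht, hconf t ht]
  generalize √(b.A t) = a at *
  rw [← hAa]
  field_simp
  ring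

end IsLinearSolution

end Cosmo

end

theorem mainTheorem3 (M : Cosmo.Model) (hκ : 0 < M.kappa) (hlam : M.lam ≠ 0)
    (hV : ContDiff ℝ ∞ M.V)
    (I : Set ℝ) (hI : IsOpen I)
    (b : Cosmo.Background) (hb : b.IsSolution M I)
    (X : ℝ → Cosmo.SVT) (hX : Cosmo.SVT.IsRegularCurve I X)
    (m : ℝ → Cosmo.Descriptor)
    (hsol : Cosmo.IsLinearSolution M b I m (fun t => Cosmo.assemble b t (X t))) :
    (∀ t ∈ I, Cosmo.LongitudinalObservables M b X t) ∧
    (∀ t ∈ I, Cosmo.LongitudinalHamilton M b X t) ∧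
    (∀ t ∈ I, deriv b.field t ≠ 0 → ∀ x : Cosmo.E3,
      HasDerivAt (deriv (fun s => Cosmo.bardeen b X s x))
        (b.N t ^ 2 / b.A t * Cosmo.lap (Cosmo.bardeen b X t) x
          + (M.kappa / 2 * b.N t ^ 2 * b.pressure M t
              - b.N t ^ 2 * b.hubble t / deriv b.field t * deriv M.V (b.field t)
              - 3 * b.hubble t ^ 2) * Cosmo.bardeen b X t x
          + (deriv b.N t / b.N t - 7 * b.hubble t
              - b.N t ^ 2 / deriv b.field t * deriv M.V (b.field t))
            * deriv (fun s => Cosmo.bardeen b X s x) t) t) ∧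
    ((∀ t ∈ I, b.N t = Real.sqrt (b.A t)) →
      ∀ t ∈ I, deriv b.field t ≠ 0 → ∀ x : Cosmo.E3,
        deriv (deriv (fun s => Cosmo.bardeen b X s x)) t
          + 2 * (b.hubble t - deriv (deriv b.field) t / deriv b.field t)
            * deriv (fun s => Cosmo.bardeen b X s x) t
          - Cosmo.lap (Cosmo.bardeen b X t) x
          + 2 * (deriv b.hubble t
              - b.hubble t * deriv (deriv b.field) t / deriv b.field t)
            * Cosmo.bardeen b X t x = 0) := by
  obtain ⟨c, hc⟩ := hX.exists_isModeCurve hI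
  exact ⟨fun t ht => Cosmo.longitudinalObservables hlam hV hI hb hc ht,
    fun t ht => hsol.longitudinalHamilton hlam hV hI hb hc ht,
    fun t ht hfield x => hsol.hasDerivAt_deriv_bardeen hlam hV hI hb hc ht hfield x,
    fun hconf t ht hfield x => hsol.bardeen_conformal hlam hV hI hb hc hconf ht hfield x⟩
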